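/- **Definitions.** Write $[x]_+=\max(0,x)$ and let $\mathcal B^n=\{x\in\mathbb R^n:\|x\|_2\le 1\}$. For a constant $k$, an instance of the *bounded sum of $k$-ReLU training problem* is a nonempty multiset $S=\{(\mathbf x_i,y_i)\}_{i\in[m]}$ of labelled samples with $\mathbf x_i\in\mathcal B^n$ and $y_i\in[-k,k]$. The goal is to minimize, over $\mathbf w^1,\dots,\mathbf w^k\in\mathcal B^n$, the average squared error $$\mathcal L(\mathbf w^1,\dots,\mathbf w^k;S)=\frac1m\sum_{i=1}^m\Big(\sum_{j=1}^k[\langle \mathbf w^j,\mathbf x_i\rangle]_+-y_i\Big)^2 .$$ The instance is *realizable* if $\mathcal L(\mathbf w^1,\dots,\mathbf w^k;S)=0$ for some $\mathbf w^1,\dots,\mathbf w^k\in\mathcal B^n$. An algorithm solves the problem *within additive error $\varepsilon$* on $S$ if it outputs $\mathbf w^1,\dots,\mathbf w^k\in\mathcal B^n$ with $\mathcal L(\mathbf w^1,\dots,\mathbf w^k;S)\le\min_{\mathbf v^1,\dots,\mathbf v^k\in\mathcal B^n}\mathcal L(\mathbf v^1,\dots,\mathbf v^k;S)+\varepsilon$.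 Algorithms are deterministic and work on bit strings (multi-stack machines, equivalent to multitape Turing machines up to polynomial overhead); the numbers in the input and the output are rationals written in binary. **Gap-ETH.** There is a constant $\delta>0$ such that no algorithm, given a 3CNF formula $\varphi$ with $n$ Boolean variables (clauses may be repeated), always halts within time $2^{o(n)}\,\mathrm{poly}(|\varphi|)$, where $|\varphi|$ is the length of $\varphi$, and distinguishes between (i) $\varphi$ is satisfiable, and (ii) every assignment violates more than a $\delta$ fraction of the clauses of $\varphi$. **Theorem.** Assume Gap-ETH. Then for every constant integer $k\ge 2$ there are no algorithm $A$, function $g$ with $g(\varepsilon)=o(1/\varepsilon)$ as $\varepsilon\to0^+$, and polynomial $P$ such that, for all $n$, all rational $\varepsilon>0$ and all rational instances $S$ in dimension $n$ of the bounded sum of $k$-ReLU training problem, $A$ on input $(n,S,\varepsilon)$ halts within time $2^{g(\varepsilon)}P(L)$, where $L$ is the length of the input (so $L\ge n$ and $L\ge m$), and, whenever $S$ is realizable, solves the problem on $S$ within additive error $\varepsilon$. That is, no $2^{o(1/\varepsilon)}\mathrm{poly}(n,m)$-time algorithm solves the bounded sum of $k$-ReLU training problem within additive squared error $\varepsilon$,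 even in the realizable case. -/

import Mathlib

namespace ReLUTraining

/-! ### Machine model

A multi-stack machine, written as a structured program.  Register `r` holds a stack of bits; an
elementary operation pushes, pops or inspects one bit and costs one step.  Only finitely many
registers occur in a program.  Such machines and multitape Turing machines simulate each other
with polynomial overhead. -/

abbrev Store := ℕ → List Bool

inductive Prog : Type
  | skip : Prog
  | push (r : ℕ) (b : Bool) : Prog
  | pop (r : ℕ) : Prog
  | seq (p q : Prog) : Prog
  /-- `branch r p q₀ q₁` continues with `p`, `q₀` or `q₁` if register `r` is empty, has top bit
  `false`, or has top bit `true`, respectively. -/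
  | branch (r : ℕ) (p q₀ q₁ : Prog) : Prog
  /-- `loop r p` repeats `p` as long as register `r` is not empty. -/
  | loop (r : ℕ) (p : Prog) : Prog

/-- `Run p s t s'`: the program `p`, started in the store `s`, halts after exactly `t` steps in the
store `s'`. -/
inductive Run : Prog → Store → ℕ → Store → Prop
  | skip (s : Store) : Run .skip s 1 s
  | push (r : ℕ) (b : Bool) (s : Store) :
      Run (.push r b) s 1 (Function.update s r (b :: s r))
  | pop (r : ℕ) (s : Store) :
      Run (.pop r) s 1 (Function.update s r (s r).tail)
  | seq {p q : Prog} {s s' s'' : Store} {t t' : ℕ} :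
      Run p s t s' → Run q s' t' s'' → Run (.seq p q) s (t + t') s''
  | branchNil {r : ℕ} {p q₀ q₁ : Prog} {s s' : Store} {t : ℕ} :
      s r = [] → Run p s t s' → Run (.branch r p q₀ q₁) s (t + 1) s'
  | branchFalse {r : ℕ} {p q₀ q₁ : Prog} {s s' : Store} {t : ℕ} :
      (s r).head? = some false → Run q₀ s t s' → Run (.branch r p q₀ q₁) s (t + 1) s'
  | branchTrue {r : ℕ} {p q₀ q₁ : Prog} {s s' : Store} {t : ℕ} :
      (s r).head? = some true → Run q₁ s t s' → Run (.branch r p q₀ q₁) s (t + 1) s'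
  | loopDone {r : ℕ} {p : Prog} {s : Store} :
      s r = [] → Run (.loop r p) s 1 s
  | loopStep {r : ℕ} {p : Prog} {s s' s'' : Store} {t t' : ℕ} :
      s r ≠ [] → Run p s t s' → Run (.loop r p) s' t' s'' →
        Run (.loop r p) s (t + t' + 1) s''

/-- Input `x` in register `0`, all other registers empty. -/
def initStore (x : List Bool) : Store := Function.update (fun _ => []) 0 x

/-- On input `x` the program halts after at most `T` steps with output `y` in register `0`. -/
def Prog.OutputsWithin (p : Prog) (x y : List Bool) (T : ℝ) : Prop :=
  ∃ (t : ℕ) (s : Store), Run p (initStore x) t s ∧ (t : ℝ) ≤ T ∧ s 0 = y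

/-! ### Encodings by bit strings (self-delimiting) -/

def encUnary (n : ℕ) : List Bool := List.replicate n true ++ [false]

/-- Binary, least significant bit first; each bit is preceded by the marker `true`. -/
def encNat (n : ℕ) : List Bool := (n.bits.flatMap fun b => [true, b]) ++ [false]

/-- Sign and absolute value of the numerator, then the denominator, in lowest terms. -/
def encRat (q : ℚ) : List Bool := decide (q < 0) :: (encNat q.num.natAbs ++ encNat q.den)

def encList {α : Type} (e : α → List Bool) (l : List α) : List Bool :=
  (l.flatMap fun a => true :: e a) ++ [false]

def encVec {n : ℕ} (v : Fin n → ℚ) : List Bool := encList encRat (List.ofFn v)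

/-! ### 3CNF formulas and the Gap Exponential Time Hypothesis -/

/-- A variable together with the truth value that makes the literal true. -/
abbrev Literal (n : ℕ) := Fin n × Bool

/-- A disjunction of three literals; repetitions are allowed, so shorter clauses are covered. -/
abbrev Clause3 (n : ℕ) := Fin 3 → Literal n

/-- A 3CNF formula with `n` Boolean variables. -/
abbrev CNF3 (n : ℕ) := List (Clause3 n)

def Clause3.eval {n : ℕ} (a : Fin n → Bool) (c : Clause3 n) : Bool :=
  decide (∃ i, a (c i).1 = (c i).2)

def CNF3.Satisfiable {n : ℕ} (φ : CNF3 n) : Prop :=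
  ∃ a : Fin n → Bool, ∀ c ∈ φ, Clause3.eval a c = true

/-- The number of clauses that the assignment `a` violates. -/
def CNF3.violated {n : ℕ} (φ : CNF3 n) (a : Fin n → Bool) : ℕ :=
  φ.countP fun c => !(Clause3.eval a c)

def encLiteral {n : ℕ} (l : Literal n) : List Bool := l.2 :: encUnary l.1

def encCNF3 {n : ℕ} (φ : CNF3 n) : List Bool :=
  encUnary n ++ encList (fun c : Clause3 n => encList encLiteral (List.ofFn c)) φ

/-- Gap-ETH: for some constant `δ > 0`, no algorithm with running time `2^{o(n)}` (times a
polynomial in the length of the input, since clauses may be repeated) distinguishes satisfiable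
3CNF formulas with `n` variables from those in which every assignment violates more than a
`δ` fraction of the clauses. -/
def GapETH : Prop :=
  ∃ δ : ℝ, 0 < δ ∧
    ¬ ∃ (p : Prog) (f : ℕ → ℝ) (P : Polynomial ℕ),
      Asymptotics.IsLittleO Filter.atTop f (fun n : ℕ => (n : ℝ)) ∧
      ∀ (n : ℕ) (φ : CNF3 n), ∃ b : Bool,
        p.OutputsWithin (encCNF3 φ) [b]
          ((2 : ℝ) ^ (f n) * ((P.eval (encCNF3 φ).length : ℕ) : ℝ)) ∧
        (CNF3.Satisfiable φ → b = true) ∧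
        ((∀ a : Fin n → Bool, δ * (φ.length : ℝ) < (CNF3.violated φ a : ℝ)) → b = false)

/-! ### Training a sum of `k` ReLUs -/

def rectifier (x : ℝ) : ℝ := max 0 x

/-- The depth-2 network `z ↦ ∑ j, a j * [⟨w j, z⟩]₊`. -/
noncomputable def relu {n k : ℕ} (w : Fin k → EuclideanSpace ℝ (Fin n)) (a : Fin k → ℝ)
    (z : EuclideanSpace ℝ (Fin n)) : ℝ :=
  ∑ j, a j * rectifier (inner ℝ (w j) z)

/-- Average squared error of the sum of `k` ReLUs (all coefficients equal to `1`) with weight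
vectors `w` on the multiset `S` of labelled samples. -/
noncomputable def loss {n k : ℕ} (w : Fin k → EuclideanSpace ℝ (Fin n))
    (S : List (EuclideanSpace ℝ (Fin n) × ℝ)) : ℝ :=
  (S.map fun z => (relu w 1 z.1 - z.2) ^ 2).sum / (S.length : ℝ)

/-- All weight vectors lie in the closed unit ball. -/
def BoundedWeights {n k : ℕ} (w : Fin k → EuclideanSpace ℝ (Fin n)) : Prop :=
  ∀ j, ‖w j‖ ≤ 1

/-- An instance of the bounded problem: points in the closed unit ball, labels in `[-k, k]`. -/
def BoundedSamples {n : ℕ} (k : ℕ) (S : List (EuclideanSpace ℝ (Fin n) × ℝ)) : Prop :=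
  ∀ z ∈ S, ‖z.1‖ ≤ 1 ∧ z.2 ∈ Set.Icc (-(k : ℝ)) (k : ℝ)

/-- Some bounded sum of `k` ReLUs has zero training error. -/
def Realizable {n : ℕ} (k : ℕ) (S : List (EuclideanSpace ℝ (Fin n) × ℝ)) : Prop :=
  ∃ w : Fin k → EuclideanSpace ℝ (Fin n), BoundedWeights w ∧ loss w S = 0

/-- `w` is feasible and within additive error `ε` of the minimum of the bounded problem. -/
def IsSolution {n k : ℕ} (S : List (EuclideanSpace ℝ (Fin n) × ℝ)) (ε : ℝ)
    (w : Fin k → EuclideanSpace ℝ (Fin n)) : Prop :=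
  BoundedWeights w ∧
    ∀ w' : Fin k → EuclideanSpace ℝ (Fin n), BoundedWeights w' → loss w S ≤ loss w' S + ε

/-- A rational vector as a point of Euclidean space. -/
noncomputable def toReal {n : ℕ} (v : Fin n → ℚ) : EuclideanSpace ℝ (Fin n) :=
  WithLp.toLp 2 fun i => (v i : ℝ)

/-- Rational labelled samples: what an algorithm receives. -/
abbrev RatSamples (n : ℕ) := List ((Fin n → ℚ) × ℚ)

noncomputable def RatSamples.toReal {n : ℕ} (S : RatSamples n) :
    List (EuclideanSpace ℝ (Fin n) × ℝ) :=
  List.map (fun z => (ReLUTraining.toReal z.1, (z.2 : ℝ))) S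

/-- The input: the dimension, the error parameter, and the samples. -/
def encInstance {n : ℕ} (S : RatSamples n) (ε : ℚ) : List Bool :=
  encUnary n ++ encRat ε ++
    encList (fun z : (Fin n → ℚ) × ℚ => encVec z.1 ++ encRat z.2) S

/-- The output: the `k` weight vectors. -/
def encWeights {n k : ℕ} (w : Fin k → Fin n → ℚ) : List Bool :=
  encList encVec (List.ofFn w)

/-- The program `A` solves the bounded sum of `k`-ReLU training problem within any given additive
error `ε > 0` on every realizable input.  Its running time is at most
`2^{g ε} * P (input length)` on every input; no answer is prescribed on inputs that are not
realizable. -/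
def SolvesRealizable (k : ℕ) (A : Prog) (g : ℝ → ℝ) (P : Polynomial ℕ) : Prop :=
  ∀ (n : ℕ) (S : RatSamples n) (ε : ℚ), S ≠ [] → 0 < ε → BoundedSamples k S.toReal →
    ∃ y : List Bool,
      A.OutputsWithin (encInstance S ε) y
        ((2 : ℝ) ^ (g (ε : ℝ)) * ((P.eval (encInstance S ε).length : ℕ) : ℝ)) ∧
      (Realizable k S.toReal →
        ∃ w : Fin k → Fin n → ℚ, y = encWeights w ∧
          IsSolution S.toReal (ε : ℝ) fun j => toReal (w j))

end ReLUTraining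

/-! ### Runs with a time bound. -/

namespace ReLUTraining
open Function

/-! Gap-3SAT on `n` variables reduces to training with `ε` of order `1/n`, so a running time
`2^{o(1/ε)}` becomes `2^{o(n)}`. The scale is forced by the unit ball: a weight vector spelling out
a truth assignment by signs has entries `±C` with `C = 2^{-e}` of order `1/√n` (`3n < 4^e ≤ 12n`, `e
= halfLog n`). A violated clause then costs a squared error of order `C²`, with a constant depending
on `k` only.

The instance lives in dimension `n + k`, and every clause contributes the same list `kinds k` of
samples. Write `u l` and `p l` for the variable and the auxiliary part of the weight vector of unit
`l`.

Samples on the auxiliary coordinates alone force `p`, up to renumbering the units by a permutation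
`σ`, to be close to half the identity matrix (`exists_perm_of_aux`). Units thus become identifiable:
a negative entry at an auxiliary coordinate pushes down the unit that owns it. The variable samples
switch off all units except `σ 0` and `σ 1`. They ask for the same output `bC` at a scaled literal
and at its negative, so one of the two units has value about `C` and the other about `-C`
(`le_abs_of_two_units`). The clause sample has label `0` and asks that, for unit `σ 0`, the three
literal values sum to at least `-C`, which excludes exactly the case that all three are `-C`
(`exists_literal_pos`).

Completeness (`sampleError_eq_zero`, `boundedWeights_codeNet`): a satisfying assignment, written in
unit `0` and negated in unit `1`, gives a network with loss zero. Soundness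
(`exists_unit_rounding`): if the loss is at most `ε`, the signs of `u (σ 0)` violate at most a `1/D`
fraction of the clauses, because each violated clause costs at least `(bC/10)²`.

The decision procedure writes the instance, runs `A`, rounds each of the `k` output vectors by signs
(it does not know `σ`) and checks the fraction of violated clauses directly. As accepted assignments
are checked, nothing has to be known about `A` on unrealizable inputs except that it halts in time.
The rest implements this on the stack machine in polynomial time; all numbers depending on `n` are
`±` powers of two, so that no arithmetic is needed to write them. -/

/-- Started in `s`, the program `p` halts in `s'` after at most `T` steps. -/
def Reach (p : Prog) (s : Store) (T : ℕ) (s' : Store) : Prop := ∃ t ≤ T, Run p s t s'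

namespace Reach

theorem mono {p : Prog} {s s' : Store} {T T' : ℕ} (h : Reach p s T s') (hT : T ≤ T') :
    Reach p s T' s' := by
  obtain ⟨t, ht, hr⟩ := h
  exact ⟨t, ht.trans hT, hr⟩

theorem of_eq {p : Prog} {s s' s'' : Store} {T : ℕ} (h : Reach p s T s') (hs : s' = s'') :
    Reach p s T s'' := hs ▸ h

theorem skip (s : Store) : Reach .skip s 1 s := ⟨1, le_rfl, .skip s⟩

theorem push (r : ℕ) (b : Bool) (s : Store) :
    Reach (.push r b) s 1 (update s r (b :: s r)) := ⟨1, le_rfl, .push r b s⟩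

theorem pop (r : ℕ) (s : Store) : Reach (.pop r) s 1 (update s r (s r).tail) :=
  ⟨1, le_rfl, .pop r s⟩

theorem seq {p q : Prog} {s s' s'' : Store} {T T' : ℕ} (h : Reach p s T s')
    (h' : Reach q s' T' s'') : Reach (.seq p q) s (T + T') s'' := by
  obtain ⟨t, ht, hr⟩ := h
  obtain ⟨t', ht', hr'⟩ := h'
  exact ⟨t + t', add_le_add ht ht', .seq hr hr'⟩

theorem branch_nil {r : ℕ} {p q₀ q₁ : Prog} {s s' : Store} {T : ℕ} (hs : s r = [])
    (h : Reach p s T s') : Reach (.branch r p q₀ q₁) s (T + 1) s' := by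
  obtain ⟨t, ht, hr⟩ := h
  exact ⟨t + 1, by omega, .branchNil hs hr⟩

theorem branch_false {r : ℕ} {p q₀ q₁ : Prog} {s s' : Store} {T : ℕ} {l : List Bool}
    (hs : s r = false :: l) (h : Reach q₀ s T s') : Reach (.branch r p q₀ q₁) s (T + 1) s' := by
  obtain ⟨t, ht, hr⟩ := h
  exact ⟨t + 1, by omega, .branchFalse (by simp [hs]) hr⟩

theorem branch_true {r : ℕ} {p q₀ q₁ : Prog} {s s' : Store} {T : ℕ} {l : List Bool}
    (hs : s r = true :: l) (h : Reach q₁ s T s') : Reach (.branch r p q₀ q₁) s (T + 1) s' := by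
  obtain ⟨t, ht, hr⟩ := h
  exact ⟨t + 1, by omega, .branchTrue (by simp [hs]) hr⟩

theorem loop_done {r : ℕ} {p : Prog} {s : Store} (hs : s r = []) : Reach (.loop r p) s 1 s :=
  ⟨1, le_rfl, .loopDone hs⟩

theorem loop_step {r : ℕ} {p : Prog} {s s' s'' : Store} {T T' : ℕ} (hs : s r ≠ [])
    (h : Reach p s T s') (h' : Reach (.loop r p) s' T' s'') :
    Reach (.loop r p) s (T + T' + 1) s'' := by
  obtain ⟨t, ht, hr⟩ := h
  obtain ⟨t', ht', hr'⟩ := h'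
  exact ⟨t + t' + 1, by omega, .loopStep hs hr hr'⟩

end Reach

/-- A step pushes at most one bit, so time bounds are also length bounds. This controls the size of
the written instance and of the output of `A`. -/
theorem Run.length_le {p : Prog} {s s' : Store} {t : ℕ} (h : Run p s t s') (r : ℕ) :
    (s' r).length ≤ (s r).length + t := by
  induction h with
  | skip => omega
  | push r' b s => by_cases h : r = r' <;> simp [h]
  | pop r' s => by_cases h : r = r' <;> simp [h]; omega
  | seq _ _ h1 h2 => omega
  | branchNil _ _ h => omega
  | branchFalse _ _ h => omega
  | branchTrue _ _ h => omega
  | loopDone => omega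
  | loopStep _ _ _ h1 h2 => omega

/-! ### Running a program on renamed registers -/

/-- `A` may use arbitrary registers; shifting it protects the registers below `K`, which keep the
formula for the verification afterwards. -/
def Prog.shift (K : ℕ) : Prog → Prog
  | .skip => .skip
  | .push r b => .push (r + K) b
  | .pop r => .pop (r + K)
  | .seq p q => .seq (p.shift K) (q.shift K)
  | .branch r p q₀ q₁ => .branch (r + K) (p.shift K) (q₀.shift K) (q₁.shift K)
  | .loop r p => .loop (r + K) (p.shift K)

/-- The store with `lo` in the registers below `K` and `hi` in the others. -/
def joinStore (K : ℕ) (lo hi : Store) : Store := fun r => if r < K then lo r else hi (r - K)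

@[simp] theorem joinStore_add (K : ℕ) (lo hi : Store) (r : ℕ) :
    joinStore K lo hi (r + K) = hi r := by simp [joinStore]

theorem update_joinStore_add (K : ℕ) (lo hi : Store) (r : ℕ) (v : List Bool) :
    update (joinStore K lo hi) (r + K) v = joinStore K lo (update hi r v) := by
  funext i
  by_cases hi' : i < K
  · simp [joinStore, hi', update_apply]; omega
  · have : i = r + K ↔ i - K = r := by omega
    simp [joinStore, hi', update_apply, this]

theorem Run.shift {p : Prog} {s s' : Store} {t : ℕ} (h : Run p s t s') (K : ℕ) (lo : Store) :
    Run (p.shift K) (joinStore K lo s) t (joinStore K lo s') := by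
  induction h with
  | skip => exact .skip _
  | push r b s =>
    have := Run.push (r + K) b (joinStore K lo s)
    rwa [update_joinStore_add, joinStore_add] at this
  | pop r s =>
    have := Run.pop (r + K) (joinStore K lo s)
    rwa [update_joinStore_add, joinStore_add] at this
  | seq _ _ h1 h2 => exact .seq h1 h2
  | branchNil hs _ h => exact .branchNil (by simpa using hs) h
  | branchFalse hs _ h => exact .branchFalse (by simpa using hs) h
  | branchTrue hs _ h => exact .branchTrue (by simpa using hs) h
  | loopDone hs => exact .loopDone (by simpa using hs)
  | loopStep hs _ _ h1 h2 => exact .loopStep (by simpa using hs) h1 h2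

/-! ### Elementary routines -/

def pushAll (r : ℕ) : List Bool → Prog
  | [] => .skip
  | b :: l => .seq (.push r b) (pushAll r l)

theorem reach_pushAll (r : ℕ) (l : List Bool) (s : Store) :
    Reach (pushAll r l) s (l.length + 1) (update s r (l.reverse ++ s r)) := by
  induction l generalizing s with
  | nil => exact (Reach.skip s).of_eq (by simp)
  | cons b l ih =>
    refine (((Reach.push r b s).seq (ih _)).mono ?_).of_eq ?_
    · simp only [List.length_cons]; omega
    · simp

def clear (r : ℕ) : Prog := .loop r (.pop r)

theorem reach_clear (r : ℕ) (s : Store) :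
    Reach (clear r) s (2 * (s r).length + 1) (update s r []) := by
  generalize hl : s r = l
  induction l generalizing s with
  | nil => exact (Reach.loop_done hl).of_eq (by simp [← hl])
  | cons b l ih =>
    refine ((Reach.loop_step (by simp [hl]) (Reach.pop r s) (ih _ (by simp [hl]))).mono ?_).of_eq ?_
    · simp only [List.length_cons]; omega
    · simp

/-- Empties register `a` onto register `b`. -/
def move (a b : ℕ) : Prog :=
  .loop a (.branch a .skip (.seq (.pop a) (.push b false)) (.seq (.pop a) (.push b true)))

theorem reach_move {a b : ℕ} (hab : a ≠ b) (s : Store) :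
    Reach (move a b) s (4 * (s a).length + 1)
      (update (update s a []) b ((s a).reverse ++ s b)) := by
  generalize hl : s a = l
  induction l generalizing s with
  | nil =>
    refine (Reach.loop_done hl).of_eq ?_
    funext r
    simp only [update_apply]
    split_ifs <;> simp_all
  | cons x l ih =>
    have step : Reach (.branch a .skip (.seq (.pop a) (.push b false))
        (.seq (.pop a) (.push b true))) s 3 (update (update s a l) b (x :: s b)) := by
      cases x
      · exact (Reach.branch_false hl ((Reach.pop a s).seq (Reach.push b false _))).of_eq
          (by simp [hl, hab.symm])
      · exact (Reach.branch_true hl ((Reach.pop a s).seq (Reach.push b true _))).of_eq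
          (by simp [hl, hab.symm])
    refine ((Reach.loop_step (by simp [hl]) step (ih _ (by simp [hab]))).mono ?_).of_eq ?_
    · simp only [List.length_cons]; omega
    · funext r
      simp only [update_apply, List.reverse_cons, List.append_assoc]
      split_ifs <;> simp_all

/-- Empties register `x` onto both of the registers `a` and `b`. -/
def moveBoth (x a b : ℕ) : Prog :=
  .loop x (.branch x .skip (.seq (.pop x) (.seq (.push a false) (.push b false)))
    (.seq (.pop x) (.seq (.push a true) (.push b true))))

theorem reach_moveBoth {x a b : ℕ} (hxa : x ≠ a) (hxb : x ≠ b) (hab : a ≠ b) (s : Store) :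
    Reach (moveBoth x a b) s (5 * (s x).length + 1)
      (update (update (update s x []) a ((s x).reverse ++ s a)) b ((s x).reverse ++ s b)) := by
  generalize hl : s x = l
  induction l generalizing s with
  | nil =>
    refine (Reach.loop_done hl).of_eq ?_
    funext r
    simp only [update_apply]
    split_ifs <;> simp_all
  | cons y l ih =>
    have step : Reach (.branch x .skip (.seq (.pop x) (.seq (.push a false) (.push b false)))
        (.seq (.pop x) (.seq (.push a true) (.push b true)))) s 4
        (update (update (update s x l) a (y :: s a)) b (y :: s b)) := by
      cases y
      · exact (Reach.branch_false hl ((Reach.pop x s).seq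
          ((Reach.push a false _).seq (Reach.push b false _)))).of_eq
          (by simp [hl, hxa.symm, hxb.symm, hab.symm])
      · exact (Reach.branch_true hl ((Reach.pop x s).seq
          ((Reach.push a true _).seq (Reach.push b true _)))).of_eq
          (by simp [hl, hxa.symm, hxb.symm, hab.symm])
    refine ((Reach.loop_step (by simp [hl]) step (ih _ (by simp [hxa, hxb]))).mono ?_).of_eq ?_
    · simp only [List.length_cons]; omega
    · funext r
      simp only [update_apply, List.reverse_cons, List.append_assoc]
      split_ifs <;> simp_all

/-- Copies register `a` to the empty register `b`, using the empty register `x`. -/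
def copy (a b x : ℕ) : Prog := .seq (move a x) (moveBoth x a b)

theorem reach_copy {a b x : ℕ} (hab : a ≠ b) (hxa : x ≠ a) (hxb : x ≠ b) {s : Store}
    (hb : s b = []) (hx : s x = []) :
    Reach (copy a b x) s (9 * (s a).length + 2) (update s b (s a)) := by
  refine (((reach_move hxa.symm s).seq (reach_moveBoth hxa hxb hab _)).mono ?_).of_eq ?_
  · simp [hx]; omega
  · funext r
    simp only [update_apply]
    split_ifs <;> simp_all

/-- Moves a block `1ⁱ0` from the top of register `w` to register `j`, using the empty
register `f`. -/
def takeUnary (w j f : ℕ) : Prog :=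
  .seq (.push f true) (.loop f (.branch w (.pop f)
    (.seq (.pop w) (.seq (.push j false) (.pop f))) (.seq (.pop w) (.push j true))))

theorem reach_takeUnary {w j f : ℕ} (hwj : w ≠ j) (hwf : w ≠ f) (hjf : j ≠ f) {s : Store}
    {i : ℕ} {l : List Bool} (hf : s f = []) (hw : s w = List.replicate i true ++ false :: l) :
    Reach (takeUnary w j f) s (4 * i + 7)
      (update (update s w l) j (false :: List.replicate i true ++ s j)) := by
  -- Loops can only test emptiness, so the one-bit register `f` is the loop condition and is popped
  -- when the terminating `false` is met.
  have key : ∀ (i : ℕ) (s : Store), s f = [true] → s w = List.replicate i true ++ false :: l →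
      Reach (.loop f (.branch w (.pop f)
        (.seq (.pop w) (.seq (.push j false) (.pop f))) (.seq (.pop w) (.push j true)))) s
        (4 * i + 6)
        (update (update (update s f []) w l) j (false :: List.replicate i true ++ s j)) := by
    intro i
    induction i with
    | zero =>
      intro s hf hw
      refine ((Reach.loop_step (by simp [hf]) (Reach.branch_false (by simpa using hw)
        ((Reach.pop w s).seq ((Reach.push j false _).seq (Reach.pop f _))))
        (Reach.loop_done (by simp [hf, hwf.symm, hjf.symm]))).mono (by omega)).of_eq ?_
      funext r
      simp only [update_apply]
      split_ifs <;> simp_all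
    | succ i ih =>
      intro s hf hw
      refine ((Reach.loop_step (by simp [hf]) (Reach.branch_true
        (l := List.replicate i true ++ false :: l) (by simpa [List.replicate_succ] using hw)
        ((Reach.pop w s).seq (Reach.push j true _)))
        (ih _ (by simp [hf, hwf.symm, hjf.symm])
          (by simp [hw, hwj, List.replicate_succ]))).mono (by omega)).of_eq ?_
      funext r
      have h1 : List.replicate i true ++ true :: s j = List.replicate (i + 1) true ++ s j := by
        rw [List.replicate_succ']; simp
      simp only [update_apply]
      split_ifs <;> simp_all
  refine (((Reach.push f true s).seq (key i _ (by simp [hf]) (by simp [hw, hwf]))).mono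
    (by omega)).of_eq ?_
  funext r
  simp only [update_apply]
  split_ifs <;> simp_all

/-! ### Tokens: bit strings with a parameter -/

/-- The encoding of a trailing block of `e` zero bits. -/
def chunk (e : ℕ) : List Bool := (List.replicate e [true, false]).flatten

theorem chunk_succ (e : ℕ) : chunk (e + 1) = true :: false :: chunk e := by
  simp [chunk, List.replicate_succ]

theorem chunk_add (a e : ℕ) : chunk (a + e) = chunk a ++ chunk e := by
  rw [chunk, List.replicate_add, List.flatten_append]; rfl

/-- A token list stands for a bit string that depends on a parameter `e`; the token `none` stands
for `chunk e`. -/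
abbrev Tokens := List (Option Bool)

def Tokens.eval (e : ℕ) (l : Tokens) : List Bool :=
  l.flatMap fun o => o.elim (chunk e) fun b => [b]

theorem Tokens.eval_append (e : ℕ) (l l' : Tokens) :
    Tokens.eval e (l ++ l') = Tokens.eval e l ++ Tokens.eval e l' := List.flatMap_append

theorem Tokens.eval_cons (e : ℕ) (o : Option Bool) (l : Tokens) :
    Tokens.eval e (o :: l) = o.elim (chunk e) (fun b => [b]) ++ Tokens.eval e l :=
  List.flatMap_cons

theorem Tokens.eval_map_some (e : ℕ) (l : List Bool) : Tokens.eval e (l.map some) = l := by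
  induction l with
  | nil => rfl
  | cons b l ih => rw [List.map_cons, Tokens.eval_cons, ih]; rfl

theorem Tokens.eval_flatMap {α : Type} (e : ℕ) (l : List α) (f : α → Tokens) :
    Tokens.eval e (l.flatMap f) = l.flatMap fun a => Tokens.eval e (f a) := by
  induction l with
  | nil => rfl
  | cons b l ih => rw [List.flatMap_cons, Tokens.eval_append, ih, List.flatMap_cons]

theorem bits_two_pow (m : ℕ) : (2 ^ m).bits = List.replicate m false ++ [true] := by
  induction m with
  | zero => simp
  | succ m ih => rw [pow_succ', Nat.bit0_bits _ (by positivity), ih]; rfl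

theorem encNat_two_pow (m : ℕ) : encNat (2 ^ m) = chunk m ++ [true, true, false] := by
  have : (List.replicate m false).flatMap (fun b => [true, b]) = chunk m := by
    induction m with
    | zero => rfl
    | succ m ih => rw [List.replicate_succ, List.flatMap_cons, ih, chunk_succ]; rfl
  simp [encNat, bits_two_pow, List.flatMap_append, this]

theorem encNat_one : encNat 1 = [true, true, false] := by simpa [chunk] using encNat_two_pow 0

/-- Numerator `1` and a power of two as denominator: the exponent shows only in the length of a
block of zero bits. This is why `e` enters the output as repetitions of one pattern. -/
theorem encRat_inv_two_pow (m : ℕ) :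
    encRat ((2 ^ m : ℚ)⁻¹) = [false, true, true, false] ++ chunk m ++ [true, true, false] := by
  have hpos : (0 : ℤ) < 2 ^ m := by positivity
  have h1 : ((2 ^ m : ℚ)⁻¹).num = 1 := by
    have := Rat.inv_natCast_num_of_pos (a := 2 ^ m) (by positivity)
    push_cast at this; exact this
  have h2 : ((2 ^ m : ℚ)⁻¹).den = 2 ^ m := by
    have := Rat.inv_natCast_den_of_pos (a := 2 ^ m) (by positivity)
    push_cast at this; exact this
  have h3 : ¬ ((2 ^ m : ℚ)⁻¹ < 0) := by
    have : (0 : ℚ) < (2 ^ m : ℚ)⁻¹ := by positivity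
    linarith
  simp [encRat, h1, h2, h3, encNat_two_pow, encNat_one]

theorem encRat_neg_inv_two_pow (m : ℕ) :
    encRat (-(2 ^ m : ℚ)⁻¹) = [true, true, true, false] ++ chunk m ++ [true, true, false] := by
  have h := encRat_inv_two_pow m
  have h3 : ¬ ((2 ^ m : ℚ)⁻¹ < 0) := by
    have : (0 : ℚ) < (2 ^ m : ℚ)⁻¹ := by positivity
    linarith
  have h4 : -(2 ^ m : ℚ)⁻¹ < 0 := by
    have : (0 : ℚ) < (2 ^ m : ℚ)⁻¹ := by positivity
    linarith
  unfold encRat at h ⊢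
  rw [decide_eq_false h3] at h
  rw [decide_eq_true h4, Rat.num_neg_eq_neg_num, Rat.den_neg_eq_den, Int.natAbs_neg]
  simpa using h

/-- A rational constant, or `± 2 ^ (-(a + e))` for the parameter `e`. -/
inductive Scalar : Type
  | const (q : ℚ) : Scalar
  | pos (a : ℕ) : Scalar
  | neg (a : ℕ) : Scalar

namespace Scalar

def val (e : ℕ) : Scalar → ℚ
  | const q => q
  | pos a => (2 ^ (a + e))⁻¹
  | neg a => -(2 ^ (a + e))⁻¹

def tokens : Scalar → Tokens
  | const q => (encRat q).map some
  | pos a => ([false, true, true, false] ++ chunk a).map some ++ none ::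
      [true, true, false].map some
  | neg a => ([true, true, true, false] ++ chunk a).map some ++ none ::
      [true, true, false].map some

theorem eval_tokens (e : ℕ) (x : Scalar) : x.tokens.eval e = encRat (x.val e) := by
  cases x with
  | const q => exact Tokens.eval_map_some _ _
  | pos a =>
    rw [tokens, Tokens.eval_append, Tokens.eval_map_some, Tokens.eval_cons, Tokens.eval_map_some,
      val, encRat_inv_two_pow, chunk_add]
    simp
  | neg a =>
    rw [tokens, Tokens.eval_append, Tokens.eval_map_some, Tokens.eval_cons, Tokens.eval_map_some,
      val, encRat_neg_inv_two_pow, chunk_add]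
    simp

end Scalar

/-! ### The training instance of a formula -/

/-- A kind of sample: signed multiplicities of the three literals of a clause, the last `k`
coordinates, and the label. -/
structure Kind (k : ℕ) where
  mult : Fin 3 → ℤ
  aux : Fin k → Scalar
  label : Scalar

/-- The contribution to coordinate `i` of a literal with multiplicity `z`. -/
def literalCoeff (l : ℕ × Bool) (z : ℤ) (i : ℕ) : ℤ :=
  if l.1 = i then (if l.2 then z else -z) else 0

/-- Contributions are added, so clauses with repeated or opposite literals need no special
treatment. -/
def clauseCoeff (l : Fin 3 → ℕ × Bool) (z : Fin 3 → ℤ) (i : ℕ) : ℤ :=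
  literalCoeff (l 0) (z 0) i + literalCoeff (l 1) (z 1) i + literalCoeff (l 2) (z 2) i

def Clause3.lits {n : ℕ} (c : Clause3 n) (t : Fin 3) : ℕ × Bool := ((c t).1, (c t).2)

/-- The size of the coordinates that belong to Boolean variables. -/
def varScale (k : ℕ) : ℚ := (2 ^ (k + 4))⁻¹

/-- The scale of the first `n` coordinates does not involve `n`: they take finitely many values for
a given kind, whose codes can be built into the program. The dependence on `e` is confined to the
auxiliary coordinates and the label. -/
def Kind.point {k n : ℕ} (K : Kind k) (e : ℕ) (c : Clause3 n) : Fin (n + k) → ℚ :=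
  Fin.append (fun i => clauseCoeff c.lits K.mult i * varScale k) fun j => (K.aux j).val e

def Kind.sample {k n : ℕ} (K : Kind k) (e : ℕ) (c : Clause3 n) : (Fin (n + k) → ℚ) × ℚ :=
  (K.point e c, K.label.val e)

def instanceOf {k n : ℕ} (Ks : List (Kind k)) (e : ℕ) (φ : CNF3 n) : RatSamples (n + k) :=
  φ.flatMap fun c => Ks.map fun K => K.sample e c

def Kind.tailTokens {k : ℕ} (K : Kind k) : Tokens :=
  ((List.ofFn K.aux).flatMap fun x => some true :: x.tokens) ++ some false :: K.label.tokens

def encSample {n : ℕ} (z : (Fin n → ℚ) × ℚ) : List Bool := encVec z.1 ++ encRat z.2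

theorem Kind.encSample_sample {k n : ℕ} (K : Kind k) (e : ℕ) (c : Clause3 n) :
    encSample (K.sample e c) =
      ((List.range n).flatMap fun i =>
        true :: encRat (clauseCoeff c.lits K.mult i * varScale k)) ++ K.tailTokens.eval e := by
  have h1 : K.tailTokens.eval e =
      ((List.ofFn fun j => (K.aux j).val e).flatMap fun a => true :: encRat a) ++
        false :: encRat (K.label.val e) := by
    rw [Kind.tailTokens, Tokens.eval_append, Tokens.eval_flatMap, Tokens.eval_cons,
      Scalar.eval_tokens]
    congr 1
    rw [show (List.ofFn fun j => (K.aux j).val e) = (List.ofFn K.aux).map (Scalar.val e) by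
      rw [List.map_ofFn]; rfl, List.flatMap_map]
    congr 1
    funext x
    rw [Tokens.eval_cons, Scalar.eval_tokens]
    rfl
  have h2 : ((List.range n).flatMap fun i =>
        true :: encRat (clauseCoeff c.lits K.mult i * varScale k)) =
      (List.ofFn fun i : Fin n => (clauseCoeff c.lits K.mult i * varScale k : ℚ)).flatMap
        fun a => true :: encRat a := by
    rw [← List.map_coe_finRange_eq_range, List.ofFn_eq_map, List.flatMap_map, List.flatMap_map]
  rw [h1, h2, encSample, Kind.sample, encVec, encList, Kind.point, List.ofFn_fin_append]
  simp

/-! ### Writing a sample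

Registers: `0` unread input, `1` saved formula, `2` the dimension in unary, `3` the parameter `e` in
unary, `4` output in reverse, `5`, `6`, `7` the literals of the current clause, `8`, `9`, `10`
copies of them, `11` flag, `12` temporary, `13` loop counter. -/

def emitToken : Option Bool → Prog
  | some b => .push 4 b
  | none => .seq (move 3 12)
      (.loop 12 (.seq (.pop 12) (.seq (.push 3 true) (.seq (.push 4 true) (.push 4 false)))))

theorem reach_emitToken (o : Option Bool) {s : Store} {e : ℕ} (h3 : s 3 = List.replicate e true)
    (h12 : s 12 = []) :
    Reach (emitToken o) s (9 * e + 2) (update s 4 ((Tokens.eval e [o]).reverse ++ s 4)) := by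
  cases o with
  | some b =>
    refine ((Reach.push 4 b s).mono (by omega)).of_eq ?_
    simp [Tokens.eval]
  | none =>
    have key : ∀ (m : ℕ) (s : Store), s 12 = List.replicate m true →
        Reach (.loop 12 (.seq (.pop 12) (.seq (.push 3 true) (.seq (.push 4 true)
          (.push 4 false))))) s (5 * m + 1)
          (update (update (update s 12 []) 3 (List.replicate m true ++ s 3)) 4
            ((chunk m).reverse ++ s 4)) := by
      intro m
      induction m with
      | zero =>
        intro s hs
        refine (Reach.loop_done hs).of_eq ?_
        funext r
        simp only [update_apply]
        split_ifs <;> simp_all [chunk]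
      | succ m ih =>
        intro s hs
        refine ((Reach.loop_step (by simp [hs, List.replicate_succ]) ((Reach.pop 12 s).seq
          ((Reach.push 3 true _).seq ((Reach.push 4 true _).seq (Reach.push 4 false _))))
          (ih _ (by simp [hs]))).mono (by omega)).of_eq ?_
        have h1 : List.replicate m true ++ true :: s 3 = List.replicate (m + 1) true ++ s 3 := by
          rw [List.replicate_succ']; simp
        simp only [ne_eq, Nat.reduceEqDiff, not_false_eq_true,
          update_of_ne, update_self, h1, chunk_succ, List.reverse_cons, List.append_assoc,
          List.cons_append, List.nil_append]
        funext r
        simp only [update_apply]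
        split_ifs <;> rfl
    refine (((reach_move (by decide) s).seq (key e _ (by simp [h3, h12]))).mono ?_).of_eq ?_
    · simp [h3]
      omega
    · funext r
      simp only [update_apply]
      split_ifs <;> simp_all [Tokens.eval]

def emitTokens : Tokens → Prog
  | [] => .skip
  | o :: l => .seq (emitToken o) (emitTokens l)

theorem reach_emitTokens (l : Tokens) {s : Store} {e : ℕ} (h3 : s 3 = List.replicate e true)
    (h12 : s 12 = []) :
    Reach (emitTokens l) s ((9 * e + 2) * (l.length + 1))
      (update s 4 ((l.eval e).reverse ++ s 4)) := by
  induction l generalizing s with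
  | nil => exact ((Reach.skip s).mono (by simp)).of_eq (by simp [Tokens.eval])
  | cons o l ih =>
    refine (((reach_emitToken o h3 h12).seq (ih (by simp [h3]) (by simp [h12]))).mono ?_).of_eq ?_
    · rw [List.length_cons]; exact le_of_eq (by ring)
    · rw [Tokens.eval_cons]
      simp [Tokens.eval]

/-- What remains of the code of the literal `l` when coordinate `i` is reached. -/
def countdown (l : ℕ × Bool) (i : ℕ) : List Bool :=
  if i ≤ l.1 then List.replicate (l.1 - i) true ++ [false, l.2] else []

/-- The code of a literal. -/
def litCode (l : ℕ × Bool) : List Bool := List.replicate l.1 true ++ [false, l.2]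

theorem countdown_zero (l : ℕ × Bool) : countdown l 0 = litCode l := by simp [countdown, litCode]

theorem countdown_of_lt {l : ℕ × Bool} {i : ℕ} (h : l.1 < i) : countdown l i = [] := by
  simp [countdown, h]

/-- Writes the current coordinate of a point: the value encoded by `enc` of `v` plus the
contributions of the literals in the listed registers, with the given multiplicities. -/
def emitCoord (enc : ℤ → List Bool) : List (ℕ × ℤ) → ℤ → Prog
  | [], v => pushAll 4 (enc v)
  | (j, z) :: rest, v => .branch j (emitCoord enc rest v)
      (.seq (.pop j) (.branch j .skip (.seq (.pop j) (emitCoord enc rest (v - z)))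
        (.seq (.pop j) (emitCoord enc rest (v + z)))))
      (.seq (.pop j) (emitCoord enc rest v))

/-- The literal's register counts down as `i` grows. It is empty if the index has been passed; it
starts with `false` exactly when coordinate `i` is the literal's variable; otherwise one `true` is
consumed and the contribution is `0`. -/
theorem reach_emitCoord_cons (enc : ℤ → List Bool) (j : ℕ) (z : ℤ) (rest : List (ℕ × ℤ)) (v : ℤ)
    {s s' : Store} {l : ℕ × Bool} {i T : ℕ} (hs : s j = countdown l i)
    (h : Reach (emitCoord enc rest (v + literalCoeff l z i)) (update s j (countdown l (i + 1))) T
      s') : Reach (emitCoord enc ((j, z) :: rest) v) s (T + 5) s' := by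
  rcases lt_trichotomy l.1 i with hi | hi | hi
  · have h0 : countdown l i = [] := countdown_of_lt hi
    have h1 : countdown l (i + 1) = [] := countdown_of_lt (by omega)
    have h2 : literalCoeff l z i = 0 := by simp [literalCoeff, hi.ne]
    rw [h1, h2, add_zero, show update s j [] = s by rw [← h0, ← hs, update_eq_self]] at h
    exact (Reach.branch_nil (hs.trans h0) h).mono (by omega)
  · have h1 : countdown l (i + 1) = [] := countdown_of_lt (by omega)
    have h0 : s j = false :: [l.2] := by simp [hs, countdown, hi]
    rw [h1] at h
    cases hb : l.2
    · have h2 : v + literalCoeff l z i = v - z := by simp [literalCoeff, hi, hb]; ring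
      rw [h2] at h
      rw [hb] at h0
      exact (Reach.branch_false h0 ((Reach.pop j s).seq (Reach.branch_false (l := [])
        (by simp [h0]) ((Reach.pop j _).seq (by simpa [h0] using h))))).mono (by omega)
    · have h2 : v + literalCoeff l z i = v + z := by simp [literalCoeff, hi, hb]
      rw [h2] at h
      rw [hb] at h0
      exact (Reach.branch_false h0 ((Reach.pop j s).seq (Reach.branch_true (l := [])
        (by simp [h0]) ((Reach.pop j _).seq (by simpa [h0] using h))))).mono (by omega)
  · obtain ⟨m, hm⟩ : ∃ m, l.1 - i = m + 1 := ⟨l.1 - i - 1, by omega⟩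
    have hm' : l.1 - (i + 1) = m := by omega
    have h0 : s j = true :: countdown l (i + 1) := by
      simp [hs, countdown, hi.le, Nat.succ_le_of_lt hi, hm, hm', List.replicate_succ]
    have h2 : literalCoeff l z i = 0 := by simp [literalCoeff, hi.ne']
    rw [h2, add_zero] at h
    exact (Reach.branch_true h0 ((Reach.pop j s).seq (by simpa [h0] using h))).mono (by omega)

def emitCoords (enc : ℤ → List Bool) (z : Fin 3 → ℤ) : Prog :=
  .loop 13 (.seq (.pop 13) (.seq (.push 4 true) (emitCoord enc [(8, z 0), (9, z 1), (10, z 2)] 0)))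

theorem abs_literalCoeff_le (l : ℕ × Bool) (z : ℤ) (i : ℕ) : |literalCoeff l z i| ≤ |z| := by
  unfold literalCoeff
  split_ifs <;> simp

theorem reach_emitCoords (enc : ℤ → List Bool) (z : Fin 3 → ℤ) :
    ∃ C : ℕ, ∀ (m i : ℕ) (l : Fin 3 → ℕ × Bool) (s : Store), s 13 = List.replicate m true →
      s 8 = countdown (l 0) i → s 9 = countdown (l 1) i → s 10 = countdown (l 2) i →
      Reach (emitCoords enc z) s (C * m + 1)
        (update (update (update (update (update s 13 []) 8 (countdown (l 0) (i + m)))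
          9 (countdown (l 1) (i + m))) 10 (countdown (l 2) (i + m))) 4
          (((List.range' i m).flatMap fun i => true :: enc (clauseCoeff l z i)).reverse ++
            s 4)) := by
  set A : ℤ := |z 0| + |z 1| + |z 2|
  -- Coefficients lie in the fixed interval `[-A, A]`, so their codes have bounded length and a
  -- coordinate costs constant time.
  set D : ℕ := (Finset.Icc (-A) A).sup fun v => (enc v).length
  have hD : ∀ (l : Fin 3 → ℕ × Bool) (i : ℕ), (enc (clauseCoeff l z i)).length ≤ D := by
    intro l i
    have h0 := abs_le.1 (abs_literalCoeff_le (l 0) (z 0) i)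
    have h1 := abs_le.1 (abs_literalCoeff_le (l 1) (z 1) i)
    have h2 := abs_le.1 (abs_literalCoeff_le (l 2) (z 2) i)
    refine Finset.le_sup (f := fun v => (enc v).length) (Finset.mem_Icc.2 ?_)
    simp only [clauseCoeff, A]
    constructor <;> linarith
  refine ⟨D + 19, fun m => ?_⟩
  induction m with
  | zero =>
    intro i l s h13 h8 h9 h10
    refine ((Reach.loop_done h13).mono (by omega)).of_eq ?_
    funext r
    simp only [update_apply]
    split_ifs <;> simp_all
  | succ m ih =>
    intro i l s h13 h8 h9 h10
    have hc : 0 + literalCoeff (l 0) (z 0) i + literalCoeff (l 1) (z 1) i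
        + literalCoeff (l 2) (z 2) i = clauseCoeff l z i := by simp [clauseCoeff]
    have coord := fun s' : Store => fun (h8 : s' 8 = countdown (l 0) i)
      (h9 : s' 9 = countdown (l 1) i) (h10 : s' 10 = countdown (l 2) i) =>
      reach_emitCoord_cons enc 8 (z 0) [(9, z 1), (10, z 2)] 0 h8
        (reach_emitCoord_cons enc 9 (z 1) [(10, z 2)] _ (l := l 1) (i := i) (by simp [h9])
        (reach_emitCoord_cons enc 10 (z 2) [] _ (l := l 2) (i := i) (by simp [h10])
          (reach_pushAll 4 _ _)))
    simp only [hc] at coord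
    refine ((Reach.loop_step (by simp [h13, List.replicate_succ]) ((Reach.pop 13 s).seq
      ((Reach.push 4 true _).seq (coord _ (by simp [h8]) (by simp [h9]) (by simp [h10]))))
      (ih (i + 1) l _ (by simp [h13]) (by simp) (by simp) (by simp))).mono ?_).of_eq ?_
    · have := hD l i
      have e1 : (D + 19) * (m + 1) = (D + 19) * m + D + 19 := by ring
      omega
    · have e1 : i + 1 + m = i + (m + 1) := by omega
      rw [e1]
      funext r
      simp only [update_apply]
      split_ifs <;> simp_all [List.range'_succ]

/-- The registers that the writing routines need. -/
structure WriteReady (s : Store) (n e : ℕ) : Prop where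
  dim : s 2 = List.replicate n true
  par : s 3 = List.replicate e true
  nil : ∀ r ∈ [8, 9, 10, 11, 12, 13], s r = []

theorem WriteReady.update {s : Store} {n e : ℕ} (h : WriteReady s n e) {r : ℕ}
    (hr : r ∈ [0, 4, 5, 6, 7]) (v : List Bool) : WriteReady (update s r v) n e := by
  obtain ⟨h1, h2, h3⟩ := h
  simp only [List.mem_cons, List.not_mem_nil, or_false] at hr
  refine ⟨?_, ?_, fun q hq => ?_⟩
  · rcases hr with rfl | rfl | rfl | rfl | rfl <;> simpa using h1
  · rcases hr with rfl | rfl | rfl | rfl | rfl <;> simpa using h2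
  · rw [update_of_ne, h3 q hq]
    rintro rfl
    rcases hr with rfl | rfl | rfl | rfl | rfl <;> simp at hq

/-- Registers `5`, `6`, `7` hold the literals `l`. -/
def HoldsLits (s : Store) (l : Fin 3 → ℕ × Bool) : Prop :=
  s 5 = litCode (l 0) ∧ s 6 = litCode (l 1) ∧ s 7 = litCode (l 2)

def emitSample {k : ℕ} (K : Kind k) : Prog :=
  .seq (.push 4 true) (.seq (copy 5 8 12) (.seq (copy 6 9 12) (.seq (copy 7 10 12)
    (.seq (copy 2 13 12) (.seq (emitCoords (fun v => encRat (v * varScale k)) K.mult)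
      (emitTokens K.tailTokens))))))

theorem length_litCode (l : ℕ × Bool) : (litCode l).length = l.1 + 2 := by simp [litCode]

theorem reach_emitSample {k : ℕ} (K : Kind k) : ∃ C : ℕ, ∀ (n e : ℕ) (c : Clause3 n) (s : Store),
    e ≤ n → WriteReady s n e → HoldsLits s c.lits →
    Reach (emitSample K) s (C * (n + 1))
      (update s 4 ((true :: encSample (K.sample e c)).reverse ++ s 4)) := by
  obtain ⟨C, hC⟩ := reach_emitCoords (fun v => encRat (v * varScale k)) K.mult
  refine ⟨C + 9 * (K.tailTokens.length + 1) + 70, ?_⟩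
  rintro n e c s hen ⟨h2, h3, hnil⟩ ⟨h5, h6, h7⟩
  have hn : ∀ t, (c.lits t).1 < n := fun t => (c t).1.isLt
  have h8 : s 8 = [] := hnil _ (by simp)
  have h9 : s 9 = [] := hnil _ (by simp)
  have h10 : s 10 = [] := hnil _ (by simp)
  have h12 : s 12 = [] := hnil _ (by simp)
  have h13 : s 13 = [] := hnil _ (by simp)
  have cp := hC n 0 c.lits
  -- All indices are below `n`, so the countdown copies end empty, ready for the next sample.
  simp only [zero_add, countdown_of_lt (hn _), countdown_zero] at cp
  have step := (Reach.push 4 true s).seq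
    ((reach_copy (a := 5) (b := 8) (x := 12) (by decide) (by decide) (by decide)
      (by simp [h8]) (by simp [h12])).seq
    ((reach_copy (a := 6) (b := 9) (x := 12) (by decide) (by decide) (by decide)
      (by simp [h9]) (by simp [h12])).seq
    ((reach_copy (a := 7) (b := 10) (x := 12) (by decide) (by decide) (by decide)
      (by simp [h10]) (by simp [h12])).seq
    ((reach_copy (a := 2) (b := 13) (x := 12) (by decide) (by decide) (by decide)
      (by simp [h13]) (by simp [h12])).seq
    ((cp _ (by simp [h2]) (by simp [h5]) (by simp [h6]) (by simp [h7])).seq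
    (reach_emitTokens K.tailTokens (e := e) (by simp [h3]) (by simp [h12])))))))
  refine (step.mono ?_).of_eq ?_
  · have l0 := hn 0
    have l1 := hn 1
    have l2 := hn 2
    simp [h5, h6, h7, h2, length_litCode]
    nlinarith [Nat.mul_le_mul_right (K.tailTokens.length + 1) hen]
  · have hr : (List.range' 0 n) = List.range n := by rw [List.range_eq_range']
    simp [hr, Kind.encSample_sample]
    funext r
    simp only [update_apply]
    split_ifs <;> simp_all

def emitSamples {k : ℕ} : List (Kind k) → Prog
  | [] => .skip
  | K :: Ks => .seq (emitSample K) (emitSamples Ks)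

theorem reach_emitSamples {k : ℕ} (Ks : List (Kind k)) : ∃ C : ℕ,
    ∀ (n e : ℕ) (c : Clause3 n) (s : Store),
    e ≤ n → WriteReady s n e → HoldsLits s c.lits →
    Reach (emitSamples Ks) s (C * (n + 1))
      (update s 4 ((Ks.flatMap fun K => true :: encSample (K.sample e c)).reverse ++ s 4)) := by
  induction Ks with
  | nil => exact ⟨1, fun n e c s _ _ _ => ((Reach.skip s).mono (by omega)).of_eq (by simp)⟩
  | cons K Ks ih =>
    obtain ⟨C, hC⟩ := reach_emitSample K
    obtain ⟨C', hC'⟩ := ih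
    refine ⟨C + C', fun n e c s he hw hl => ?_⟩
    refine (((hC n e c s he hw hl).seq (hC' n e c _ he (hw.update (by simp) _)
      (by simpa [HoldsLits] using hl))).mono (le_of_eq (by ring))).of_eq ?_
    simp

/-! ### Reading a formula clause by clause -/

/-- Reads a literal, preceded by a marker, to register `t`. -/
def readLit (t : ℕ) : Prog :=
  .seq (.pop 0) (.seq (.branch 0 .skip (.seq (.pop 0) (.push t false))
    (.seq (.pop 0) (.push t true))) (.seq (takeUnary 0 8 11) (move 8 t)))

theorem reach_readLit {t : ℕ} (h0 : t ≠ 0) (h8 : t ≠ 8) (h11 : t ≠ 11) {n : ℕ} (l : Literal n)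
    {s : Store} {rest : List Bool} (hs : s 0 = true :: (encLiteral l ++ rest)) (ht : s t = [])
    (hs8 : s 8 = []) (hs11 : s 11 = []) :
    Reach (readLit t) s (8 * n + 20) (update (update s 0 rest) t (litCode (l.1, l.2))) := by
  obtain ⟨i, b⟩ := l
  have hs' : s 0 = true :: b :: (List.replicate i true ++ false :: rest) := by
    simp [hs, encLiteral, encUnary]
  have hb : Reach (.branch 0 .skip (.seq (.pop 0) (.push t false)) (.seq (.pop 0) (.push t true)))
      (update s 0 (b :: (List.replicate i true ++ false :: rest))) 3
      (update (update s 0 (List.replicate i true ++ false :: rest)) t [b]) := by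
    cases b
    · exact (Reach.branch_false (update_self ..) ((Reach.pop 0 _).seq (Reach.push t false _))).of_eq
        (by simp [ht, h0])
    · exact (Reach.branch_true (update_self ..) ((Reach.pop 0 _).seq (Reach.push t true _))).of_eq
        (by simp [ht, h0])
  have step := ((Reach.pop 0 s).of_eq (by rw [hs']; rfl)).seq (hb.seq
    ((reach_takeUnary (w := 0) (j := 8) (f := 11) (i := i) (l := rest) (by decide) (by decide)
      (by decide) (by simp [Ne.symm h11, hs11]) (by simp [h0.symm])).seq
      (reach_move h8.symm _)))
  refine (step.mono ?_).of_eq ?_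
  · have := i.isLt
    simp [h8.symm, hs8]
    omega
  · simp [h8, h8.symm, hs8, h0]
    funext r
    simp only [update_apply]
    split_ifs <;> simp_all [litCode]

def encClause {n : ℕ} (c : Clause3 n) : List Bool := encList encLiteral (List.ofFn c)

def readClause : Prog := .seq (readLit 5) (.seq (readLit 6) (.seq (readLit 7) (.pop 0)))

def loadLits (l : Fin 3 → ℕ × Bool) (s : Store) : Store :=
  update (update (update s 5 (litCode (l 0))) 6 (litCode (l 1))) 7 (litCode (l 2))

theorem holdsLits_loadLits (l : Fin 3 → ℕ × Bool) (s : Store) : HoldsLits (loadLits l s) l := by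
  simp [HoldsLits, loadLits]

theorem reach_readClause {n : ℕ} (c : Clause3 n) {s : Store} {rest : List Bool}
    (hs : s 0 = encClause c ++ rest) (hnil : ∀ r ∈ [5, 6, 7, 8, 11], s r = []) :
    Reach readClause s (24 * n + 61) (loadLits c.lits (update s 0 rest)) := by
  have h5 : s 5 = [] := hnil _ (by simp)
  have h6 : s 6 = [] := hnil _ (by simp)
  have h7 : s 7 = [] := hnil _ (by simp)
  have h8 : s 8 = [] := hnil _ (by simp)
  have h11 : s 11 = [] := hnil _ (by simp)
  have hs' : s 0 = true :: (encLiteral (c 0) ++ true :: (encLiteral (c 1) ++ true ::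
      (encLiteral (c 2) ++ false :: rest))) := by
    simp [hs, encClause, encList, List.ofFn_succ]
  have step := (reach_readLit (t := 5) (by decide) (by decide) (by decide) (c 0) hs' h5 h8 h11).seq
    ((reach_readLit (t := 6) (by decide) (by decide) (by decide) (c 1) (update_of_ne (by decide) ..)
      (by simp [h6]) (by simp [h8]) (by simp [h11])).seq
    ((reach_readLit (t := 7) (by decide) (by decide) (by decide) (c 2) (by simp; rfl)
      (by simp [h7]) (by simp [h8]) (by simp [h11])).seq (Reach.pop 0 _)))
  refine (step.mono (by omega)).of_eq ?_
  simp [loadLits, Clause3.lits]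
  funext r
  simp only [update_apply]
  split_ifs <;> simp_all

/-- Runs `body` for every clause of the formula in register `0`, with its literals in the
registers `5`, `6` and `7`. -/
def forClauses (body : Prog) : Prog :=
  .loop 0 (.branch 0 .skip (.pop 0) (.seq (.pop 0) (.seq readClause body)))

/-- `G` is the effect of the body on the whole store. Since it commutes with overwriting register
`0`, the fold over the clauses can be stated separately from the consumption of the input. -/
theorem reach_forClauses {n T : ℕ} {body : Prog} (Inv : Store → Prop)
    (G : Clause3 n → Store → Store)
    (hbody : ∀ c s, Inv s → Reach body (loadLits c.lits s) T (G c s))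
    (hG : ∀ c s, Inv s → Inv (G c s))
    (hnil : ∀ s, Inv s → ∀ r ∈ [5, 6, 7, 8, 11], s r = [])
    (hupd : ∀ s v, Inv s → Inv (update s 0 v))
    (hcomm : ∀ c s v, G c (update s 0 v) = update (G c s) 0 v)
    (φ : CNF3 n) {s : Store} (hs : Inv s) (h0 : s 0 = encList encClause φ) :
    Reach (forClauses body) s (φ.length * (T + 24 * n + 64) + 4)
      (update (φ.foldl (fun s c => G c s) s) 0 []) := by
  induction φ generalizing s with
  | nil =>
    -- Even the empty list leaves its closing `false` in register `0`, which costs one round.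
    exact ((Reach.loop_step (by simp [h0, encList]) (Reach.branch_false (l := []) (by simp [h0, encList])
      (Reach.pop 0 s)) (Reach.loop_done (by simp [h0, encList]))).mono (by simp)).of_eq
      (by simp [h0, encList])
  | cons c φ ih =>
    have h0' : s 0 = true :: (encClause c ++ encList encClause φ) := by simp [h0, encList]
    have hi := hupd s (encList encClause φ) hs
    have h0'' : G c (update s 0 (encList encClause φ)) 0 = encList encClause φ := by simp [hcomm]
    have hread := reach_readClause c (s := update s 0 (s 0).tail) (rest := encList encClause φ)
      (by simp [h0']) (hnil _ (hupd s _ hs))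
    rw [update_idem] at hread
    refine ((Reach.loop_step (by simp [h0']) (Reach.branch_true h0' ((Reach.pop 0 s).seq
      (hread.seq (hbody c _ hi)))) (ih (hG c _ hi) h0'')).mono ?_).of_eq ?_
    · rw [List.length_cons, Nat.add_mul]; omega
    · rw [List.foldl_cons]
      have : ∀ (φ : CNF3 n) (s : Store) (v : List Bool), φ.foldl (fun s c => G c s) (update s 0 v) =
          update (φ.foldl (fun s c => G c s) s) 0 v := by
        intro φ
        induction φ with
        | nil => intro s v; rfl
        | cons c φ ih => intro s v; rw [List.foldl_cons, hcomm, ih]; rfl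
      rw [hcomm, this, update_idem]

/-! ### Computing the parameter -/

/-- About half the binary logarithm. -/
def halfLog : ℕ → ℕ
  | 0 => 0
  -- Drop one unit, then divide by four rounding up; both are easy in unary.
  | x + 1 => halfLog ((x + 3) / 4) + 1
termination_by x => x
decreasing_by omega

theorem halfLog_le (n : ℕ) : halfLog n ≤ n := by
  induction n using Nat.strong_induction_on with
  | _ n ih =>
    cases n with
    | zero => simp [halfLog]
    | succ x => rw [halfLog]; have := ih ((x + 3) / 4) (by omega); omega

/-- If `3m + 1 ≤ 4^h` with `m = ⌈(n-1)/4⌉`, then `4^{h+1} ≥ 12m + 4 ≥ 3n + 1`. The factor `3` leaves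
room in the unit ball for the auxiliary weight `1/2`. -/
theorem lt_four_pow_halfLog (n : ℕ) : 3 * n < 4 ^ halfLog n := by
  induction n using Nat.strong_induction_on with
  | _ n ih =>
    cases n with
    | zero => simp [halfLog]
    | succ x => rw [halfLog, pow_succ]; have := ih ((x + 3) / 4) (by omega); omega

theorem four_pow_halfLog_le {n : ℕ} (hn : n ≠ 0) : 4 ^ halfLog n ≤ 12 * n := by
  -- The bound `12 * n - 8` survives the rounding in the induction; the truncated subtraction
  -- requires a correction at `n = 0`.
  suffices h : ∀ n : ℕ, 4 ^ halfLog n ≤ 12 * n - 8 + if n = 0 then 1 else 0 by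
    have := h n; simp [hn] at this; omega
  intro n
  induction n using Nat.strong_induction_on with
  | _ n ih =>
    cases n with
    | zero => simp [halfLog]
    | succ x =>
      rw [halfLog, pow_succ]
      have := ih ((x + 3) / 4) (by omega)
      split_ifs at this ⊢ <;> omega

/-- Popping an empty register is harmless, so an incomplete last group of four still counts: the
division rounds up. -/
def quarter : Prog :=
  .seq (.loop 13 (.seq (.pop 13) (.seq (.pop 13) (.seq (.pop 13) (.seq (.pop 13) (.push 12 true))))))
    (move 12 13)

theorem reach_quarter (m : ℕ) {s : Store} (h13 : s 13 = List.replicate m true) (h12 : s 12 = []) :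
    Reach quarter s (10 * ((m + 3) / 4) + 2) (update s 13 (List.replicate ((m + 3) / 4) true)) := by
  have key : ∀ (m : ℕ) (s : Store), s 13 = List.replicate m true →
      Reach (.loop 13 (.seq (.pop 13) (.seq (.pop 13) (.seq (.pop 13) (.seq (.pop 13)
        (.push 12 true)))))) s (6 * ((m + 3) / 4) + 1)
        (update (update s 13 []) 12 (List.replicate ((m + 3) / 4) true ++ s 12)) := by
    intro m
    induction m using Nat.strong_induction_on with
    | _ m ih =>
      intro s hs
      rcases Nat.eq_zero_or_pos m with rfl | hm
      · refine (Reach.loop_done hs).of_eq ?_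
        funext r
        simp only [update_apply]
        split_ifs <;> simp_all
      · have e1 : (m + 3) / 4 = (m - 4 + 3) / 4 + 1 := by omega
        refine ((Reach.loop_step (by simp [hs]; omega) ((Reach.pop 13 s).seq
          ((Reach.pop 13 _).seq ((Reach.pop 13 _).seq ((Reach.pop 13 _).seq
            (Reach.push 12 true _)))))
          (ih (m - 4) (by omega) _ ?_)).mono ?_).of_eq ?_
        · simp [hs, Nat.sub_sub]
        · omega
        · rw [e1, List.replicate_succ']
          simp
          funext r
          simp only [update_apply]
          split_ifs <;> simp_all
  refine (((key m s h13).seq (reach_move (by decide) _)).mono ?_).of_eq ?_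
  · simp [h12]; omega
  · simp [h12]
    funext r
    simp only [update_apply]
    split_ifs <;> simp_all

def computePar : Prog :=
  .seq (copy 2 13 12) (.loop 13 (.seq (.pop 13) (.seq quarter (.push 3 true))))

theorem reach_computePar {n : ℕ} {s : Store} (h2 : s 2 = List.replicate n true) (h3 : s 3 = [])
    (h12 : s 12 = []) (h13 : s 13 = []) :
    Reach computePar s (30 * (n + 1) ^ 2)
      (update s 3 (List.replicate (halfLog n) true)) := by
  have key : ∀ (m : ℕ) (s : Store), s 13 = List.replicate m true → s 12 = [] →
      Reach (.loop 13 (.seq (.pop 13) (.seq quarter (.push 3 true)))) s (20 * (m + 1) ^ 2)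
        (update (update s 13 []) 3 (List.replicate (halfLog m) true ++ s 3)) := by
    intro m
    induction m using Nat.strong_induction_on with
    | _ m ih =>
      intro s h13 h12
      cases m with
      | zero =>
        refine ((Reach.loop_done h13).mono (by omega)).of_eq ?_
        funext r
        simp only [update_apply]
        split_ifs <;> simp_all [halfLog]
      | succ x =>
        refine ((Reach.loop_step (by simp [h13, List.replicate_succ]) ((Reach.pop 13 s).seq
          ((reach_quarter x (by simp [h13]) (by simp [h12])).seq (Reach.push 3 true _)))
          (ih ((x + 3) / 4) (by omega) _ (by simp) (by simp [h12]))).mono ?_).of_eq ?_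
        · have h1 : (x + 3) / 4 ≤ x := by omega
          have h2 := Nat.mul_le_mul_left 20 (Nat.pow_le_pow_left (Nat.succ_le_succ h1) 2)
          simp only [Nat.succ_eq_add_one] at h2
          have h3 : 20 * (x + 1 + 1) ^ 2 = 20 * (x + 1) ^ 2 + 40 * x + 60 := by ring
          omega
        · rw [halfLog, List.replicate_succ']
          simp
          funext r
          simp only [update_apply]
          split_ifs <;> simp_all
  refine (((reach_copy (a := 2) (b := 13) (x := 12) (by decide) (by decide) (by decide) h13
    h12).seq (key n _ (by simp [h2]) (by simp [h12]))).mono ?_).of_eq ?_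
  · rw [h2, List.length_replicate]; nlinarith
  · simp [h3]
    funext r
    simp only [update_apply]
    split_ifs <;> simp_all

/-! ### Writing the training instance -/

theorem Reach.length_le {p : Prog} {s s' : Store} {T : ℕ} (h : Reach p s T s') (r : ℕ) :
    (s' r).length ≤ (s r).length + T := by
  obtain ⟨t, ht, hr⟩ := h
  exact (hr.length_le r).trans (by omega)

/-- The error parameter of the instance. -/
def errorOf (H e : ℕ) : ℚ := (2 ^ (H + 2 * e))⁻¹

def errorTokens (H : ℕ) : Tokens :=
  ([false, true, true, false] ++ chunk H).map some ++ none :: none :: [true, true, false].map some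

theorem eval_errorTokens (H e : ℕ) : (errorTokens H).eval e = encRat (errorOf H e) := by
  rw [errorTokens, Tokens.eval_append, Tokens.eval_map_some, Tokens.eval_cons, Tokens.eval_cons,
    Tokens.eval_map_some, errorOf, encRat_inv_two_pow, two_mul, chunk_add, chunk_add]
  simp

def writeHeader (k H : ℕ) : Prog :=
  .seq (copy 2 13 12) (.seq (move 13 4) (.seq (pushAll 4 (encUnary k)) (emitTokens (errorTokens H))))

theorem reach_writeHeader (k H : ℕ) : ∃ C : ℕ, ∀ (n e : ℕ) (s : Store), e ≤ n →
    WriteReady s n e → Reach (writeHeader k H) s (C * (n + 1))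
      (update s 4 ((encUnary (n + k) ++ encRat (errorOf H e)).reverse ++ s 4)) := by
  refine ⟨k + 20 + 9 * ((errorTokens H).length + 1) , ?_⟩
  rintro n e s hen ⟨h2, h3, hnil⟩
  have h12 : s 12 = [] := hnil _ (by simp)
  have h13 : s 13 = [] := hnil _ (by simp)
  have step := (reach_copy (a := 2) (b := 13) (x := 12) (by decide) (by decide) (by decide) h13
    h12).seq ((reach_move (a := 13) (b := 4) (by decide) _).seq ((reach_pushAll 4 (encUnary k) _).seq
      (reach_emitTokens (errorTokens H) (e := e) (by simp [h3]) (by simp [h12]))))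
  refine (step.mono ?_).of_eq ?_
  · simp [h2, encUnary]
    nlinarith [Nat.mul_le_mul_right ((errorTokens H).length + 1) hen]
  · have hu : encUnary (n + k) = List.replicate n true ++ encUnary k := by
      rw [encUnary, List.replicate_add, List.append_assoc]; rfl
    simp [h2, eval_errorTokens, hu]
    funext r
    simp only [update_apply]
    split_ifs <;> simp_all

def writeSamples {k : ℕ} (Ks : List (Kind k)) : Prog :=
  .seq (emitSamples Ks) (.seq (clear 5) (.seq (clear 6) (clear 7)))

def encBlock {k n : ℕ} (Ks : List (Kind k)) (e : ℕ) (c : Clause3 n) : List Bool :=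
  Ks.flatMap fun K => true :: encSample (K.sample e c)

theorem reach_writeSamples {k : ℕ} (Ks : List (Kind k)) : ∃ C : ℕ,
    ∀ (n e : ℕ) (φ : CNF3 n) (s : Store), e ≤ n → WriteReady s n e → s 5 = [] → s 6 = [] →
    s 7 = [] → s 0 = encList encClause φ →
    Reach (forClauses (writeSamples Ks)) s (C * (n + 1) * (φ.length + 1))
      (update (update s 0 []) 4 ((φ.flatMap (encBlock Ks e)).reverse ++ s 4)) := by
  obtain ⟨C, hC⟩ := reach_emitSamples Ks
  refine ⟨C + 200, fun n e φ s he hw h5 h6 h7 h0 => ?_⟩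
  have main := reach_forClauses (n := n) (T := (C + 100) * (n + 1)) (body := writeSamples Ks)
    (fun s => WriteReady s n e ∧ s 5 = [] ∧ s 6 = [] ∧ s 7 = [])
    (fun c s => update s 4 ((encBlock Ks e c).reverse ++ s 4)) ?_ ?_ ?_ ?_ ?_ φ ⟨hw, h5, h6, h7⟩ h0
  · refine (main.mono ?_).of_eq ?_
    · nlinarith
    · have : ∀ (φ : CNF3 n) (s : Store),
          φ.foldl (fun s c => update s 4 ((encBlock Ks e c).reverse ++ s 4)) s =
          update s 4 ((φ.flatMap (encBlock Ks e)).reverse ++ s 4) := by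
        intro φ
        induction φ with
        | nil => intro s; simp
        | cons c φ ih => intro s; rw [List.foldl_cons, ih]; simp
      rw [this, update_comm (by decide)]
  · rintro c s ⟨hw, h5, h6, h7⟩
    have hw' : WriteReady (loadLits c.lits s) n e :=
      ((hw.update (by simp) _).update (by simp) _).update (by simp) _
    have step := (hC n e c _ he hw' (holdsLits_loadLits _ _)).seq ((reach_clear 5 _).seq
      ((reach_clear 6 _).seq (reach_clear 7 _)))
    refine (step.mono ?_).of_eq ?_
    · have l0 := (c 0).1.isLt
      have l1 := (c 1).1.isLt
      have l2 := (c 2).1.isLt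
      simp [loadLits, length_litCode, Clause3.lits]
      nlinarith
    · simp [loadLits, encBlock]
      funext r
      simp only [update_apply]
      split_ifs <;> simp_all
  · rintro c s ⟨hw, h5, h6, h7⟩
    exact ⟨hw.update (by simp) _, by simp [h5], by simp [h6], by simp [h7]⟩
  · rintro s ⟨hw, h5, h6, h7⟩ r hr
    simp only [List.mem_cons, List.not_mem_nil, or_false] at hr
    rcases hr with rfl | rfl | rfl | rfl | rfl
    · exact h5
    · exact h6
    · exact h7
    · exact hw.nil _ (by simp)
    · exact hw.nil _ (by simp)
  · rintro s v ⟨hw, h5, h6, h7⟩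
    exact ⟨hw.update (by simp) _, by simp [h5], by simp [h6], by simp [h7]⟩
  · intro c s v
    rw [update_comm (by decide)]
    simp

def writeInstance {k : ℕ} (Ks : List (Kind k)) (H : ℕ) : Prog :=
  .seq computePar (.seq (writeHeader k H) (.seq (forClauses (writeSamples Ks))
    (.seq (.push 4 false) (move 4 20))))

theorem encInstance_instanceOf {k n : ℕ} (Ks : List (Kind k)) (e : ℕ) (φ : CNF3 n) (ε : ℚ) :
    encInstance (instanceOf Ks e φ) ε =
      encUnary (n + k) ++ encRat ε ++ (φ.flatMap (encBlock Ks e) ++ [false]) := by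
  rw [encInstance, encList, instanceOf, List.flatMap_assoc]
  congr 3
  funext c
  rw [List.flatMap_map]
  rfl

theorem reach_writeInstance {k : ℕ} (Ks : List (Kind k)) (H : ℕ) : ∃ C : ℕ,
    ∀ (n : ℕ) (φ : CNF3 n) (s : Store), s 0 = encList encClause φ → s 2 = List.replicate n true →
    (∀ r, 3 ≤ r → s r = []) →
    Reach (writeInstance Ks H) s (C * (n + 1) ^ 2 * (φ.length + 1))
      (update (update (update s 0 []) 3 (List.replicate (halfLog n) true)) 20
        (encInstance (instanceOf Ks (halfLog n) φ) (errorOf H (halfLog n)))) := by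
  obtain ⟨C, hC⟩ := reach_writeHeader k H
  obtain ⟨C', hC'⟩ := reach_writeSamples Ks
  refine ⟨5 * (30 + C + C' + 2), fun n φ s h0 h2 hnil => ?_⟩
  set e := halfLog n with he
  have hen : e ≤ n := halfLog_le n
  have s1 := reach_computePar h2 (hnil 3 le_rfl) (hnil 12 (by decide)) (hnil 13 (by decide))
  have hw : WriteReady (update s 3 (List.replicate e true)) n e := by
    refine ⟨by simp [h2], by simp, fun r hr => ?_⟩
    have : 3 < r := by
      simp only [List.mem_cons, List.not_mem_nil, or_false] at hr; omega
    rw [update_of_ne this.ne', hnil r this.le]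
  have step := s1.seq ((hC n e _ hen hw).seq ((hC' n e φ _ hen (hw.update (by simp) _)
    (by simp [hnil]) (by simp [hnil]) (by simp [hnil]) (by simp [h0])).seq (Reach.push 4 false _)))
  -- The final reversal takes time proportional to the length of register `4`, which is at most the
  -- time spent so far.
  have hlen := step.length_le 4
  have hT : 30 * (n + 1) ^ 2 + (C * (n + 1) + (C' * (n + 1) * (φ.length + 1) + 1)) ≤
      (30 + C + C' + 1) * (n + 1) ^ 2 * (φ.length + 1) := by
    have a1 : 1 ≤ φ.length + 1 := by omega
    have a2 : n + 1 ≤ (n + 1) ^ 2 := Nat.le_self_pow (by decide) _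
    have a3 : (n + 1) ^ 2 ≤ (n + 1) ^ 2 * (φ.length + 1) := Nat.le_mul_of_pos_right _ a1
    have a4 : C * (n + 1) ≤ C * ((n + 1) ^ 2 * (φ.length + 1)) :=
      Nat.mul_le_mul_left _ (a2.trans a3)
    have a5 : C' * ((n + 1) * (φ.length + 1)) ≤ C' * ((n + 1) ^ 2 * (φ.length + 1)) :=
      Nat.mul_le_mul_left _ (Nat.mul_le_mul_right _ a2)
    nlinarith
  set T := 30 * (n + 1) ^ 2 + (C * (n + 1) + (C' * (n + 1) * (φ.length + 1) + 1)) with hTdef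
  have step' := s1.seq ((hC n e _ hen hw).seq ((hC' n e φ _ hen (hw.update (by simp) _)
    (by simp [hnil]) (by simp [hnil]) (by simp [hnil]) (by simp [h0])).seq
    ((Reach.push 4 false _).seq (reach_move (a := 4) (b := 20) (by decide) _))))
  refine (step'.mono (T' := T + (4 * T + 1)) ?_ |>.mono ?_).of_eq ?_
  · rw [hnil 4 (by decide), List.length_nil, zero_add] at hlen
    rw [hTdef]
    rw [hTdef] at hlen
    linarith
  · have : 1 ≤ (n + 1) ^ 2 * (φ.length + 1) := Nat.mul_pos (by positivity) (by positivity)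
    nlinarith
  · rw [encInstance_instanceOf]
    simp [hnil]
    funext r
    simp only [update_apply]
    split_ifs <;> simp_all

/-! ### Reading the signs of a weight vector

Registers: `20` unread weights, `14` the signs of the current vector, `15` a penalty for every
violated clause, `16` the number of clauses, `17` the satisfied literals of the current clause,
`18` nonempty if some vector passed the test. -/

/-- Drops a self-delimiting natural number. -/
def skipNat : List Bool → List Bool
  | [] => []
  | false :: l => l
  | [true] => []
  | true :: _ :: l => skipNat l

theorem length_skipNat_le (l : List Bool) : (skipNat l).length ≤ l.length := by
  fun_induction skipNat l with
  | case1 => simp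
  | case2 => simp
  | case3 => simp
  | case4 _ l ih => simp; omega

theorem skipNat_encNat (n : ℕ) (l : List Bool) : skipNat (encNat n ++ l) = l := by
  unfold encNat
  induction n.bits with
  | nil => rfl
  | cons b bs ih => simpa [skipNat] using ih

def skipNatProg : Prog :=
  .seq (.push 11 true) (.loop 11 (.branch 20 (.pop 11) (.seq (.pop 20) (.pop 11))
    (.seq (.pop 20) (.pop 20))))

theorem reach_skipNatProg {s : Store} (h11 : s 11 = []) :
    Reach skipNatProg s (4 * (s 20).length + 7) (update s 20 (skipNat (s 20))) := by
  have key : ∀ (l : List Bool) (s : Store), s 20 = l → s 11 = [true] →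
      Reach (.loop 11 (.branch 20 (.pop 11) (.seq (.pop 20) (.pop 11))
        (.seq (.pop 20) (.pop 20)))) s (4 * l.length + 6)
        (update (update s 11 []) 20 (skipNat l)) := by
    intro l
    fun_induction skipNat l with
    | case1 =>
      intro s hs h11
      refine ((Reach.loop_step (by simp [h11]) (Reach.branch_nil hs (Reach.pop 11 s))
        (Reach.loop_done (by simp [h11]))).mono (by simp)).of_eq ?_
      simp [h11, hs]
    | case2 l =>
      intro s hs h11
      refine ((Reach.loop_step (by simp [h11]) (Reach.branch_false hs ((Reach.pop 20 s).seq
        (Reach.pop 11 _))) (Reach.loop_done (by simp [h11]))).mono (by simp)).of_eq ?_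
      simp [h11, hs]
      funext r
      simp only [update_apply]
      split_ifs <;> simp_all
    | case3 =>
      intro s hs h11
      refine ((Reach.loop_step (by simp [h11]) (Reach.branch_true hs ((Reach.pop 20 s).seq
        (Reach.pop 20 _))) (Reach.loop_step (by simp [h11]) (Reach.branch_nil (by simp [hs])
          (Reach.pop 11 _)) (Reach.loop_done (by simp [h11])))).mono (by simp)).of_eq ?_
      simp [h11, hs]
      funext r
      simp only [update_apply]
      split_ifs <;> simp_all
    | case4 _ l ih =>
      intro s hs h11
      refine ((Reach.loop_step (by simp [h11]) (Reach.branch_true hs ((Reach.pop 20 s).seq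
        (Reach.pop 20 _))) (ih _ (by simp [hs]) (by simp [h11]))).mono (by simp; omega)).of_eq ?_
      simp [hs]
      funext r
      simp only [update_apply]
      split_ifs <;> simp_all
  refine (((Reach.push 11 true s).seq (key (s 20) _ (by simp) (by simp [h11]))).mono
    (by omega)).of_eq ?_
  simp
  funext r
  simp only [update_apply]
  split_ifs <;> simp_all

/-- The sign bits of an encoded vector, and the unread part of the input. -/
def readSigns : List Bool → List Bool × List Bool
  | [] => ([], [])
  | false :: l => ([], l)
  | true :: l => (l.take 1 ++ (readSigns (skipNat (skipNat l.tail))).1,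
      (readSigns (skipNat (skipNat l.tail))).2)
termination_by l => l.length
decreasing_by
  all_goals
    have h1 := length_skipNat_le l.tail
    have h2 := length_skipNat_le (skipNat l.tail)
    have h3 := l.length_tail
    simp only [List.length_cons]
    omega

theorem length_readSigns_le (l : List Bool) :
    (readSigns l).1.length ≤ l.length ∧ (readSigns l).2.length ≤ l.length := by
  fun_induction readSigns l with
  | case1 => simp
  | case2 => simp
  | case3 l ih =>
    have h1 := length_skipNat_le l.tail
    have h2 := length_skipNat_le (skipNat l.tail)
    have h3 := l.length_tail
    have h4 := List.length_take_le 1 l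
    constructor
    · rcases l with _ | ⟨b, l⟩
      · simp [skipNat, readSigns]
      · simp at *
        omega
    · simp; omega

theorem readSigns_encList (v : List ℚ) (l : List Bool) :
    readSigns (encList encRat v ++ l) = (v.map fun q => decide (q < 0), l) := by
  induction v with
  | nil => simp [encList, readSigns]
  | cons q v ih =>
    have : encList encRat (q :: v) ++ l = true :: decide (q < 0) ::
        (encNat q.num.natAbs ++ (encNat q.den ++ (encList encRat v ++ l))) := by
      simp [encList, encRat]
    rw [this, readSigns, List.tail_cons, skipNat_encNat, skipNat_encNat, ih]
    simp

def readSignsLoop : Prog :=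
  .loop 13 (.branch 20 (.pop 13) (.seq (.pop 20) (.pop 13)) (.seq (.pop 20)
    (.seq (.branch 20 .skip (.seq (.pop 20) (.push 12 false)) (.seq (.pop 20) (.push 12 true)))
      (.seq skipNatProg skipNatProg))))

theorem reach_readSignsLoop (l : List Bool) : ∀ {s : Store}, s 20 = l → s 13 = [true] →
    s 11 = [] → Reach readSignsLoop s ((8 * l.length + 30) * (l.length + 1))
      (update (update (update s 13 []) 20 (readSigns l).2) 12 ((readSigns l).1.reverse ++ s 12)) := by
  fun_induction readSigns l with
  | case1 =>
    intro s hs h13 h11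
    refine ((Reach.loop_step (by simp [h13]) (Reach.branch_nil hs (Reach.pop 13 s))
      (Reach.loop_done (by simp [h13]))).mono (by simp)).of_eq ?_
    simp [h13]
    funext r
    simp only [update_apply]
    split_ifs <;> simp_all
  | case2 l =>
    intro s hs h13 h11
    refine ((Reach.loop_step (by simp [h13]) (Reach.branch_false hs ((Reach.pop 20 s).seq
      (Reach.pop 13 _))) (Reach.loop_done (by simp [h13]))).mono (by simp; nlinarith)).of_eq ?_
    simp [h13, hs]
    funext r
    simp only [update_apply]
    split_ifs <;> simp_all
  | case3 l ih =>
    intro s hs h13 h11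
    have h1 := length_skipNat_le l.tail
    have h2 := length_skipNat_le (skipNat l.tail)
    have h3 := l.length_tail
    have hb : Reach (.branch 20 .skip (.seq (.pop 20) (.push 12 false))
        (.seq (.pop 20) (.push 12 true))) (update s 20 l) 3
        (update (update s 20 l.tail) 12 (l.take 1 ++ s 12)) := by
      rcases l with _ | ⟨_ | _, l⟩
      · exact ((Reach.branch_nil (by simp) (Reach.skip _)).mono (by omega)).of_eq (by simp)
      · exact (Reach.branch_false (update_self ..) ((Reach.pop 20 _).seq
          (Reach.push 12 false _))).of_eq (by simp)
      · exact (Reach.branch_true (update_self ..) ((Reach.pop 20 _).seq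
          (Reach.push 12 true _))).of_eq (by simp)
    have hp : Reach (.pop 20) s 1 (update s 20 l) := (Reach.pop 20 s).of_eq (by rw [hs]; rfl)
    have sk1 := reach_skipNatProg (s := update (update s 20 l.tail) 12 (l.take 1 ++ s 12))
      (by simp [h11])
    have sk2 := reach_skipNatProg (s := update (update (update s 20 l.tail) 12
      (l.take 1 ++ s 12)) 20 (skipNat l.tail)) (by simp [h11])
    simp only [ne_eq, Nat.reduceEqDiff, not_false_eq_true, update_of_ne, update_self] at sk1 sk2
    refine ((Reach.loop_step (by simp [h13]) (Reach.branch_true hs (hp.seq (hb.seq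
      (sk1.seq sk2)))) (ih (by simp) (by simp [h13]) (by simp [h11]))).mono ?_).of_eq ?_
    · rw [List.length_cons]
      have h4 : (skipNat (skipNat l.tail)).length ≤ l.length := by omega
      have h5 := Nat.mul_le_mul (Nat.add_le_add_right (Nat.mul_le_mul_left 8 h4) 30)
        (Nat.add_le_add_right h4 1)
      have h6 : (skipNat l.tail).length ≤ l.length := by omega
      have h7 : l.tail.length ≤ l.length := by omega
      nlinarith
    · have hrev : (l.take 1).reverse = l.take 1 := by cases l <;> simp
      simp [hrev]
      funext r
      simp only [update_apply]
      split_ifs <;> simp_all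

def readSignsProg : Prog := .seq (.push 13 true) (.seq readSignsLoop (move 12 14))

theorem reach_readSignsProg {s : Store} (h11 : s 11 = []) (h12 : s 12 = []) (h13 : s 13 = [])
    (h14 : s 14 = []) :
    Reach readSignsProg s (40 * ((s 20).length + 1) ^ 2)
      (update (update s 20 (readSigns (s 20)).2) 14 (readSigns (s 20)).1) := by
  refine (((Reach.push 13 true s).seq ((reach_readSignsLoop (s 20) (by simp) (by simp [h13])
    (by simp [h11])).seq (reach_move (by decide) _))).mono ?_).of_eq ?_
  · have := (length_readSigns_le (s 20)).1
    simp [h12]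
    nlinarith
  · simp [h12, h14]
    funext r
    simp only [update_apply]
    split_ifs <;> simp_all

/-! ### Evaluating the formula at the rounded weights -/

/-- The truth value of a variable whose sign bit is the given entry of `bits`. -/
def truth (bits : List Bool) (i : ℕ) : Bool := !(bits.getD i false)

/-- Each `true` of the code discards one sign bit, so at the `false` the top of register `12` is the
sign of the literal's variable. An exhausted register counts as sign `false`, in agreement with
`truth`. -/
def evalLitLoop (t : ℕ) : Prog :=
  .loop t (.branch t .skip
    (.seq (.pop t) (.seq (.branch t .skip (.branch 12 .skip .skip (.push 17 true))
      (.branch 12 (.push 17 true) (.push 17 true) .skip)) (.pop t)))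
    (.seq (.pop t) (.pop 12)))

theorem reach_evalLitLoop {t : ℕ} (h12 : t ≠ 12) (h17 : t ≠ 17) (b : Bool) (i : ℕ)
    (bits : List Bool) {s : Store} (ht : s t = litCode (i, b)) (hs : s 12 = bits) :
    Reach (evalLitLoop t) s (4 * i + 8) (update (update (update s t []) 12 (bits.drop i)) 17
      (if truth bits i = b then true :: s 17 else s 17)) := by
  induction i generalizing bits s with
  | zero =>
    have ht' : s t = false :: [b] := by simp [ht, litCode]
    have hb : Reach (.branch t .skip (.branch 12 .skip .skip (.push 17 true))
        (.branch 12 (.push 17 true) (.push 17 true) .skip)) (update s t [b]) 3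
        (update (update s t [b]) 17 (if truth bits 0 = b then true :: s 17 else s 17)) := by
      have e17 : update s t [b] 17 = s 17 := update_of_ne h17.symm ..
      have e12 : update s t [b] 12 = s 12 := update_of_ne h12.symm ..
      cases b
      · refine Reach.branch_false (update_self ..) ?_
        rcases bits with _ | ⟨_ | _, l⟩
        · exact (Reach.branch_nil (e12.trans hs) (Reach.skip _)).of_eq (by simp [truth, ← e17])
        · exact (Reach.branch_false (e12.trans hs) (Reach.skip _)).of_eq (by simp [truth, ← e17])
        · exact (Reach.branch_true (e12.trans hs) (Reach.push 17 true _)).of_eq (by simp [truth, e17])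
      · refine Reach.branch_true (update_self ..) ?_
        rcases bits with _ | ⟨_ | _, l⟩
        · exact (Reach.branch_nil (e12.trans hs) (Reach.push 17 true _)).of_eq (by simp [truth, e17])
        · exact (Reach.branch_false (e12.trans hs) (Reach.push 17 true _)).of_eq
            (by simp [truth, e17])
        · exact (Reach.branch_true (e12.trans hs) (Reach.skip _)).of_eq (by simp [truth, ← e17])
    have hp : Reach (.pop t) s 1 (update s t [b]) := (Reach.pop t s).of_eq (by rw [ht']; rfl)
    refine ((Reach.loop_step (by simp [ht']) (Reach.branch_false ht' (hp.seq (hb.seq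
      (Reach.pop t _)))) (Reach.loop_done (by simp [h17]))).mono (by omega)).of_eq ?_
    simp [h17]
    funext r
    simp only [update_apply]
    split_ifs <;> simp_all
  | succ i ih =>
    have ht' : s t = true :: litCode (i, b) := by simp [ht, litCode, List.replicate_succ]
    have hd : truth bits (i + 1) = truth bits.tail i := by cases bits <;> simp [truth]
    refine ((Reach.loop_step (by simp [ht']) (Reach.branch_true ht' ((Reach.pop t s).seq
      (Reach.pop 12 _))) (ih bits.tail (by simp [ht', h12]) (by simp [h12.symm, hs]))).mono
      (by omega)).of_eq ?_
    simp [hd, h17.symm]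
    funext r
    simp only [update_apply]
    split_ifs <;> simp_all

def evalLit (t : ℕ) : Prog := .seq (copy 14 12 8) (.seq (evalLitLoop t) (clear 12))

theorem reach_evalLit {t : ℕ} (h12 : t ≠ 12) (h17 : t ≠ 17) {l : ℕ × Bool}
    {s : Store} (ht : s t = litCode l) (hs12 : s 12 = []) (hs8 : s 8 = []) :
    Reach (evalLit t) s (11 * (s 14).length + 4 * l.1 + 11) (update (update s t []) 17
      (if truth (s 14) l.1 = l.2 then true :: s 17 else s 17)) := by
  have step := (reach_copy (a := 14) (b := 12) (x := 8) (by decide) (by decide) (by decide) hs12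
    hs8).seq ((reach_evalLitLoop h12 h17 l.2 l.1 (s 14) (by simpa [h12] using ht) (by simp)).seq
    (reach_clear 12 _))
  refine (step.mono ?_).of_eq ?_
  · simp
    omega
  · simp
    funext r
    simp only [update_apply]
    split_ifs <;> simp_all

def evalClause (D : ℕ) : Prog :=
  .seq (evalLit 5) (.seq (evalLit 6) (.seq (evalLit 7)
    (.seq (.branch 17 (pushAll 15 (List.replicate D true)) .skip .skip)
      (.seq (clear 17) (.push 16 true)))))

def penalty {n : ℕ} (D : ℕ) (bits : List Bool) (c : Clause3 n) : ℕ :=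
  if Clause3.eval (fun i => truth bits i) c then 0 else D

/-- One bit for every satisfied literal of `c`. -/
def satisfied {n : ℕ} (bits : List Bool) (c : Clause3 n) : List Bool :=
  (if truth bits (c.lits 2).1 = (c.lits 2).2 then [true] else []) ++
    ((if truth bits (c.lits 1).1 = (c.lits 1).2 then [true] else []) ++
      (if truth bits (c.lits 0).1 = (c.lits 0).2 then [true] else []))

theorem satisfied_cases {n : ℕ} (bits : List Bool) (c : Clause3 n) :
    (satisfied bits c = [] ∧ Clause3.eval (fun i => truth bits i) c = false) ∨
      ((∃ l, satisfied bits c = true :: l) ∧ Clause3.eval (fun i => truth bits i) c = true) := by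
  have h : Clause3.eval (fun i => truth bits i) c = true ↔ truth bits (c.lits 0).1 = (c.lits 0).2 ∨
      truth bits (c.lits 1).1 = (c.lits 1).2 ∨ truth bits (c.lits 2).1 = (c.lits 2).2 := by
    simp [Clause3.eval, Clause3.lits, Fin.exists_fin_succ]
  rw [← Bool.not_eq_true, h]
  unfold satisfied
  split_ifs <;> simp_all

theorem length_satisfied_le {n : ℕ} (bits : List Bool) (c : Clause3 n) :
    (satisfied bits c).length ≤ 3 := by
  unfold satisfied
  split_ifs <;> simp

theorem reach_evalClause {n : ℕ} (D : ℕ) (c : Clause3 n) {s : Store}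
    (h8 : s 8 = []) (h12 : s 12 = []) (h17 : s 17 = [])
    (h5 : s 5 = []) (h6 : s 6 = []) (h7 : s 7 = []) :
    Reach (evalClause D) (loadLits c.lits s) (33 * (s 14).length + 12 * n + D + 60)
      (update (update s 15 (List.replicate (penalty D (s 14) c) true ++ s 15)) 16
        (true :: s 16)) := by
  set s0 := loadLits c.lits s with hs0
  have s1 := reach_evalLit (t := 5) (l := c.lits 0) (s := s0) (by decide) (by decide)
    (by simp [s0, loadLits]) (by simp [s0, loadLits, h12]) (by simp [s0, loadLits, h8])
  set sA := update (update s0 5 []) 17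
      (if truth (s0 14) (c.lits 0).1 = (c.lits 0).2 then true :: s0 17 else s0 17) with hsA
  have s2 := reach_evalLit (t := 6) (l := c.lits 1) (s := sA) (by decide) (by decide)
    (by simp [s0, sA, loadLits]) (by simp [s0, sA, loadLits, h12])
    (by simp [s0, sA, loadLits, h8])
  set sB := update (update sA 6 []) 17
      (if truth (sA 14) (c.lits 1).1 = (c.lits 1).2 then true :: sA 17 else sA 17) with hsB
  have s3 := reach_evalLit (t := 7) (l := c.lits 2) (s := sB) (by decide) (by decide)
    (by simp [s0, sA, sB, loadLits]) (by simp [s0, sA, sB, loadLits, h12])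
    (by simp [s0, sA, sB, loadLits, h8])
  set sC := update (update sB 7 []) 17
      (if truth (sB 14) (c.lits 2).1 = (c.lits 2).2 then true :: sB 17 else sB 17) with hsC
  have e14 : s0 14 = s 14 ∧ sA 14 = s 14 ∧ sB 14 = s 14 := by simp [s0, sA, sB, loadLits]
  have e17 : s0 17 = [] := by simp [s0, loadLits, h17]
  have hC : sC = update s 17 (sC 17) := by
    funext r
    rcases eq_or_ne r 17 with rfl | hr
    · simp
    rw [update_of_ne hr, hsC, update_of_ne hr]
    rcases eq_or_ne r 7 with rfl | hr7
    · simp [h7]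
    rw [update_of_ne hr7, hsB, update_of_ne hr]
    rcases eq_or_ne r 6 with rfl | hr6
    · simp [h6]
    rw [update_of_ne hr6, hsA, update_of_ne hr]
    rcases eq_or_ne r 5 with rfl | hr5
    · simp [h5]
    rw [update_of_ne hr5, hs0, loadLits, update_of_ne hr7, update_of_ne hr6, update_of_ne hr5]
  have hC17 : sC 17 = satisfied (s 14) c := by
    have b1 : sA 17 = if truth (s 14) (c.lits 0).1 = (c.lits 0).2 then [true] else [] := by
      simp [sA, e14, e17]
    have b2 : sB 17 = if truth (s 14) (c.lits 1).1 = (c.lits 1).2 then true :: sA 17 else sA 17 := by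
      rw [hsB, update_self, e14.2.1]
    have b3 : sC 17 = if truth (s 14) (c.lits 2).1 = (c.lits 2).2 then true :: sB 17 else sB 17 := by
      rw [hsC, update_self, e14.2.2]
    rw [b3, b2, b1, satisfied]
    split_ifs <;> rfl
  have hlen : (sC 17).length ≤ 3 := hC17 ▸ length_satisfied_le _ _
  have hbr : Reach (.branch 17 (pushAll 15 (List.replicate D true)) .skip .skip) sC (D + 2)
      (update sC 15 (List.replicate (penalty D (s 14) c) true ++ sC 15)) := by
    rcases satisfied_cases (s 14) c with ⟨hl, hev⟩ | ⟨⟨l, hl⟩, hev⟩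
    · have : penalty D (s 14) c = D := by simp [penalty, hev]
      rw [this]
      exact ((Reach.branch_nil (hC17.trans hl) (reach_pushAll 15 _ _)).mono (by simp)).of_eq
        (by simp)
    · have : penalty D (s 14) c = 0 := by simp [penalty, hev]
      rw [this]
      exact ((Reach.branch_true (hC17.trans hl) (Reach.skip _)).mono (by omega)).of_eq (by simp)
  have step := s1.seq (s2.seq (s3.seq (hbr.seq ((reach_clear 17 _).seq (Reach.push 16 true _)))))
  refine (step.mono ?_).of_eq ?_
  · have l0 : (c.lits 0).1 < n := (c 0).1.isLt
    have l1 : (c.lits 1).1 < n := (c 1).1.isLt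
    have l2 : (c.lits 2).1 < n := (c 2).1.isLt
    rw [e14.1, e14.2.1, e14.2.2]
    simp
    omega
  · generalize sC 17 = L at hC
    rw [hC]
    clear * - h17
    simp
    funext r
    simp only [update_apply]
    split_ifs <;> simp_all

/-- Subtracts register `16` from register `15`. -/
def subtract : Prog := .loop 16 (.seq (.pop 16) (.pop 15))

theorem reach_subtract (b : ℕ) : ∀ (a : ℕ) {s : Store}, s 16 = List.replicate b true →
    s 15 = List.replicate a true →
    Reach subtract s (3 * b + 1) (update (update s 16 []) 15 (List.replicate (a - b) true)) := by
  induction b with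
  | zero =>
    intro a s h16 h15
    refine ((Reach.loop_done (by simpa using h16)).mono (by omega)).of_eq ?_
    funext r
    simp only [update_apply]
    split_ifs <;> simp_all
  | succ b ih =>
    intro a s h16 h15
    refine ((Reach.loop_step (by simp [h16, List.replicate_succ]) ((Reach.pop 16 s).seq
      (Reach.pop 15 _)) (ih (a - 1) (by simp [h16]) (by simp [h15]))).mono (by omega)).of_eq ?_
    rw [Nat.sub_sub, add_comm 1 b]
    simp
    funext r
    simp only [update_apply]
    split_ifs <;> simp_all

/-- At most a `1 / D` fraction of the clauses is violated by the rounded weights. -/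
def Passes {n : ℕ} (D : ℕ) (φ : CNF3 n) (bits : List Bool) : Prop :=
  φ.violated (fun i => truth bits i) * D ≤ φ.length

instance {n : ℕ} (D : ℕ) (φ : CNF3 n) (bits : List Bool) : Decidable (Passes D φ bits) :=
  inferInstanceAs (Decidable (_ ≤ _))

/-- With `V` violated clauses out of `M`, register `15` finally has length `V * D - M`, truncated at
zero; it is empty exactly when `V * D ≤ M`. Register `18` is only ever pushed, so it records the
disjunction over all tested vectors. -/
def test (D : ℕ) : Prog :=
  .seq (copy 1 0 8) (.seq (forClauses (evalClause D)) (.seq subtract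
    (.seq (.branch 15 (.push 18 true) .skip .skip) (.seq (clear 15) (clear 14)))))

/-- The registers that the evaluation uses for input and scratch work are empty. -/
def EvalReady (s : Store) : Prop := ∀ r ∈ [0, 5, 6, 7, 8, 11, 12, 13, 15, 16, 17], s r = []

theorem sum_penalty {n : ℕ} (D : ℕ) (bits : List Bool) (φ : CNF3 n) :
    (φ.map (penalty D bits)).sum = φ.violated (fun i => truth bits i) * D := by
  induction φ with
  | nil => simp [CNF3.violated]
  | cons c φ ih =>
    rw [List.map_cons, List.sum_cons, ih]
    unfold CNF3.violated penalty
    rw [List.countP_cons]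
    by_cases h : Clause3.eval (fun i => truth bits i) c = true
    · simp [h]
    · simp [h]; ring

theorem reach_test {n : ℕ} (D : ℕ) (φ : CNF3 n) {s : Store} (hs : EvalReady s)
    (h1 : s 1 = encList encClause φ) :
    Reach (test D) s ((50 + 2 * D) * ((s 1).length + (s 14).length + n + D + 10) * (φ.length + 2))
      (update (update s 14 []) 18 (if Passes D φ (s 14) then true :: s 18 else s 18)) := by
  have h0 : s 0 = [] := hs _ (by simp)
  have h8 : s 8 = [] := hs _ (by simp)
  set bits := s 14 with hbits
  have main := reach_forClauses (n := n) (T := 33 * bits.length + 12 * n + D + 60)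
    (body := evalClause D)
    (fun s => (∀ r ∈ [5, 6, 7, 8, 11, 12, 17], s r = []) ∧ s 14 = bits)
    (fun c s => update (update s 15 (List.replicate (penalty D bits c) true ++ s 15)) 16
        (true :: s 16)) ?_ ?_ ?_ ?_ ?_ φ (s := update s 0 (s 1)) ⟨?_, by simp [hbits]⟩
    (by simpa using h1)
  · have hfold : ∀ (φ : CNF3 n) (s : Store), φ.foldl (fun (s : Store) c =>
        update (update s 15 (List.replicate (penalty D bits c) true ++ s 15)) 16 (true :: s 16)) s =
        update (update s 15 (List.replicate (φ.map (penalty D bits)).sum true ++ s 15)) 16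
          (List.replicate φ.length true ++ s 16) := by
      intro φ
      induction φ with
      | nil => intro s; simp
      | cons c φ ih =>
        intro s
        rw [List.foldl_cons, ih, List.map_cons, List.sum_cons, add_comm (penalty D bits c),
          List.length_cons, List.replicate_succ']
        simp
        funext r
        simp only [update_apply]
        split_ifs
        · rfl
        · rw [List.replicate_add, List.append_assoc]
        · rfl
    rw [hfold, sum_penalty] at main
    set V := φ.violated (fun i => truth bits i) with hV
    have hVle : V ≤ φ.length := List.countP_le_length
    have h15 : s 15 = [] := hs _ (by simp)
    have h16 : s 16 = [] := hs _ (by simp)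
    have c1 := reach_copy (a := 1) (b := 0) (x := 8) (by decide) (by decide) (by decide) h0 h8
    have c3 := reach_subtract φ.length (V * D) (s := update (update (update (update s 0 (s 1)) 15
      (List.replicate (V * D) true ++ update s 0 (s 1) 15)) 16
        (List.replicate φ.length true ++ update s 0 (s 1) 16)) 0 []) (by simp [h16]) (by simp [h15])
    have c4 : ∀ s' : Store, s' 15 = List.replicate (V * D - φ.length) true →
        Reach (.branch 15 (.push 18 true) .skip .skip) s' 2
          (update s' 18 (if Passes D φ bits then true :: s' 18 else s' 18)) := by
      intro s' h'
      by_cases hp : Passes D φ bits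
      · have : V * D - φ.length = 0 := Nat.sub_eq_zero_of_le hp
        rw [this] at h'
        exact (Reach.branch_nil h' (Reach.push 18 true _)).of_eq (by simp [hp])
      · obtain ⟨m, hm⟩ : ∃ m, V * D - φ.length = m + 1 :=
          ⟨V * D - φ.length - 1, by have : ¬ V * D ≤ φ.length := hp; omega⟩
        rw [hm, List.replicate_succ] at h'
        exact (Reach.branch_true h' (Reach.skip _)).of_eq (by simp [hp])
    have step := c1.seq (main.seq (c3.seq ((c4 _ (by simp)).seq
      ((reach_clear 15 _).seq (reach_clear 14 _)))))
    refine (step.mono ?_).of_eq ?_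
    · simp
      have hVD : V * D ≤ φ.length * D := Nat.mul_le_mul_right _ hVle
      have : V * D - φ.length ≤ φ.length * D := by omega
      nlinarith
    · simp
      funext r
      simp only [update_apply]
      split_ifs <;> simp_all
  · rintro c s ⟨h, h14⟩
    rw [← h14]
    exact reach_evalClause D c (h _ (by simp)) (h _ (by simp)) (h _ (by simp)) (h _ (by simp))
      (h _ (by simp)) (h _ (by simp))
  · rintro c s ⟨h, h14⟩
    refine ⟨fun r hr => ?_, by simpa using h14⟩
    simp only [List.mem_cons, List.not_mem_nil, or_false] at hr
    rw [update_of_ne (by omega), update_of_ne (by omega), h r (by simpa using hr)]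
  · rintro s ⟨h, h14⟩ r hr
    simp only [List.mem_cons, List.not_mem_nil, or_false] at hr
    exact h r (by simp; omega)
  · rintro s v ⟨h, h14⟩
    refine ⟨fun r hr => ?_, by simpa using h14⟩
    simp only [List.mem_cons, List.not_mem_nil, or_false] at hr
    rw [update_of_ne (by omega), h r (by simpa using hr)]
  · intro c s v
    simp
    funext r
    simp only [update_apply]
    split_ifs <;> simp_all
  · intro r hr
    simp only [List.mem_cons, List.not_mem_nil, or_false] at hr
    rw [update_of_ne (by omega), hs r (by simp; omega)]

/-! ### Reading the output of the training algorithm -/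

/-- The sign bits of the first `k` vectors in an encoded list. -/
def signVectors : ℕ → List Bool → List (List Bool)
  | 0, _ => []
  | k + 1, y => (readSigns y.tail).1 :: signVectors k (readSigns y.tail).2

theorem signVectors_encWeights {n k : ℕ} (w : Fin k → Fin n → ℚ) :
    signVectors k (encWeights w) =
      List.ofFn fun j => List.ofFn fun i => decide (w j i < 0) := by
  have : ∀ (L : List (Fin n → ℚ)) (r : List Bool),
      signVectors L.length (encList encVec L ++ r) =
        L.map fun v => List.ofFn fun i => decide (v i < 0) := by
    intro L r
    induction L with
    | nil => rfl
    | cons v L ih =>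
      have e : encList encVec (v :: L) ++ r =
          true :: (encList encRat (List.ofFn v) ++ (encList encVec L ++ r)) := by
        simp [encList, encVec]
      rw [e, List.length_cons, signVectors, List.tail_cons, readSigns_encList, ih]
      simp [List.map_ofFn]
      rfl
  have h := this (List.ofFn w) []
  rw [List.length_ofFn, List.append_nil, List.map_ofFn] at h
  exact h

def decode (D : ℕ) : ℕ → Prog
  | 0 => .skip
  | k + 1 => .seq (.pop 20) (.seq readSignsProg (.seq (test D) (decode D k)))

/-- Register `20` is arbitrary here: on unrealizable inputs `A` may output any bit string, and
decoding must still halt in time. -/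
theorem reach_decode {n : ℕ} (D : ℕ) (φ : CNF3 n) (X : ℕ) (k : ℕ) : ∀ {s : Store}, EvalReady s →
    s 14 = [] → s 1 = encList encClause φ → (s 1).length + (s 20).length + n + D + 10 ≤ X →
    φ.length + 2 ≤ X →
    ∃ s', Reach (decode D k) s (k * ((91 + 2 * D) * X ^ 2 + 1) + 1) s' ∧ s' 0 = [] ∧
      (s' 18 ≠ [] ↔ s 18 ≠ [] ∨ ∃ bits ∈ signVectors k (s 20), Passes D φ bits) := by
  induction k with
  | zero =>
    intro s hs h14 h1 hX hX'
    exact ⟨s, (Reach.skip s).mono (by simp), hs _ (by simp), by simp [signVectors]⟩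
  | succ k ih =>
    intro s hs h14 h1 hX hX'
    have hl := length_readSigns_le (s 20).tail
    have ht := (s 20).length_tail
    have r1 := reach_readSignsProg (s := update s 20 (s 20).tail)
      (by simp [hs 11 (by simp)]) (by simp [hs 12 (by simp)]) (by simp [hs 13 (by simp)])
      (by simp [h14])
    set sA := update (update (update s 20 (s 20).tail) 20
      (readSigns (update s 20 (s 20).tail 20)).2) 14
      (readSigns (update s 20 (s 20).tail 20)).1 with hsA
    have hA : EvalReady sA := by
      intro r hr
      simp only [List.mem_cons, List.not_mem_nil, or_false] at hr
      rw [hsA, update_of_ne (by omega), update_of_ne (by omega), update_of_ne (by omega),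
        hs r (by simpa using hr)]
    have r2 := reach_test D φ hA (by simp [sA, h1])
    set sB := update (update sA 14 []) 18 (if Passes D φ (sA 14) then true :: sA 18 else sA 18)
      with hsB
    have hB : EvalReady sB := by
      intro r hr
      have hr' := hr
      simp only [List.mem_cons, List.not_mem_nil, or_false] at hr
      rw [hsB, update_of_ne (by omega), update_of_ne (by omega), hA r hr']
    have e20 : sB 20 = (readSigns (s 20).tail).2 := by simp [sB, sA]
    have e1 : sA 1 = s 1 := by simp [sA]
    have e14 : sA 14 = (readSigns (s 20).tail).1 := by simp [sA]
    obtain ⟨s', r3, h0', h18'⟩ := ih (s := sB) hB (by simp [sB]) (by simp [sB, sA, h1])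
      (by rw [e20, show sB 1 = s 1 by simp [sB, sA]]; omega) hX'
    refine ⟨s', ((Reach.pop 20 s).seq (r1.seq (r2.seq r3))).mono ?_, h0', ?_⟩
    · rw [e1, e14, update_self]
      have b1 : (40 * ((s 20).tail.length + 1) ^ 2) ≤ 40 * X ^ 2 :=
        Nat.mul_le_mul_left _ (Nat.pow_le_pow_left (by omega) 2)
      have b2 : (50 + 2 * D) * ((s 1).length + (readSigns (s 20).tail).1.length + n + D + 10) *
          (φ.length + 2) ≤ (50 + 2 * D) * X * X :=
        Nat.mul_le_mul (Nat.mul_le_mul_left _ (by omega)) hX'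
      nlinarith
    · rw [h18', e20]
      have e18 : sA 18 = s 18 := by simp [sA]
      simp only [signVectors, List.mem_cons, exists_eq_or_imp, sB, update_self, e14, e18]
      split_ifs with hp <;> simp [hp]

/-! ### The value of a network at a sample -/

def sgn (b : Bool) : ℝ := if b then 1 else -1

/-- The inner product of a weight vector with coordinates `u`, `p` with a sample point. -/
noncomputable def act {k n : ℕ} (K : Kind k) (e : ℕ) (c : Clause3 n) (u : Fin n → ℝ)
    (p : Fin k → ℝ) : ℝ :=
  (varScale k : ℝ) * ∑ t, (K.mult t : ℝ) * (sgn (c t).2 * u (c t).1) +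
    ∑ j, ((K.aux j).val e : ℝ) * p j

theorem sum_literalCoeff {n : ℕ} (l : Literal n) (z : ℤ) (u : Fin n → ℝ) :
    ∑ i : Fin n, u i * (literalCoeff (l.1, l.2) z i : ℝ) = z * (sgn l.2 * u l.1) := by
  rw [Finset.sum_eq_single l.1]
  · cases h : l.2 <;> simp [literalCoeff, sgn] <;> ring
  · intro i _ hi
    have : ¬ ((l.1 : ℕ) = i) := fun h => hi (Fin.ext h.symm)
    simp [literalCoeff, this]
  · simp

theorem inner_point {k n : ℕ} (K : Kind k) (e : ℕ) (c : Clause3 n)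
    (w : EuclideanSpace ℝ (Fin (n + k))) :
    inner ℝ w (toReal (K.point e c)) =
      act K e c (fun i => w (Fin.castAdd k i)) fun j => w (Fin.natAdd n j) := by
  rw [PiLp.inner_apply, Fin.sum_univ_add, act]
  congr 1
  · have : ∀ i : Fin n, inner ℝ (w (Fin.castAdd k i)) (toReal (K.point e c) (Fin.castAdd k i)) =
        (varScale k : ℝ) * (w (Fin.castAdd k i) * (literalCoeff ((c 0).1, (c 0).2) (K.mult 0) i : ℝ) +
          w (Fin.castAdd k i) * (literalCoeff ((c 1).1, (c 1).2) (K.mult 1) i : ℝ) +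
          w (Fin.castAdd k i) * (literalCoeff ((c 2).1, (c 2).2) (K.mult 2) i : ℝ)) := by
      intro i
      simp [toReal, Kind.point, clauseCoeff, Clause3.lits]
      ring
    simp only [this, ← Finset.mul_sum, Finset.sum_add_distrib]
    congr 1
    rw [Fin.sum_univ_three]
    congr 1
    · congr 1
      · exact sum_literalCoeff (c 0) (K.mult 0) fun i => w (Fin.castAdd k i)
      · exact sum_literalCoeff (c 1) (K.mult 1) fun i => w (Fin.castAdd k i)
    · exact sum_literalCoeff (c 2) (K.mult 2) fun i => w (Fin.castAdd k i)
  · refine Finset.sum_congr rfl fun j _ => ?_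
    simp [toReal, Kind.point]

/-- The error of a network on a sample. -/
noncomputable def sampleError {k n : ℕ} (K : Kind k) (e : ℕ) (c : Clause3 n)
    (u : Fin k → Fin n → ℝ) (p : Fin k → Fin k → ℝ) : ℝ :=
  ∑ l, rectifier (act K e c (u l) (p l)) - (K.label.val e : ℝ)

theorem sum_instanceOf {k n : ℕ} (Ks : List (Kind k)) (e : ℕ) (φ : CNF3 n)
    (w : Fin k → EuclideanSpace ℝ (Fin (n + k))) :
    ((instanceOf Ks e φ).toReal.map fun z => (relu w 1 z.1 - z.2) ^ 2).sum =
      (φ.map fun c => (Ks.map fun K => sampleError K e c (fun l i => w l (Fin.castAdd k i))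
        (fun l j => w l (Fin.natAdd n j)) ^ 2).sum).sum := by
  rw [RatSamples.toReal, List.map_map, instanceOf]
  induction φ with
  | nil => simp
  | cons c φ ih =>
    rw [List.flatMap_cons, List.map_append, List.sum_append, ih, List.map_cons, List.sum_cons,
      List.map_map]
    congr 3
    funext K
    simp [relu, Kind.sample, inner_point, sampleError]

theorem length_instanceOf {k n : ℕ} (Ks : List (Kind k)) (e : ℕ) (φ : CNF3 n) :
    (instanceOf Ks e φ).toReal.length = φ.length * Ks.length := by
  simp [RatSamples.toReal, instanceOf, List.length_flatMap]

/-- Markov's inequality for lists. It is also used with the constant predicate `true`, as a bound by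
the sum of a common lower bound. -/
theorem countP_mul_le_sum {α : Type} (q : α → Bool) (f : α → ℝ) (a : ℝ) (l : List α)
    (h : ∀ c ∈ l, q c = true → a ≤ f c) (h0 : ∀ c ∈ l, 0 ≤ f c) :
    (l.countP q : ℝ) * a ≤ (l.map f).sum := by
  induction l with
  | nil => simp
  | cons c l ih =>
    have ih' := ih (fun c hc => h c (List.mem_cons_of_mem _ hc))
      fun c hc => h0 c (List.mem_cons_of_mem _ hc)
    rw [List.countP_cons, List.map_cons, List.sum_cons]
    have h1 := h c List.mem_cons_self
    have h2 := h0 c List.mem_cons_self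
    by_cases hq : q c = true
    · have := h1 hq
      simp [hq]; linarith
    · simp [hq]; linarith

/-! ### The kinds of samples -/

/-- The size of the last coordinates that switch off a unit. -/
def auxScale (k : ℕ) : ℚ := (2 ^ k)⁻¹

/-- The first three kinds pin down the auxiliary weights: column `i` has positive part of total mass
`1/2` and no negative part, and subtracting another column inside the rectifiers loses none of this
mass, so distinct columns have disjoint supports. -/
def posKind {k : ℕ} (i : Fin k) : Kind k :=
  ⟨0, fun j => .const (if j = i then 1 else 0), .const (1 / 2)⟩

def negKind {k : ℕ} (i : Fin k) : Kind k :=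
  ⟨0, fun j => .const (if j = i then -1 else 0), .const 0⟩

def diffKind {k : ℕ} (i i' : Fin k) : Kind k :=
  ⟨0, fun j => .const ((if j = i then 1 / 2 else 0) - if j = i' then 1 / 2 else 0),
    -- For `i = i'` this is the zero point with label `0`, a harmless sample that keeps the list
    -- uniform.
    .const (if i = i' then 0 else 1 / 4)⟩

/-- The entries `-auxScale k` silence the owners of the coordinates `j ≥ 2`. The label is `varScale
k * 2^{-e}`, the scaled value of a true literal. -/
def varKind (k : ℕ) (t : Fin 3) (z : ℤ) : Kind k :=
  ⟨Pi.single t z, fun j => .const (if j.val < 2 then 0 else -auxScale k), .pos (k + 4)⟩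

/-- Coordinate `0`, of weight about `1/2` in its owner, lowers the activation by about `bC` (`b =
varScale k`, `C = 2^{-e}`): it is nonpositive iff the literal values sum to at least `-C`. The
owners of all other coordinates are silenced. -/
def clauseKind (k : ℕ) : Kind k :=
  ⟨-1, fun j => if j.val = 0 then .neg (k + 3) else .const (-auxScale k), .const 0⟩

def kinds (k : ℕ) : List (Kind k) :=
  (List.finRange k).map posKind ++ ((List.finRange k).map negKind ++
    ((List.finRange k).flatMap (fun i => (List.finRange k).map (diffKind i)) ++
      ((List.finRange 3).map (fun t => varKind k t 1) ++
        ((List.finRange 3).map (fun t => varKind k t (-1)) ++ [clauseKind k]))))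

theorem mem_kinds {k : ℕ} {K : Kind k} : K ∈ kinds k ↔ (∃ i, posKind i = K) ∨
    (∃ i, negKind i = K) ∨ (∃ i i', diffKind i i' = K) ∨ (∃ t, varKind k t 1 = K) ∨
    (∃ t, varKind k t (-1) = K) ∨ K = clauseKind k := by
  simp [kinds]

/-! ### Activations of the sample kinds. -/

section act
variable {k n : ℕ} (e : ℕ) (c : Clause3 n) (u : Fin n → ℝ) (p : Fin k → ℝ)

theorem act_posKind (i : Fin k) : act (posKind i) e c u p = p i := by
  simp [act, posKind, Scalar.val, apply_ite (Rat.cast : ℚ → ℝ)]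

theorem act_negKind (i : Fin k) : act (negKind i) e c u p = -p i := by
  simp [act, negKind, Scalar.val, apply_ite (Rat.cast : ℚ → ℝ)]

theorem act_diffKind (i i' : Fin k) : act (diffKind i i') e c u p = (p i - p i') / 2 := by
  simp [act, diffKind, Scalar.val, sub_mul, Finset.sum_sub_distrib,
    apply_ite (Rat.cast : ℚ → ℝ)]
  ring

theorem act_varKind (t : Fin 3) (z : ℤ) : act (varKind k t z) e c u p =
    varScale k * (z * (sgn (c t).2 * u (c t).1)) -
      auxScale k * ∑ j : Fin k, if j.val < 2 then 0 else p j := by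
  have h1 : ∑ t', (((Pi.single t z : Fin 3 → ℤ) t' : ℤ) : ℝ) * (sgn (c t').2 * u (c t').1) =
      z * (sgn (c t).2 * u (c t).1) := by
    rw [Finset.sum_eq_single t]
    · simp
    · intro b _ hb; simp [hb]
    · simp
  have h2 : ∑ j : Fin k, ((Scalar.const (if j.val < 2 then 0 else -auxScale k)).val e : ℝ) * p j =
      -(auxScale k * ∑ j : Fin k, if j.val < 2 then 0 else p j) := by
    rw [Finset.mul_sum, ← Finset.sum_neg_distrib]
    refine Finset.sum_congr rfl fun j _ => ?_
    split_ifs <;> simp [Scalar.val]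
  rw [act, varKind]
  simp only
  rw [h1, h2]
  ring

theorem act_clauseKind (p : Fin (k + 1) → ℝ) : act (clauseKind (k + 1)) e c u p =
    -(varScale (k + 1) * ∑ t, sgn (c t).2 * u (c t).1) -
      2 * varScale (k + 1) * (2 ^ e : ℝ)⁻¹ * p 0 -
      auxScale (k + 1) * ∑ j : Fin k, p j.succ := by
  rw [act, Fin.sum_univ_succ (n := k), Finset.mul_sum _ _ (auxScale (k + 1) : ℝ)]
  simp [clauseKind, Scalar.val, varScale, Fin.sum_univ_three]
  have : (2 ^ (k + 1 + 3 + e) : ℝ)⁻¹ = 2 * (2 ^ (k + 1 + 4))⁻¹ * (2 ^ e)⁻¹ := by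
    rw [show k + 1 + 4 = k + 1 + 3 + 1 by ring, pow_succ, pow_add]
    field_simp
  rw [this]
  ring

end act

/-! ### The rectifier. -/

theorem rectifier_nonneg (x : ℝ) : 0 ≤ rectifier x := le_max_left 0 x

theorem le_rectifier (x : ℝ) : x ≤ rectifier x := le_max_right 0 x

theorem rectifier_of_nonneg {x : ℝ} (h : 0 ≤ x) : rectifier x = x := max_eq_right h

theorem rectifier_of_nonpos {x : ℝ} (h : x ≤ 0) : rectifier x = 0 := max_eq_left h

/-! ### The auxiliary coordinates identify the units -/

/-- Every column has a unit with a large entry, and no unit is large in two columns; so choosing a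
large unit for each column is an injection of `Fin k` into itself, hence a permutation. All other
entries are small, which leaves mass about `1/2` for the chosen one. -/
theorem exists_perm_of_aux {k : ℕ} (hk : 1 ≤ k) (p : Fin k → Fin k → ℝ) {η : ℝ} (hη : 0 < η)
    (hsmall : k * ((k + 3) * η) ≤ 1 / 8)
    (h1 : ∀ i, |∑ l, rectifier (p l i) - 1 / 2| ≤ η)
    (h2 : ∀ i, ∑ l, rectifier (-p l i) ≤ η)
    (h3 : ∀ i i', i ≠ i' → 1 / 4 - η ≤ ∑ l, rectifier ((p l i - p l i') / 2)) :
    ∃ σ : Equiv.Perm (Fin k), (∀ i l, l ≠ σ i → |p l i| ≤ (k + 3) * η) ∧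
      ∀ i, |p (σ i) i - 1 / 2| ≤ k * ((k + 3) * η) := by
  have hk' : (1 : ℝ) ≤ k := by exact_mod_cast hk
  set κ := (k + 3) * η with hκ
  have hηκ : 4 * η ≤ κ := by rw [hκ]; nlinarith
  have hκk : κ ≤ k * κ := by nlinarith
  have hlow : ∀ l i, -η ≤ p l i := by
    intro l i
    have a1 := Finset.single_le_sum (f := fun l => rectifier (-p l i))
      (fun l _ => rectifier_nonneg _) (Finset.mem_univ l)
    have a2 := le_rectifier (-p l i)
    have a3 := h2 i
    linarith
  have htwo : ∀ l i i', κ ≤ p l i → κ ≤ p l i' → i = i' := by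
    intro l i i' hi hi'
    by_contra hne
    have a1 := abs_le.1 (h1 i)
    have a2 := h3 i i' hne
    -- `f l` measures the mass of column `i` lost by unit `l` when column `i'` is subtracted; the
    -- summand `η` makes it nonnegative. The samples give a total of at most `(k + 3) * η`, while a
    -- unit large in both columns would contribute `(k + 4) * η`. Hence the threshold `κ`.
    set f : Fin k → ℝ := fun l => rectifier (p l i) - 2 * rectifier ((p l i - p l i') / 2) + η
      with hf
    have hf0 : ∀ l, 0 ≤ f l := by
      intro l
      have b1 := le_rectifier (p l i)
      have b2 := rectifier_nonneg (p l i)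
      have b3 := hlow l i'
      simp only [hf]
      rcases le_total ((p l i - p l i') / 2) 0 with h | h
      · rw [rectifier_of_nonpos h]; linarith
      · rw [rectifier_of_nonneg h]; linarith
    have hfl : κ + η ≤ f l := by
      have b1 := le_rectifier (p l i)
      simp only [hf]
      rcases le_total ((p l i - p l i') / 2) 0 with h | h
      · rw [rectifier_of_nonpos h]; linarith
      · rw [rectifier_of_nonneg h]; linarith
    have a3 := Finset.single_le_sum (f := f) (fun l _ => hf0 l) (Finset.mem_univ l)
    have a4 : ∑ l, f l = ∑ l, rectifier (p l i) -
        2 * ∑ l, rectifier ((p l i - p l i') / 2) + k * η := by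
      simp [hf, Finset.sum_add_distrib, Finset.sum_sub_distrib, ← Finset.mul_sum]
    rw [hκ] at hfl
    linarith
  have hex : ∀ i, ∃ l, κ ≤ p l i := by
    intro i
    by_contra! h
    have a1 := abs_le.1 (h1 i)
    have a2 : ∑ l, rectifier (p l i) ≤ ∑ _l : Fin k, κ :=
      Finset.sum_le_sum fun l _ => max_le (by linarith) (h l).le
    simp at a2
    linarith
  choose τ hτ using hex
  have hinj : Injective τ := fun i i' h => htwo (τ i) i i' (hτ i) (h ▸ hτ i')
  let σ : Equiv.Perm (Fin k) := Equiv.ofBijective τ (Finite.injective_iff_bijective.1 hinj)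
  have hσ : ∀ i, κ ≤ p (σ i) i := hτ
  have hoff : ∀ i l, l ≠ σ i → p l i ≤ κ := by
    intro i l hl
    by_contra! h
    have := htwo l i (σ.symm l) h.le (by simpa using hσ (σ.symm l))
    exact hl (by rw [this]; simp)
  refine ⟨σ, fun i l hl => abs_le.2 ⟨by linarith [hlow l i], hoff i l hl⟩, fun i => ?_⟩
  have a1 := abs_le.1 (h1 i)
  have a2 := Finset.single_le_sum (f := fun l => rectifier (p l i))
      (fun l _ => rectifier_nonneg _) (Finset.mem_univ (σ i))
  have a3 := le_rectifier (p (σ i) i)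
  have a4 : ∑ l, rectifier (p l i) ≤ ∑ l, (κ + if l = σ i then p (σ i) i - κ else 0) := by
    refine Finset.sum_le_sum fun l _ => ?_
    split_ifs with h
    · rw [h, rectifier_of_nonneg (by linarith [hσ i])]; linarith
    · exact max_le (by linarith) (by linarith [hoff i l h])
  simp [Finset.sum_add_distrib] at a4
  exact abs_le.2 ⟨by linarith, by linarith⟩

/-! ### The variable and clause samples force a satisfying assignment -/

/-- If `V₁` were smaller, the second unit would have to supply a positive share at the point and at
its negative, forcing both `V₂ > 0` and `-V₂ > 0`: the deficit `0.9 - 0.875 - 0.01` exceeds the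
perturbation `0.01`. -/
theorem le_abs_of_two_units {C V₁ V₂ e₁ e₂ : ℝ} (hC : 0 < C) (h₁ : |e₁| ≤ C / 100)
    (h₂ : |e₂| ≤ C / 100)
    (hpos : |rectifier (V₁ + e₁) + rectifier (V₂ + e₂) - C| ≤ C / 10)
    (hneg : |rectifier (-V₁ + e₁) + rectifier (-V₂ + e₂) - C| ≤ C / 10) :
    7 / 8 * C ≤ |V₁| := by
  have a1 := abs_le.1 h₁
  have a2 := abs_le.1 h₂
  have a3 := abs_le.1 hpos
  have a4 := abs_le.1 hneg
  by_contra! h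
  have a5 := abs_lt.1 h
  unfold rectifier at a3 a4
  rcases max_cases 0 (V₁ + e₁) with ⟨b1, b1'⟩ | ⟨b1, b1'⟩ <;>
  rcases max_cases 0 (V₂ + e₂) with ⟨b2, b2'⟩ | ⟨b2, b2'⟩ <;>
  rcases max_cases 0 (-V₁ + e₁) with ⟨b3, b3'⟩ | ⟨b3, b3'⟩ <;>
  rcases max_cases 0 (-V₂ + e₂) with ⟨b4, b4'⟩ | ⟨b4, b4'⟩ <;>
  rw [b1, b2] at a3 <;> rw [b3, b4] at a4 <;> linarith

theorem sum_perm_eq {k : ℕ} (σ : Equiv.Perm (Fin (k + 2))) (f : Fin (k + 2) → ℝ)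
    (h : ∀ j : Fin k, f (σ j.succ.succ) = 0) : ∑ l, f l = f (σ 0) + f (σ 1) := by
  rw [← Equiv.sum_comp σ f, Fin.sum_univ_succ, Fin.sum_univ_succ]
  simp [h]

/-- Small weights on the auxiliary coordinates. -/
structure Pinned {k : ℕ} (p : Fin k → Fin k → ℝ) (σ : Equiv.Perm (Fin k)) (κ : ℝ) : Prop where
  off : ∀ i l, l ≠ σ i → |p l i| ≤ κ
  diag : ∀ i, |p (σ i) i - 1 / 2| ≤ k * κ

/-- The variable samples push the literals of unit `σ 0` away from `0`. If all were nonpositive,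
each would be at most `-7C/8`, and the clause sample would activate `σ 0` although its label is `0`.
-/
theorem exists_literal_pos {k n : ℕ} {e : ℕ} {c : Clause3 n} {u : Fin (k + 2) → Fin n → ℝ}
    {p : Fin (k + 2) → Fin (k + 2) → ℝ} {σ : Equiv.Perm (Fin (k + 2))} {κ : ℝ} (hκ : 0 ≤ κ)
    (hpin : Pinned p σ κ) (hu : ∀ l i, |u l i| ≤ 1)
    (hsmall : ((k + 2 : ℕ) : ℝ) * κ ≤ (2 ^ e : ℝ)⁻¹ / 1600)
    (hvar : ∀ t, |sampleError (varKind (k + 2) t 1) e c u p| ≤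
      varScale (k + 2) * (2 ^ e : ℝ)⁻¹ / 10)
    (hvar' : ∀ t, |sampleError (varKind (k + 2) t (-1)) e c u p| ≤
      varScale (k + 2) * (2 ^ e : ℝ)⁻¹ / 10)
    (hcl : |sampleError (clauseKind (k + 2)) e c u p| ≤ varScale (k + 2) * (2 ^ e : ℝ)⁻¹ / 10) :
    ∃ t, 0 < sgn (c t).2 * u (σ 0) (c t).1 := by
  obtain ⟨hoff, hdiag⟩ := hpin
  set C : ℝ := (2 ^ e : ℝ)⁻¹ with hC
  have hC0 : 0 < C := by positivity
  have hC1 : C ≤ 1 := inv_le_one_of_one_le₀ (one_le_pow₀ (by norm_num))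
  set b : ℝ := ((varScale (k + 2) : ℚ) : ℝ) with hb
  set B : ℝ := ((auxScale (k + 2) : ℚ) : ℝ) with hB
  have hb0 : 0 < b := by simp [hb, varScale]
  have hBb : B = 16 * b := by
    simp [hB, hb, auxScale, varScale, pow_add]
    ring
  set r : Fin (k + 2) → ℝ := fun l => ∑ j : Fin (k + 2), if j.val < 2 then 0 else p l j with hr
  have hcard : ∑ _j : Fin (k + 2), κ = ((k + 2 : ℕ) : ℝ) * κ := by simp
  -- the two main units
  have hmain : ∀ i : Fin (k + 2), i.val < 2 → |B * r (σ i)| ≤ b * C / 100 := by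
    intro i hi
    have : |r (σ i)| ≤ ((k + 2 : ℕ) : ℝ) * κ := by
      rw [← hcard]
      refine (Finset.abs_sum_le_sum_abs _ _).trans (Finset.sum_le_sum fun j _ => ?_)
      split_ifs with h
      · simpa using hκ
      · exact hoff j (σ i) fun h' => h (by rw [← σ.injective h']; exact hi)
    rw [abs_mul, abs_of_pos (by rw [hBb]; positivity), hBb]
    -- As `B = 16 * b`, the bound `C / 1600` on `(k + 2) * κ` gives exactly `b * C / 100`.
    nlinarith
  -- the other units are switched off
  have hrest : ∀ j : Fin k, B / 4 ≤ B * r (σ j.succ.succ) := by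
    intro j
    have : 1 / 2 - ((k + 2 : ℕ) : ℝ) * κ - ((k + 2 : ℕ) : ℝ) * κ ≤ r (σ j.succ.succ) := by
      have a1 : ∑ i : Fin (k + 2), ((if i = j.succ.succ then
          1 / 2 - ((k + 2 : ℕ) : ℝ) * κ else 0) - κ) ≤ r (σ j.succ.succ) := by
        refine Finset.sum_le_sum fun i _ => ?_
        by_cases hij : i = j.succ.succ
        · subst hij
          have := (abs_le.1 (hdiag j.succ.succ)).1
          simp only [if_true]
          rw [if_neg (by simp)]
          linarith
        · rw [if_neg hij]
          split_ifs
          · linarith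
          · have := (abs_le.1 (hoff i (σ j.succ.succ) fun h => hij (σ.injective h).symm)).1
            linarith
      rw [Finset.sum_sub_distrib, hcard] at a1
      simpa using a1
    have hB0 : 0 < B := by rw [hBb]; positivity
    nlinarith
  have hsgn : ∀ t l, |sgn (c t).2 * u l (c t).1| ≤ 1 := by
    intro t l
    rw [abs_mul]
    have : |sgn (c t).2| = 1 := by unfold sgn; split_ifs <;> simp
    rw [this, one_mul]; exact hu _ _
  have hlabel : ((((varKind (k + 2) 0 1).label).val e : ℚ) : ℝ) = b * C := by
    simp [varKind, Scalar.val, hb, hC, varScale, pow_add]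
    ring
  have hval : ∀ t (z : ℤ), |(z : ℝ)| = 1 → sampleError (varKind (k + 2) t z) e c u p =
      rectifier (b * (z * (sgn (c t).2 * u (σ 0) (c t).1)) - B * r (σ 0)) +
        rectifier (b * (z * (sgn (c t).2 * u (σ 1) (c t).1)) - B * r (σ 1)) - b * C := by
    intro t z hz
    have hl : ((((varKind (k + 2) t z).label).val e : ℚ) : ℝ) = b * C := hlabel
    rw [sampleError, hl, sum_perm_eq σ]
    · rw [act_varKind, act_varKind]
    · intro j
      rw [act_varKind]
      refine rectifier_of_nonpos ?_
      -- `B / 4 = 4 * b` outweighs `b`, the largest contribution a literal can make.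
      have a1 := hrest j
      have a2 : (z : ℝ) * (sgn (c t).2 * u (σ j.succ.succ) (c t).1) ≤ 1 := by
        refine (le_abs_self _).trans ?_
        rw [abs_mul, hz, one_mul]; exact hsgn _ _
      have a3 := mul_le_mul_of_nonneg_left a2 hb0.le
      simp only [hr] at a1
      linarith
  have hlarge : ∀ t, 7 / 8 * (b * C) ≤ |b * (sgn (c t).2 * u (σ 0) (c t).1)| := by
    intro t
    have q1 := hvar t
    have q2 := hvar' t
    rw [hval t 1 (by simp)] at q1
    rw [hval t (-1) (by simp)] at q2
    refine le_abs_of_two_units (V₂ := b * (sgn (c t).2 * u (σ 1) (c t).1)) (e₁ := -(B * r (σ 0)))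
      (e₂ := -(B * r (σ 1))) (by positivity) ?_ ?_ ?_ ?_
    · rw [abs_neg]; exact hmain 0 (by simp)
    · rw [abs_neg]; exact hmain 1 (by simp)
    · simpa [sub_eq_add_neg] using q1
    · simpa [sub_eq_add_neg] using q2
  by_contra! hneg
  have hcl' : act (clauseKind (k + 2)) e c (u (σ 0)) (p (σ 0)) ≤ b * C / 10 := by
    have a1 : sampleError (clauseKind (k + 2)) e c u p =
        ∑ l, rectifier (act (clauseKind (k + 2)) e c (u l) (p l)) := by
      simp [sampleError, clauseKind, Scalar.val]
    rw [a1] at hcl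
    refine (le_rectifier _).trans ((Finset.single_le_sum (f := fun l =>
      rectifier (act (clauseKind (k + 2)) e c (u l) (p l))) (fun l _ => rectifier_nonneg _)
        (Finset.mem_univ (σ 0))).trans ((le_abs_self _).trans hcl))
  rw [act_clauseKind] at hcl'
  change -(b * ∑ t, sgn (c t).2 * u (σ 0) (c t).1) - 2 * b * C * p (σ 0) 0 -
    B * ∑ j : Fin (k + 1), p (σ 0) j.succ ≤ b * C / 10 at hcl'
  have hs : |∑ j : Fin (k + 1), p (σ 0) j.succ| ≤ ((k + 2 : ℕ) : ℝ) * κ := by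
    refine (Finset.abs_sum_le_sum_abs _ _).trans ((Finset.sum_le_sum fun j _ =>
      hoff j.succ (σ 0) fun h => Fin.succ_ne_zero j (σ.injective h).symm).trans ?_)
    simp
    linarith
  have hs1 : B * ∑ j : Fin (k + 1), p (σ 0) j.succ ≤ b * C / 100 := by
    have := (abs_le.1 hs).2
    rw [hBb]
    nlinarith
  have hd := (abs_le.1 (hdiag 0)).2
  have hd1 : 2 * b * C * p (σ 0) 0 ≤ b * C * (1 + 2 / 1600) := by
    have a1 : p (σ 0) 0 ≤ 1 / 2 + 1 / 1600 := by linarith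
    have a2 := mul_le_mul_of_nonneg_left a1 (by positivity : 0 ≤ 2 * b * C)
    linarith
  have hl : ∀ t, 7 / 8 * (b * C) ≤ -(b * (sgn (c t).2 * u (σ 0) (c t).1)) := by
    intro t
    have := hlarge t
    rwa [abs_of_nonpos (mul_nonpos_of_nonneg_of_nonpos hb0.le (hneg t))] at this
  have l0 := hl 0
  have l1 := hl 1
  have l2 := hl 2
  -- The activation would be at least `(21/8 - 1 - 2/1600 - 1/100) * b * C`, more than `b * C / 10`.
  rw [Fin.sum_univ_three, mul_add, mul_add] at hcl'
  have : 0 < b * C := by positivity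
  linarith

/-! ### Soundness -/

/-- The exponent of the error parameter. -/
def errorExp (k D : ℕ) : ℕ :=
  -- One summand for each smallness condition in `exists_unit_rounding`; since `H ≤ 2 ^ H`, using
  -- the required factor itself as the exponent avoids logarithms.
  (kinds k).length * (1600 * k * (k + 3)) ^ 2 + (kinds k).length * (D * 100 * 4 ^ (k + 4))

theorem errorOf_eq (H e : ℕ) : (errorOf H e : ℝ) = (2 ^ H : ℝ)⁻¹ * ((2 ^ e : ℝ)⁻¹) ^ 2 := by
  simp [errorOf, pow_add, mul_comm 2 e, pow_mul]
  ring

theorem errorOf_mul_le {H : ℕ} (e : ℕ) {T : ℝ} (x : ℝ) (h : T ≤ 2 ^ H * x ^ 2) :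
    (errorOf H e : ℝ) * T ≤ (x * (2 ^ e : ℝ)⁻¹) ^ 2 := by
  rw [errorOf_eq, mul_pow]
  have : (2 ^ H : ℝ)⁻¹ * T ≤ x ^ 2 := by
    rw [inv_mul_le_iff₀ (by positivity)]; exact h
  have h2 : 0 ≤ ((2 ^ e : ℝ)⁻¹) ^ 2 := by positivity
  nlinarith

theorem eval_of_literal_pos {n : ℕ} {c : Clause3 n} {v : Fin n → ℝ}
    (h : ∃ t, 0 < sgn (c t).2 * v (c t).1) {a : Fin n → Bool} (ha : ∀ i, a i = decide (0 ≤ v i)) :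
    Clause3.eval a c = true := by
  obtain ⟨t, ht⟩ := h
  rw [Clause3.eval, decide_eq_true_eq]
  refine ⟨t, ?_⟩
  rw [ha]
  cases hb : (c t).2
  · simp [sgn, hb] at ht; simpa using ht
  · simp [sgn, hb] at ht; simpa using ht.le

/-- Pinning the units must hold globally, and it does because the auxiliary samples are repeated
identically for every clause. After that, clauses can be treated one at a time, and the average loss
bounds the number of violated ones. -/
theorem exists_unit_rounding {k n e D : ℕ} {φ : CNF3 n} (hφ : φ ≠ [])
    {w : Fin (k + 2) → EuclideanSpace ℝ (Fin (n + (k + 2)))} (hw : BoundedWeights w)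
    (hloss : loss w (instanceOf (kinds (k + 2)) e φ).toReal ≤
      (errorOf (errorExp (k + 2) D) e : ℝ)) :
    ∃ l, ∀ a : Fin n → Bool, (∀ i, a i = decide (0 ≤ w l (Fin.castAdd (k + 2) i))) →
      φ.violated a * D ≤ φ.length := by
  set Ks := kinds (k + 2) with hKs
  set H := errorExp (k + 2) D with hH
  set u : Fin (k + 2) → Fin n → ℝ := fun l i => w l (Fin.castAdd (k + 2) i) with hu
  set p : Fin (k + 2) → Fin (k + 2) → ℝ := fun l j => w l (Fin.natAdd n j) with hp
  set C : ℝ := (2 ^ e : ℝ)⁻¹ with hC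
  have hC0 : 0 < C := by positivity
  have hC1 : C ≤ 1 := inv_le_one_of_one_le₀ (one_le_pow₀ (by norm_num))
  set b : ℝ := ((varScale (k + 2) : ℚ) : ℝ) with hb
  have hb0 : 0 < b := by simp [hb, varScale]
  have hM : (0 : ℝ) < φ.length := by exact_mod_cast List.length_pos_iff.2 hφ
  have hTpos : (0 : ℝ) < Ks.length := by
    have : clauseKind (k + 2) ∈ Ks := mem_kinds.2 (by simp)
    exact_mod_cast List.length_pos_of_mem this
  have hcoord : ∀ l i, |w l i| ≤ 1 := fun l i =>
    (PiLp.norm_apply_le (w l) i).trans (hw l)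
  have htot : (φ.map fun c => (Ks.map fun K => sampleError K e c u p ^ 2).sum).sum ≤
      φ.length * ((errorOf H e : ℝ) * Ks.length) := by
    rw [loss, sum_instanceOf, length_instanceOf, div_le_iff₀ (by push_cast; positivity)] at hloss
    push_cast at hloss
    linarith
  have hblock0 : ∀ c : Clause3 n, 0 ≤ (Ks.map fun K => sampleError K e c u p ^ 2).sum := by
    intro c
    refine List.sum_nonneg fun x hx => ?_
    obtain ⟨K, _, rfl⟩ := List.mem_map.1 hx
    positivity
  have hsingle : ∀ (c : Clause3 n), ∀ K ∈ Ks, sampleError K e c u p ^ 2 ≤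
      (Ks.map fun K => sampleError K e c u p ^ 2).sum := by
    intro c K hK
    refine List.single_le_sum (fun x hx => ?_) _ (List.mem_map.2 ⟨K, hK, rfl⟩)
    obtain ⟨K, _, rfl⟩ := List.mem_map.1 hx
    positivity
  -- the samples that do not depend on the clause
  have hk0 : (0 : ℝ) < 1600 * (k + 2 : ℕ) * ((k + 2 : ℕ) + 3) := by positivity
  -- Chosen so that `k * (k + 3) * η = C / 1600` with `k + 2` for `k`, the tolerance in
  -- `exists_literal_pos`.
  set η : ℝ := (1600 * ((k + 2 : ℕ) : ℝ) * (((k + 2 : ℕ) : ℝ) + 3))⁻¹ * C with hη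
  have hη0 : 0 < η := by positivity
  have h2H : (H : ℝ) ≤ 2 ^ H := by exact_mod_cast (Nat.lt_two_pow_self (n := H)).le
  have hHval : (H : ℝ) = Ks.length * (1600 * (k + 2 : ℕ) * ((k + 2 : ℕ) + 3)) ^ 2 +
      Ks.length * (D * 100 * 4 ^ (k + 2 + 4)) := by
    rw [hH, errorExp]; push_cast; ring
  have hεη : (errorOf H e : ℝ) * Ks.length ≤ η ^ 2 := by
    refine errorOf_mul_le e _ ?_
    rw [inv_pow, ← div_eq_mul_inv, le_div_iff₀ (by positivity)]
    have : (0 : ℝ) ≤ Ks.length * (D * 100 * 4 ^ (k + 2 + 4)) := by positivity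
    linarith
  -- An error that is the same in all blocks is bounded by the average itself; no fraction of
  -- exceptional clauses arises.
  have hglobal : ∀ K ∈ Ks, ∀ r : ℝ, (∀ c : Clause3 n, sampleError K e c u p = r) → |r| ≤ η := by
    intro K hK r hr
    refine abs_le_of_sq_le_sq ?_ hη0.le
    have a1 := countP_mul_le_sum (fun _ => true)
      (fun c => (Ks.map fun K => sampleError K e c u p ^ 2).sum) (r ^ 2) φ
      (fun c _ _ => by rw [← hr c]; exact hsingle c K hK) (fun c _ => hblock0 c)
    rw [List.countP_true] at a1
    exact (le_of_mul_le_mul_left (a1.trans htot) hM).trans hεη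
  have hcastk : (1 : ℝ) ≤ ((k + 2 : ℕ) : ℝ) := by push_cast; linarith [(k.cast_nonneg : (0 : ℝ) ≤ k)]
  have hkη : ((k + 2 : ℕ) : ℝ) * (((k + 2 : ℕ) + 3) * η) = C / 1600 := by
    rw [hη]; field_simp
  obtain ⟨σ, hoff, hdiag⟩ := exists_perm_of_aux (by omega) p hη0 (by rw [hkη]; linarith)
    (fun i => hglobal (posKind i) (mem_kinds.2 (by simp)) _ fun c => by
      simp only [sampleError, act_posKind]; simp [posKind, Scalar.val])
    (fun i => (le_abs_self _).trans (hglobal (negKind i) (mem_kinds.2 (by simp)) _ fun c => by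
      simp only [sampleError, act_negKind]; simp [negKind, Scalar.val]))
    (fun i i' h => by
      have := hglobal (diffKind i i') (mem_kinds.2 (by simp))
        (∑ l, rectifier ((p l i - p l i') / 2) - 1 / 4) fun c => by
          simp only [sampleError, act_diffKind]; simp [diffKind, Scalar.val, h]
      linarith [(abs_le.1 this).1])
  refine ⟨σ 0, fun a ha => ?_⟩
  -- the samples of a violated clause
  set τ : ℝ := b * C / 10 with hτ
  have hτ0 : 0 < τ := by positivity
  have hbad : ∀ c : Clause3 n, Clause3.eval a c = false →
      τ ^ 2 ≤ (Ks.map fun K => sampleError K e c u p ^ 2).sum := by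
    intro c hc
    by_contra! hlt
    have hle : ∀ K ∈ Ks, |sampleError K e c u p| ≤ τ := fun K hK =>
      abs_le_of_sq_le_sq ((hsingle c K hK).trans hlt.le) hτ0.le
    have := exists_literal_pos (κ := ((k + 2 : ℕ) + 3) * η) (by positivity) ⟨hoff, hdiag⟩
      (fun l i => hcoord l _) hkη.le
      (fun t => hle _ (mem_kinds.2 (by simp))) (fun t => hle _ (mem_kinds.2 (by simp)))
      (hle _ (mem_kinds.2 (by simp)))
    rw [eval_of_literal_pos this ha] at hc
    exact Bool.noConfusion hc
  have hcount := countP_mul_le_sum (fun c => !(Clause3.eval a c))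
      (fun c => (Ks.map fun K => sampleError K e c u p ^ 2).sum) (τ ^ 2) φ
      (fun c _ h => hbad c (by simpa using h)) (fun c _ => hblock0 c)
  have hετ : (errorOf H e : ℝ) * (Ks.length * D) ≤ τ ^ 2 := by
    rw [hτ, mul_div_right_comm]
    refine errorOf_mul_le e _ ?_
    have hb2 : b = (2 ^ (k + 2 + 4))⁻¹ := by simp [hb, varScale]
    have h4 : (4 : ℝ) ^ (k + 2 + 4) = (2 ^ (k + 2 + 4)) ^ 2 := by
      rw [← pow_mul, mul_comm, pow_mul]; norm_num
    rw [h4] at hHval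
    have : (0 : ℝ) ≤ Ks.length * (1600 * (k + 2 : ℕ) * ((k + 2 : ℕ) + 3)) ^ 2 := by positivity
    rw [hb2, div_pow, inv_pow, div_eq_mul_inv, ← mul_inv, ← div_eq_mul_inv,
      le_div_iff₀ (by positivity)]
    linarith
  have hviol : (φ.violated a : ℝ) * τ ^ 2 ≤ φ.length * ((errorOf H e : ℝ) * Ks.length) :=
    hcount.trans htot
  have hfin : ((φ.violated a : ℝ) * D) * τ ^ 2 ≤ φ.length * τ ^ 2 := by
    calc ((φ.violated a : ℝ) * D) * τ ^ 2 = ((φ.violated a : ℝ) * τ ^ 2) * D := by ring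
      _ ≤ (φ.length * ((errorOf H e : ℝ) * Ks.length)) * D :=
        mul_le_mul_of_nonneg_right hviol (by positivity)
      _ = φ.length * ((errorOf H e : ℝ) * (Ks.length * D)) := by ring
      _ ≤ φ.length * τ ^ 2 := mul_le_mul_of_nonneg_left hετ hM.le
  exact_mod_cast le_of_mul_le_mul_right hfin (by positivity)

/-! ### Completeness -/

/-- The coordinates of the network that encodes the assignment `a`. -/
noncomputable def codeVar {k n : ℕ} (e : ℕ) (a : Fin n → Bool) (l : Fin (k + 2)) (i : Fin n) : ℝ :=
  (if l = 0 then (2 ^ e : ℝ)⁻¹ else if l = 1 then -(2 ^ e : ℝ)⁻¹ else 0) * sgn (a i)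

noncomputable def codeAux {k : ℕ} (l j : Fin (k + 2)) : ℝ := if j = l then 1 / 2 else 0

theorem sgn_mul_sgn (x y : Bool) : sgn x * sgn y = if y = x then 1 else -1 := by
  cases x <;> cases y <;> simp [sgn]

/-- On a variable sample exactly one of the units `0`, `1` fires, with the value of the label. On
the clause sample no unit fires: for unit `0` this is the truth of the clause, for the others the
penalty `B / 2 = 8 * b` exceeds `3 * b * C`. -/
theorem sampleError_eq_zero {k n : ℕ} (e : ℕ) (a : Fin n → Bool) (c : Clause3 n)
    (hc : Clause3.eval a c = true) (K : Kind (k + 2)) (hK : K ∈ kinds (k + 2)) :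
    sampleError K e c (codeVar e a) codeAux = 0 := by
  set C : ℝ := (2 ^ e : ℝ)⁻¹ with hC
  have hC0 : 0 < C := by positivity
  have hC1 : C ≤ 1 := inv_le_one_of_one_le₀ (one_le_pow₀ (by norm_num))
  set b : ℝ := ((varScale (k + 2) : ℚ) : ℝ) with hb
  set B : ℝ := ((auxScale (k + 2) : ℚ) : ℝ) with hB
  have hb0 : 0 < b := by simp [hb, varScale]
  have hBb : B = 16 * b := by
    simp [hB, hb, auxScale, varScale, pow_add]
    ring
  have r1 : rectifier (1 / 2) = 1 / 2 := rectifier_of_nonneg (by norm_num)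
  have r0 : rectifier 0 = 0 := rectifier_of_nonneg le_rfl
  have hlit : ∀ t, sgn (c t).2 * sgn (a (c t).1) = 1 ∨ sgn (c t).2 * sgn (a (c t).1) = -1 := by
    intro t; rw [sgn_mul_sgn]; split_ifs <;> simp
  have hvar : ∀ t (z : ℤ), z = 1 ∨ z = -1 →
      sampleError (varKind (k + 2) t z) e c (codeVar e a) codeAux = 0 := by
    intro t z hz
    have hl : ((((varKind (k + 2) t z).label).val e : ℚ) : ℝ) = b * C := by
      simp [varKind, Scalar.val, hb, hC, varScale, pow_add]
      ring
    rw [sampleError, hl, Fin.sum_univ_succ, Fin.sum_univ_succ]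
    have hs : (0 : Fin (k + 1)).succ = (1 : Fin (k + 2)) := rfl
    have h2 : ∀ j : Fin k, rectifier (act (varKind (k + 2) t z) e c (codeVar e a j.succ.succ)
        (codeAux j.succ.succ)) = 0 := by
      intro j
      refine rectifier_of_nonpos ?_
      rw [act_varKind]
      have : ∑ i : Fin (k + 2), (if i.val < 2 then 0 else codeAux j.succ.succ i) = 1 / 2 := by
        rw [Finset.sum_eq_single j.succ.succ]
        · simp [codeAux]
        · intro i _ hi; simp [codeAux, hi]
        · simp
      rw [this]
      have h0 : codeVar e a j.succ.succ (c t).1 = 0 := by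
        rw [codeVar, if_neg (Fin.succ_ne_zero _), if_neg, zero_mul]
        rw [← hs]; exact fun h => Fin.succ_ne_zero j (Fin.succ_injective _ h)
      rw [h0]
      change b * (z * (sgn (c t).2 * 0)) - B * (1 / 2) ≤ 0
      rw [hBb]; linarith
    have haux : ∀ l : Fin (k + 2), l.val < 2 →
        ∑ i : Fin (k + 2), (if i.val < 2 then 0 else codeAux l i) = 0 := by
      intro l hl
      refine Finset.sum_eq_zero fun i _ => ?_
      split_ifs with h
      · rfl
      · rw [codeAux, if_neg]; rintro rfl; exact h hl
    simp only [h2, Finset.sum_const_zero, add_zero, hs]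
    rw [act_varKind, act_varKind, haux 0 (by simp), haux 1 (by simp)]
    have hx : (z : ℝ) * (sgn (c t).2 * sgn (a (c t).1)) = 1 ∨
        (z : ℝ) * (sgn (c t).2 * sgn (a (c t).1)) = -1 := by
      rcases hz with rfl | rfl <;> rcases hlit t with h | h <;> simp [h]
    have e0 : b * (z * (sgn (c t).2 * codeVar e a (0 : Fin (k + 2)) (c t).1)) - B * 0 =
        b * C * (z * (sgn (c t).2 * sgn (a (c t).1))) := by
      simp only [codeVar, if_true]; ring
    have e1 : b * (z * (sgn (c t).2 * codeVar e a (1 : Fin (k + 2)) (c t).1)) - B * 0 =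
        -(b * C * (z * (sgn (c t).2 * sgn (a (c t).1)))) := by
      simp only [codeVar, if_true, one_ne_zero, if_false]; ring
    change rectifier (b * (z * (sgn (c t).2 * codeVar e a (0 : Fin (k + 2)) (c t).1)) - B * 0) +
      rectifier (b * (z * (sgn (c t).2 * codeVar e a (1 : Fin (k + 2)) (c t).1)) - B * 0) -
        b * C = 0
    rw [e0, e1]
    have hbC : 0 < b * C := by positivity
    rcases hx with h | h <;> rw [h]
    · rw [rectifier_of_nonneg (by linarith), rectifier_of_nonpos (by linarith)]; ring
    · rw [rectifier_of_nonpos (by linarith), rectifier_of_nonneg (by linarith)]; ring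
  rcases mem_kinds.1 hK with ⟨i, rfl⟩ | ⟨i, rfl⟩ | ⟨i, i', rfl⟩ | ⟨t, rfl⟩ | ⟨t, rfl⟩ | rfl
  · simp only [sampleError, act_posKind, codeAux, apply_ite rectifier, r1, r0]
    simp [posKind, Scalar.val]
  · simp only [sampleError, act_negKind]
    rw [Finset.sum_eq_zero]
    · simp [negKind, Scalar.val]
    · intro l _
      refine rectifier_of_nonpos ?_
      unfold codeAux; split_ifs <;> norm_num
  · simp only [sampleError, act_diffKind]
    by_cases h : i = i'
    · subst h
      simp [r0, diffKind, Scalar.val]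
    · rw [Finset.sum_eq_single i]
      · rw [codeAux, codeAux, if_pos rfl, if_neg (Ne.symm h), rectifier_of_nonneg (by norm_num)]
        simp [diffKind, Scalar.val, h]
        norm_num
      · intro l _ hl
        refine rectifier_of_nonpos ?_
        rw [codeAux, codeAux, if_neg (Ne.symm hl)]
        split_ifs <;> norm_num
      · simp
  · exact hvar t 1 (Or.inl rfl)
  · exact hvar t (-1) (Or.inr rfl)
  · rw [sampleError, Finset.sum_eq_zero]
    · simp [clauseKind, Scalar.val]
    intro l _
    refine rectifier_of_nonpos ?_
    rw [act_clauseKind]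
    change -(b * ∑ t, sgn (c t).2 * codeVar e a l (c t).1) - 2 * b * C * codeAux l 0 -
      B * ∑ j : Fin (k + 1), codeAux l j.succ ≤ 0
    have hS3 : |∑ t, sgn (c t).2 * codeVar e a l (c t).1| ≤ 3 * C := by
      refine (Finset.abs_sum_le_sum_abs _ _).trans ?_
      have : ∀ t ∈ Finset.univ, |sgn (c t).2 * codeVar e a l (c t).1| ≤ C := by
        intro t _
        have : sgn (c t).2 * codeVar e a l (c t).1 =
            (if l = 0 then C else if l = 1 then -C else 0) *
              (sgn (c t).2 * sgn (a (c t).1)) := by rw [codeVar]; ring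
        rw [this, abs_mul]
        have h1 : |sgn (c t).2 * sgn (a (c t).1)| = 1 := by
          rcases hlit t with h | h <;> simp [h]
        rw [h1, mul_one]
        split_ifs <;> simp [abs_of_pos hC0, hC0.le]
      exact (Finset.sum_le_sum this).trans (by simp)
    rcases Fin.eq_zero_or_eq_succ l with rfl | ⟨l, rfl⟩
    · have h0 : ∑ j : Fin (k + 1), codeAux (0 : Fin (k + 2)) j.succ = 0 :=
        Finset.sum_eq_zero fun j _ => by simp [codeAux]
      rw [h0]
      -- One true literal contributes `C` and the other two at least `-2 * C`.
      have hS : -C ≤ ∑ t, sgn (c t).2 * codeVar e a (0 : Fin (k + 2)) (c t).1 := by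
        have : ∀ t, sgn (c t).2 * codeVar e a (0 : Fin (k + 2)) (c t).1 =
            C * (sgn (c t).2 * sgn (a (c t).1)) := by
          intro t; simp only [codeVar, if_true]; ring
        simp only [this, ← Finset.mul_sum]
        have hge : ∀ t, -1 ≤ sgn (c t).2 * sgn (a (c t).1) := by
          intro t; rcases hlit t with h | h <;> rw [h]; norm_num
        have g0 := hge 0
        have g1 := hge 1
        have g2 := hge 2
        obtain ⟨t, ht⟩ := by simpa [Clause3.eval] using hc
        have ht1 : sgn (c t).2 * sgn (a (c t).1) = 1 := by rw [sgn_mul_sgn, if_pos ht]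
        have : -1 ≤ ∑ t, sgn (c t).2 * sgn (a (c t).1) := by
          rw [Fin.sum_univ_three]
          fin_cases t <;> simp at ht1 <;> linarith
        nlinarith
      have : codeAux (0 : Fin (k + 2)) 0 = 1 / 2 := by simp [codeAux]
      rw [this]
      nlinarith
    · have h0 : ∑ j : Fin (k + 1), codeAux l.succ j.succ = 1 / 2 := by simp [codeAux]
      have h1 : codeAux l.succ 0 = 0 := by simp [codeAux, (Fin.succ_ne_zero l).symm]
      rw [h0, h1, hBb]
      have := (abs_le.1 hS3).1
      nlinarith

noncomputable def codeNet {k n : ℕ} (e : ℕ) (a : Fin n → Bool) (l : Fin (k + 2)) :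
    EuclideanSpace ℝ (Fin (n + (k + 2))) :=
  WithLp.toLp 2 (Fin.append (codeVar e a l) (codeAux l))

/-- The squared norm is at most `n / 4^e + 1/4`, and `n / 4^e` is below `1/3`. -/
theorem boundedWeights_codeNet {k n : ℕ} {e : ℕ} (hn : 3 * n < 4 ^ e) (a : Fin n → Bool) :
    BoundedWeights (codeNet (k := k) e a) := by
  intro l
  rw [← sq_le_one_iff₀ (norm_nonneg _), EuclideanSpace.real_norm_sq_eq, Fin.sum_univ_add]
  simp only [codeNet, Fin.append_left, Fin.append_right]
  have h1 : ∀ i, codeVar e a l i ^ 2 ≤ (4 ^ e : ℝ)⁻¹ := by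
    intro i
    have hs : sgn (a i) ^ 2 = 1 := by unfold sgn; split_ifs <;> norm_num
    have h4 : ((2 ^ e : ℝ)⁻¹) ^ 2 = (4 ^ e : ℝ)⁻¹ := by
      rw [inv_pow, ← pow_mul, mul_comm, pow_mul]; norm_num
    rw [codeVar, mul_pow, hs, mul_one]
    split_ifs
    · rw [h4]
    · rw [neg_sq, h4]
    · rw [zero_pow two_ne_zero]; positivity
  have h2 : ∑ i, codeVar e a l i ^ 2 ≤ 1 / 3 := by
    refine (Finset.sum_le_sum fun i _ => h1 i).trans ?_
    have : (3 * n : ℝ) < 4 ^ e := by exact_mod_cast hn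
    simp
    rw [← div_eq_mul_inv, div_le_iff₀ (by positivity)]
    linarith
  have h3 : ∑ j, codeAux l j ^ 2 = 1 / 4 := by
    simp [codeAux, ite_pow]
    norm_num
  linarith

theorem loss_codeNet {k n : ℕ} (e : ℕ) (a : Fin n → Bool) (φ : CNF3 n)
    (h : ∀ c ∈ φ, Clause3.eval a c = true) :
    loss (codeNet (k := k) e a) (instanceOf (kinds (k + 2)) e φ).toReal = 0 := by
  rw [loss, sum_instanceOf]
  have : (φ.map fun c => ((kinds (k + 2)).map fun K => sampleError K e c
      (fun l i => codeNet (k := k) e a l (Fin.castAdd (k + 2) i))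
      (fun l j => codeNet (k := k) e a l (Fin.natAdd n j)) ^ 2).sum).sum = 0 := by
    refine List.sum_eq_zero fun x hx => ?_
    obtain ⟨c, hc, rfl⟩ := List.mem_map.1 hx
    refine List.sum_eq_zero fun x hx => ?_
    obtain ⟨K, hK, rfl⟩ := List.mem_map.1 hx
    simp only [codeNet, Fin.append_left, Fin.append_right]
    have := sampleError_eq_zero e a c (h c hc) K hK
    rw [show (fun l i => codeVar e a l i) = codeVar (k := k) e a from rfl,
      show (fun l j => codeAux l j) = codeAux (k := k) from rfl, this]
    norm_num
  rw [this, zero_div]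

theorem realizable_of_satisfiable {k n e : ℕ} (hn : 3 * n < 4 ^ e) {φ : CNF3 n}
    (h : φ.Satisfiable) : Realizable (k + 2) (instanceOf (kinds (k + 2)) e φ).toReal := by
  obtain ⟨a, ha⟩ := h
  exact ⟨codeNet e a, boundedWeights_codeNet hn a, loss_codeNet e a φ ha⟩

/-! ### The samples are bounded -/

theorem sum_literalCoeff_sq {n : ℕ} (l : Literal n) (z : ℤ) :
    ∑ i : Fin n, (literalCoeff (l.1, l.2) z i : ℝ) ^ 2 = (z : ℝ) ^ 2 := by
  rw [Finset.sum_eq_single l.1]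
  · cases h : l.2 <;> simp [literalCoeff]
  · intro i _ hi
    have : ¬ ((l.1 : ℕ) = i) := fun h => hi (Fin.ext h.symm)
    simp [literalCoeff, this]
  · simp

/-- Two literals may share a coordinate; `(x + y + z)² ≤ 3 (x² + y² + z²)` covers this without
cases. -/
theorem norm_point_le_one {k n : ℕ} (K : Kind k) (e : ℕ) (c : Clause3 n)
    (h : 3 * (varScale k : ℝ) ^ 2 * ∑ t, (K.mult t : ℝ) ^ 2 +
      ∑ j, ((K.aux j).val e : ℝ) ^ 2 ≤ 1) : ‖toReal (K.point e c)‖ ≤ 1 := by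
  rw [← sq_le_one_iff₀ (norm_nonneg _), EuclideanSpace.real_norm_sq_eq, Fin.sum_univ_add]
  refine le_trans (add_le_add ?_ (le_of_eq ?_)) h
  · have : ∀ i : Fin n, toReal (K.point e c) (Fin.castAdd k i) ^ 2 ≤
        3 * (varScale k : ℝ) ^ 2 * ((literalCoeff ((c 0).1, (c 0).2) (K.mult 0) i : ℝ) ^ 2 +
          (literalCoeff ((c 1).1, (c 1).2) (K.mult 1) i : ℝ) ^ 2 +
          (literalCoeff ((c 2).1, (c 2).2) (K.mult 2) i : ℝ) ^ 2) := by
      intro i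
      simp only [toReal, Kind.point, clauseCoeff, Clause3.lits, Fin.append_left]
      push_cast
      have key : ∀ x y z b : ℝ, ((x + y + z) * b) ^ 2 ≤ 3 * b ^ 2 * (x ^ 2 + y ^ 2 + z ^ 2) := by
        intro x y z b
        nlinarith [mul_nonneg (sq_nonneg b) (sq_nonneg (x - y)),
          mul_nonneg (sq_nonneg b) (sq_nonneg (y - z)), mul_nonneg (sq_nonneg b) (sq_nonneg (x - z))]
      exact key _ _ _ _
    refine (Finset.sum_le_sum fun i _ => this i).trans (le_of_eq ?_)
    rw [← Finset.mul_sum, Finset.sum_add_distrib, Finset.sum_add_distrib, sum_literalCoeff_sq,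
      sum_literalCoeff_sq, sum_literalCoeff_sq, Fin.sum_univ_three]
  · simp [toReal, Kind.point]

theorem sum_single_sq (t : Fin 3) (z : ℤ) :
    ∑ t', ((Pi.single t z : Fin 3 → ℤ) t' : ℝ) ^ 2 = (z : ℝ) ^ 2 := by
  rw [Finset.sum_eq_single t]
  · simp
  · intro t' _ h; simp [h]
  · simp

theorem norm_point_kinds {k n : ℕ} {K : Kind (k + 2)} (hK : K ∈ kinds (k + 2)) (e : ℕ)
    (c : Clause3 n) : ‖toReal (K.point e c)‖ ≤ 1 := by
  apply norm_point_le_one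
  have hb : (varScale (k + 2) : ℝ) ^ 2 ≤ 1 / 36 := by
    have h1 : (varScale (k + 2) : ℝ) ≤ 1 / 64 := by
      simp only [varScale]
      push_cast
      rw [one_div]
      refine inv_anti₀ (by norm_num) ?_
      calc (64 : ℝ) = 2 ^ 6 := by norm_num
        _ ≤ 2 ^ (k + 2 + 4) := pow_le_pow_right₀ (by norm_num) (by omega)
    have h2 : (0 : ℝ) ≤ varScale (k + 2) := by simp [varScale]
    nlinarith
  have hB0 : (0 : ℝ) ≤ auxScale (k + 2) := by simp [auxScale]
  have hB : ∑ _j : Fin (k + 2), (auxScale (k + 2) : ℝ) ^ 2 ≤ 1 / 4 := by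
    have h1 : ((k + 2 : ℕ) : ℝ) * auxScale (k + 2) ≤ 1 := by
      simp only [auxScale]
      push_cast
      rw [← div_eq_mul_inv, div_le_one (by positivity)]
      exact_mod_cast (Nat.lt_two_pow_self (n := k + 2)).le
    have h2 : (auxScale (k + 2) : ℝ) ≤ 1 / 4 := by
      simp only [auxScale]
      push_cast
      rw [one_div]
      refine inv_anti₀ (by norm_num) ?_
      calc (4 : ℝ) = 2 ^ 2 := by norm_num
        _ ≤ 2 ^ (k + 2) := pow_le_pow_right₀ (by norm_num) (by omega)
    simp only [Finset.sum_const, Finset.card_univ, Fintype.card_fin, nsmul_eq_mul]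
    nlinarith
  rcases mem_kinds.1 hK with ⟨i, rfl⟩ | ⟨i, rfl⟩ | ⟨i, i', rfl⟩ | ⟨t, rfl⟩ | ⟨t, rfl⟩ | rfl
  · simp [posKind, Scalar.val, apply_ite (Rat.cast : ℚ → ℝ), ite_pow]
  · simp [negKind, Scalar.val, apply_ite (Rat.cast : ℚ → ℝ), ite_pow]
  · simp only [diffKind, Scalar.val, Pi.zero_apply, Int.cast_zero, ne_eq, OfNat.ofNat_ne_zero,
      not_false_eq_true, zero_pow, Finset.sum_const_zero, mul_zero, zero_add]
    have : ∀ j : Fin (k + 2), (((if j = i then 1 / 2 else 0) - (if j = i' then 1 / 2 else 0) : ℚ) :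
        ℝ) ^ 2 ≤ (if j = i then 1 / 2 else 0) + (if j = i' then 1 / 2 else 0) := by
      intro j
      split_ifs <;> norm_num
    refine (Finset.sum_le_sum fun j _ => this j).trans ?_
    rw [Finset.sum_add_distrib]
    simp
    norm_num
  · have : ∑ j, (((varKind (k + 2) t 1).aux j).val e : ℝ) ^ 2 ≤ 1 / 4 := by
      refine (Finset.sum_le_sum fun j _ => ?_).trans hB
      simp only [varKind, Scalar.val]
      split_ifs
      · simpa using sq_nonneg _
      · simp
    change 3 * (varScale (k + 2) : ℝ) ^ 2 * (∑ t', ((Pi.single t 1 : Fin 3 → ℤ) t' : ℝ) ^ 2) + _ ≤ 1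
    rw [sum_single_sq, Int.cast_one]; linarith
  · have : ∑ j, (((varKind (k + 2) t (-1)).aux j).val e : ℝ) ^ 2 ≤ 1 / 4 := by
      refine (Finset.sum_le_sum fun j _ => ?_).trans hB
      simp only [varKind, Scalar.val]
      split_ifs
      · simpa using sq_nonneg _
      · simp
    change 3 * (varScale (k + 2) : ℝ) ^ 2 *
      (∑ t', ((Pi.single t (-1) : Fin 3 → ℤ) t' : ℝ) ^ 2) + _ ≤ 1
    rw [sum_single_sq, Int.cast_neg, Int.cast_one, neg_sq]; linarith
  · have : ∑ j, (((clauseKind (k + 2)).aux j).val e : ℝ) ^ 2 ≤ 1 / 4 := by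
      refine (Finset.sum_le_sum fun j _ => ?_).trans hB
      simp only [clauseKind]
      split_ifs
      · simp only [Scalar.val, auxScale]
        push_cast
        rw [neg_sq]
        refine pow_le_pow_left₀ (by positivity) (inv_anti₀ (by positivity) ?_) 2
        exact pow_le_pow_right₀ (by norm_num) (by omega)
      · simp [Scalar.val]
    have h3 : ∑ t, ((clauseKind (k + 2)).mult t : ℝ) ^ 2 = 3 := by simp [clauseKind]
    rw [h3]
    linarith

theorem label_kinds {k : ℕ} {K : Kind k} (hK : K ∈ kinds k) (e : ℕ) :
    0 ≤ (K.label.val e : ℝ) ∧ (K.label.val e : ℝ) ≤ 1 := by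
  rcases mem_kinds.1 hK with ⟨i, rfl⟩ | ⟨i, rfl⟩ | ⟨i, i', rfl⟩ | ⟨t, rfl⟩ | ⟨t, rfl⟩ | rfl
  · simp [posKind, Scalar.val]; norm_num
  · simp [negKind, Scalar.val]
  · simp only [diffKind, Scalar.val]; split_ifs <;> norm_num
  · simp [varKind, Scalar.val]
    exact inv_le_one_of_one_le₀ (one_le_pow₀ (by norm_num))
  · simp [varKind, Scalar.val]
    exact inv_le_one_of_one_le₀ (one_le_pow₀ (by norm_num))
  · simp [clauseKind, Scalar.val]

theorem boundedSamples_instanceOf {k n : ℕ} (e : ℕ) (φ : CNF3 n) :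
    BoundedSamples (k + 2) (instanceOf (kinds (k + 2)) e φ).toReal := by
  intro z hz
  rw [RatSamples.toReal, List.mem_map] at hz
  obtain ⟨z, hz, rfl⟩ := hz
  rw [instanceOf, List.mem_flatMap] at hz
  obtain ⟨c, _, hz⟩ := hz
  obtain ⟨K, hK, rfl⟩ := List.mem_map.1 hz
  have h := label_kinds hK e
  refine ⟨norm_point_kinds hK e c, ?_, ?_⟩
  · have : (0 : ℝ) ≤ ((k + 2 : ℕ) : ℝ) := by positivity
    exact le_trans (by linarith) h.1
  · refine h.2.trans ?_
    exact_mod_cast (by omega : 1 ≤ k + 2)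

theorem instanceOf_ne_nil {k n : ℕ} (e : ℕ) {φ : CNF3 n} (hφ : φ ≠ []) :
    instanceOf (kinds k) e φ ≠ [] := by
  obtain ⟨c, φ', rfl⟩ := List.exists_cons_of_ne_nil hφ
  have h : (clauseKind k).sample e c ∈ instanceOf (kinds k) e (c :: φ') :=
    List.mem_flatMap.2 ⟨c, List.mem_cons_self, List.mem_map.2 ⟨_, mem_kinds.2 (by simp), rfl⟩⟩
  exact List.ne_nil_of_mem h

/-! ### The reduction -/

/-- Decides the gap problem, given a program `A` for the training problem. -/
def reduction (k D : ℕ) (A : Prog) : Prog :=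
  .seq (takeUnary 0 2 11) (.seq (.pop 2) (.seq
    (.branch 0 .skip (.seq (.pop 0) (.push 18 true))
      (.seq (copy 0 1 12) (.seq (writeInstance (kinds k) (errorExp k D))
        (.seq (A.shift 20) (decode D k)))))
    (.branch 18 (.push 0 false) (.push 0 true) (.push 0 true))))

theorem reach_finish {s : Store} (h0 : s 0 = []) : ∃ s', Reach (.branch 18 (.push 0 false)
    (.push 0 true) (.push 0 true)) s 2 s' ∧ s' 0 = [decide (s 18 ≠ [])] := by
  rcases h : s 18 with _ | ⟨_ | _, l⟩
  · exact ⟨_, Reach.branch_nil h (Reach.push 0 false s), by simp [h0]⟩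
  · exact ⟨_, Reach.branch_false h (Reach.push 0 true s), by simp [h0]⟩
  · exact ⟨_, Reach.branch_true h (Reach.push 0 true s), by simp [h0]⟩

theorem reach_start {n : ℕ} (φ : CNF3 n) : Reach (.seq (takeUnary 0 2 11) (.pop 2))
    (initStore (encCNF3 φ)) (4 * n + 8)
    (update (update (fun _ => []) 0 (encList encClause φ)) 2 (List.replicate n true)) := by
  have h : initStore (encCNF3 φ) 0 = List.replicate n true ++ false :: encList encClause φ := by
    simp [initStore, encCNF3, encUnary]
    rfl
  refine (((reach_takeUnary (w := 0) (j := 2) (f := 11) (by decide) (by decide) (by decide)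
    (by simp [initStore]) h).seq (Reach.pop 2 _)).mono (by omega)).of_eq ?_
  simp [initStore]

theorem length_encList_ge {α : Type} (f : α → List Bool) (l : List α) :
    l.length + 1 ≤ (encList f l).length := by
  induction l with
  | nil => simp [encList]
  | cons a l ih => simp [encList] at ih ⊢; omega

theorem length_encCNF3 {n : ℕ} (φ : CNF3 n) :
    (encCNF3 φ).length = n + 1 + (encList encClause φ).length := by
  change (encUnary n ++ encList encClause φ).length = _
  simp [encUnary]
  omega

theorem reduction_nil {k D n : ℕ} (A : Prog) : ∃ s', Reach (reduction k D A)
    (initStore (encCNF3 ([] : CNF3 n))) (4 * n + 13) s' ∧ s' 0 = [true] := by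
  have h1 := reach_start ([] : CNF3 n)
  set s1 := update (update (fun _ => []) 0 (encList encClause ([] : CNF3 n))) 2
    (List.replicate n true) with hs1
  have h10 : s1 0 = [false] := by simp [s1, encList]
  have h2 := Reach.branch_false (p := .skip) (q₁ := (.seq (copy 0 1 12)
    (.seq (writeInstance (kinds k) (errorExp k D)) (.seq (A.shift 20) (decode D k))))) h10
    ((Reach.pop 0 s1).seq (Reach.push 18 true _))
  obtain ⟨s', h3, h4⟩ := reach_finish
    (s := update (update s1 0 (s1 0).tail) 18 (true :: update s1 0 (s1 0).tail 18)) (by simp [h10])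
  obtain ⟨t, ht, hr⟩ := h1
  -- The run of the first two instructions is split because `reduction` nests its sequence to the
  -- right.
  cases hr with
  | seq hr1 hr2 =>
    refine ⟨s', ?_, by simpa using h4⟩
    exact ((Reach.seq ⟨_, le_rfl, hr1⟩ (Reach.seq ⟨_, le_rfl, hr2⟩ (h2.seq h3)))).mono (by omega)

/-- Nothing is assumed about `A` beyond one halting run: its time `t` enters the bound, and its
output is only decoded and tested. The constant does not depend on `A`. -/
theorem reduction_cons (k D : ℕ) : ∃ C : ℕ, ∀ (A : Prog) (n : ℕ) (φ : CNF3 n) (t : ℕ) (sA : Store),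
    φ ≠ [] →
    Run A (initStore (encInstance (instanceOf (kinds k) (halfLog n) φ)
      (errorOf (errorExp k D) (halfLog n)))) t sA →
    (encInstance (instanceOf (kinds k) (halfLog n) φ)
      (errorOf (errorExp k D) (halfLog n))).length ≤ C * (encCNF3 φ).length ^ 3 ∧
    ∃ s', Reach (reduction k D A) (initStore (encCNF3 φ)) (C * ((encCNF3 φ).length ^ 3 + t) ^ 2) s' ∧
      s' 0 = [decide (∃ bits ∈ signVectors k (sA 0), Passes D φ bits)] := by
  obtain ⟨C, hC⟩ := reach_writeInstance (kinds k) (errorExp k D)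
  refine ⟨C + 40 + k * ((91 + 2 * D) * (C + D + 12) ^ 2 + 1), fun A n φ t sA hφ hA => ?_⟩
  set L := (encCNF3 φ).length with hL
  have hLn : n + 1 + (encList encClause φ).length = L := (length_encCNF3 φ).symm
  have hLM : φ.length + 1 ≤ (encList encClause φ).length := length_encList_ge _ _
  have h1 := reach_start φ
  set s1 := update (update (fun _ => []) 0 (encList encClause φ)) 2 (List.replicate n true) with hs1
  obtain ⟨l, hl⟩ : ∃ l, s1 0 = true :: l := by
    obtain ⟨c, φ', rfl⟩ := List.exists_cons_of_ne_nil hφ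
    exact ⟨_, by simp [s1, encList]; rfl⟩
  have h2 := reach_copy (a := 0) (b := 1) (x := 12) (s := s1) (by decide) (by decide) (by decide)
    (by simp [s1]) (by simp [s1])
  set s2 := update s1 1 (s1 0) with hs2
  set x := encInstance (instanceOf (kinds k) (halfLog n) φ)
    (errorOf (errorExp k D) (halfLog n)) with hx
  have h3 := hC n φ s2 (by simp [s2, s1]) (by simp [s2, s1]) (fun r hr => by
    rw [hs2, hs1, update_of_ne (by omega), update_of_ne (by omega), update_of_ne (by omega)])
  rw [← hx] at h3
  set s3 := update (update (update s2 0 []) 3 (List.replicate (halfLog n) true)) 20 x with hs3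
  have hCL : C * (n + 1) ^ 2 * (φ.length + 1) ≤ C * L ^ 3 := by
    rw [pow_succ L 2, ← mul_assoc]
    exact Nat.mul_le_mul (Nat.mul_le_mul_left _ (Nat.pow_le_pow_left (by omega) 2)) (by omega)
  have hxlen : x.length ≤ C * L ^ 3 := by
    have := h3.length_le 20
    simp [s3, s2, s1] at this
    omega
  refine ⟨hxlen.trans (Nat.mul_le_mul_right _ (by omega)), ?_⟩
  -- From register `20` on, the store holds only the instance, so it is an initial store for the
  -- shifted `A`.
  have hjoin : joinStore 20 s3 (initStore x) = s3 := by
    funext r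
    by_cases hr : r < 20
    · simp [joinStore, hr]
    · by_cases h20 : r = 20
      · subst h20; simp [joinStore, initStore, s3]
      · have : r - 20 ≠ 0 := by omega
        simp only [joinStore, hr, if_false, initStore, update_of_ne this]
        rw [hs3, update_of_ne h20, update_of_ne (by omega), update_of_ne (by omega), hs2,
          update_of_ne (by omega), hs1, update_of_ne (by omega), update_of_ne (by omega)]
  have h4 : Reach (A.shift 20) s3 t (joinStore 20 s3 sA) :=
    ⟨t, le_rfl, by simpa [hjoin] using hA.shift 20 s3⟩
  set s4 := joinStore 20 s3 sA with hs4
  have hlow : ∀ r, r < 20 → s4 r = s3 r := fun r hr => by simp [s4, joinStore, hr]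
  have h20 : s4 20 = sA 0 := by simp [s4, joinStore]
  have hylen : (sA 0).length ≤ C * L ^ 3 + t := by
    have := hA.length_le 0
    simp [initStore] at this
    omega
  have hready : EvalReady s4 := by
    intro r hr
    simp only [List.mem_cons, List.not_mem_nil, or_false] at hr
    rw [hlow r (by omega), hs3, update_of_ne (by omega), update_of_ne (by omega)]
    by_cases hr0 : r = 0
    · subst hr0; simp
    · rw [update_of_ne hr0, hs2, update_of_ne (by omega), hs1, update_of_ne (by omega),
        update_of_ne hr0]
  have e1 : s4 1 = encList encClause φ := by rw [hlow 1 (by decide)]; simp [s3, s2, s1]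
  have e14 : s4 14 = [] := by rw [hlow 14 (by decide)]; simp [s3, s2, s1]
  have e18 : s4 18 = [] := by rw [hlow 18 (by decide)]; simp [s3, s2, s1]
  have hL3 : L ≤ L ^ 3 := Nat.le_self_pow (by decide) _
  have hL1 : 1 ≤ L ^ 3 := by omega
  set Y := L ^ 3 + t with hY
  have hY1 : 1 ≤ Y := by omega
  obtain ⟨s5, h5, h50, h518⟩ := reach_decode D φ ((C + D + 12) * Y) k (s := s4) hready e14 e1
    (by
      rw [e1, h20]
      have a1 : C * L ^ 3 + t ≤ C * Y + Y := by
        have := Nat.mul_le_mul_left C (show L ^ 3 ≤ Y by omega)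
        omega
      have a2 : D ≤ D * Y := Nat.le_mul_of_pos_right _ hY1
      have a3 : (C + D + 12) * Y = C * Y + D * Y + 12 * Y := by ring
      omega)
    (by
      have : 12 * Y ≤ (C + D + 12) * Y := Nat.mul_le_mul_right _ (by omega)
      omega)
  obtain ⟨s6, h6, h60⟩ := reach_finish h50
  obtain ⟨t1, ht1, hr⟩ := h1
  cases hr with
  | seq hr1 hr2 =>
    refine ⟨s6, (Reach.seq ⟨_, le_rfl, hr1⟩ (Reach.seq ⟨_, le_rfl, hr2⟩
      ((Reach.branch_true hl (h2.seq (h3.seq (h4.seq h5)))).seq h6))).mono ?_, ?_⟩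
    · have a0 : (s1 0).length = (encList encClause φ).length := by simp [s1]
      rw [a0]
      have a1 : Y ≤ Y ^ 2 := Nat.le_self_pow (by decide) _
      have a2 : C * L ^ 3 ≤ C * Y ^ 2 := Nat.mul_le_mul_left _ (by omega)
      have a3 : (C + 40 + k * ((91 + 2 * D) * (C + D + 12) ^ 2 + 1)) * Y ^ 2 =
          C * Y ^ 2 + 40 * Y ^ 2 + (k * ((91 + 2 * D) * ((C + D + 12) * Y) ^ 2) + k * Y ^ 2) := by
        ring
      have a4 : k ≤ k * Y ^ 2 := Nat.le_mul_of_pos_right _ (by omega)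
      have a5 : ∀ Z : ℕ, k * (Z + 1) = k * Z + k := fun Z => by ring
      rw [a3, a5]
      omega
    · rw [h60]
      simp only [h518, e18, h20, ne_eq, not_true_eq_false, false_or]

/-! ### Correctness on satisfiable formulas. -/

theorem truth_ofFn {N : ℕ} (v : Fin N → ℚ) (i : Fin N) :
    truth (List.ofFn fun i => decide (v i < 0)) i = decide (0 ≤ (v i : ℝ)) := by
  have : ((List.ofFn fun i => decide (v i < 0)).getD i false) = decide (v i < 0) := by
    simp [List.getD]
  rw [truth, this, ← decide_not]
  simp

/-- A solution of the training instance of a satisfiable formula contains a good assignment. -/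
theorem exists_passes {k n D e : ℕ} (hn : 3 * n < 4 ^ e) {φ : CNF3 n} (hφ : φ ≠ [])
    (hsat : φ.Satisfiable) {w : Fin (k + 2) → Fin (n + (k + 2)) → ℚ}
    (hw : IsSolution (instanceOf (kinds (k + 2)) e φ).toReal
      ((errorOf (errorExp (k + 2) D) e : ℚ) : ℝ) fun j => toReal (w j)) :
    ∃ bits ∈ signVectors (k + 2) (encWeights w), Passes D φ bits := by
  obtain ⟨v, hv, hv0⟩ := realizable_of_satisfiable (k := k) hn hsat
  obtain ⟨l, hl⟩ := exists_unit_rounding hφ hw.1 (by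
    have := hw.2 v hv
    rwa [hv0, zero_add] at this)
  rw [signVectors_encWeights]
  refine ⟨_, (List.mem_ofFn' _ _).2 ⟨l, rfl⟩, hl _ fun i => ?_⟩
  exact truth_ofFn (w l) (Fin.castAdd (k + 2) i)

/-! ### Asymptotics of the error parameter and of the running time. -/

theorem errorOf_pos (H e : ℕ) : 0 < errorOf H e := by unfold errorOf; positivity

theorem one_div_errorOf (H e : ℕ) : 1 / (errorOf H e : ℝ) = 2 ^ H * 4 ^ e := by
  rw [errorOf]
  push_cast
  rw [one_div, inv_inv, pow_add, pow_mul]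
  norm_num

open Filter Asymptotics in
theorem tendsto_errorOf (H : ℕ) : Tendsto (fun n : ℕ => (errorOf H (halfLog n) : ℝ)) atTop
    (nhdsWithin 0 (Set.Ioi 0)) := by
  refine tendsto_nhdsWithin_iff.2 ⟨?_, .of_forall fun n => ?_⟩
  · refine squeeze_zero (fun n => by exact_mod_cast (errorOf_pos H _).le) (fun n => ?_)
      (tendsto_one_div_add_atTop_nhds_zero_nat (𝕜 := ℝ))
    rw [← one_div_one_div (errorOf H (halfLog n) : ℝ), one_div_errorOf]
    refine one_div_le_one_div_of_le (by positivity) ?_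
    have h1 : (3 * n + 1 : ℝ) ≤ 4 ^ halfLog n := by exact_mod_cast lt_four_pow_halfLog n
    have h2 : (1 : ℝ) ≤ 2 ^ H := one_le_pow₀ (by norm_num)
    have h3 : (0 : ℝ) ≤ n := n.cast_nonneg
    nlinarith
  · have := errorOf_pos H (halfLog n)
    simpa using this

open Filter Asymptotics in
theorem isLittleO_exponent {g : ℝ → ℝ}
    (hg : IsLittleO (nhdsWithin (0 : ℝ) (Set.Ioi 0)) g fun ε : ℝ => 1 / ε) (H : ℕ) :
    IsLittleO atTop (fun n : ℕ => 2 * max (g (errorOf H (halfLog n))) 0) fun n : ℕ => (n : ℝ) := by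
  have h1 := hg.comp_tendsto (tendsto_errorOf H)
  have h2 : IsBigO atTop ((fun ε : ℝ => 1 / ε) ∘ fun n : ℕ => (errorOf H (halfLog n) : ℝ))
      fun n : ℕ => (n : ℝ) := by
    refine IsBigO.of_bound (2 ^ H * 12) ?_
    filter_upwards [eventually_ne_atTop 0] with n hn
    have h3 : (4 ^ halfLog n : ℝ) ≤ 12 * n := by exact_mod_cast four_pow_halfLog_le hn
    simp only [comp_apply]
    rw [one_div_errorOf, Real.norm_of_nonneg (by positivity), Real.norm_of_nonneg (by positivity),
      mul_assoc]
    exact mul_le_mul_of_nonneg_left h3 (by positivity)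
  refine IsLittleO.const_mul_left (IsBigO.trans_isLittleO ?_ (h1.trans_isBigO h2)) 2
  refine IsBigO.of_bound 1 (.of_forall fun n => ?_)
  rw [one_mul, Real.norm_of_nonneg (le_max_right _ _)]
  exact max_le (le_abs_self _) (norm_nonneg _)

theorem eval_mono {P : Polynomial ℕ} {a b : ℕ} (h : a ≤ b) : P.eval a ≤ P.eval b := by
  rw [Polynomial.eval_eq_sum_range, Polynomial.eval_eq_sum_range]
  exact Finset.sum_le_sum fun i _ => Nat.mul_le_mul_left _ (Nat.pow_le_pow_left h i)

/-- Postprocessing is quadratic in the time of `A`, which doubles the exponent. Replacing `x` by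
`max x 0` makes the factor at least `1`, so that it also covers the additive `L`. -/
theorem le_two_rpow_mul_sq {C L Q t : ℕ} {x : ℝ} (ht : (t : ℝ) ≤ 2 ^ x * (Q : ℝ)) :
    ((C * (L + t) ^ 2 : ℕ) : ℝ) ≤ 2 ^ (2 * max x 0) * ((C * (L + Q) ^ 2 : ℕ) : ℝ) := by
  set R : ℝ := 2 ^ max x 0 with hR
  have hR1 : 1 ≤ R := Real.one_le_rpow (by norm_num) (le_max_right _ _)
  have hxR : (2 : ℝ) ^ x ≤ R := Real.rpow_le_rpow_of_exponent_le (by norm_num) (le_max_left _ _)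
  have hRR : (2 : ℝ) ^ (2 * max x 0) = R ^ 2 := by
    rw [hR, mul_comm, Real.rpow_mul (by norm_num)]
    norm_num
  have h1 : (L + t : ℝ) ≤ R * (L + Q) := by
    have a1 : (2 : ℝ) ^ x * Q ≤ R * Q := mul_le_mul_of_nonneg_right hxR (by positivity)
    have a2 : (L : ℝ) ≤ R * L := le_mul_of_one_le_left (by positivity) hR1
    linarith
  rw [hRR]
  push_cast
  calc (C : ℝ) * (L + t) ^ 2 ≤ C * (R * (L + Q)) ^ 2 := by gcongr
    _ = R ^ 2 * (C * (L + Q) ^ 2) := by ring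

/-- The reduction turns a training algorithm into an algorithm for the gap problem. -/
theorem exists_gap_algorithm {k : ℕ} (hk : 2 ≤ k) {A : Prog} {g : ℝ → ℝ} {P : Polynomial ℕ}
    (hA : SolvesRealizable k A g P) {δ : ℝ} {D : ℕ} (hD : 1 ≤ δ * D) :
    ∃ Q : Polynomial ℕ, ∀ (n : ℕ) (φ : CNF3 n), ∃ b : Bool,
      (reduction k D A).OutputsWithin (encCNF3 φ) [b]
        ((2 : ℝ) ^ (2 * max (g (errorOf (errorExp k D) (halfLog n))) 0) *
          ((Q.eval (encCNF3 φ).length : ℕ) : ℝ)) ∧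
      (CNF3.Satisfiable φ → b = true) ∧
      ((∀ a : Fin n → Bool, δ * (φ.length : ℝ) < (CNF3.violated φ a : ℝ)) → b = false) := by
  obtain ⟨k, rfl⟩ : ∃ k', k = k' + 2 := ⟨k - 2, by omega⟩
  obtain ⟨C, hC⟩ := reduction_cons (k + 2) D
  open Polynomial in
  -- `C * X ^ 3` bounds the length of the instance; the summand `13` covers the empty formula.
  refine ⟨Polynomial.C (C + 13) * (X ^ 3 + P.comp (Polynomial.C C * X ^ 3)) ^ 2, fun n φ => ?_⟩
  set H := errorExp (k + 2) D with hH
  set e := halfLog n with he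
  set L := (encCNF3 φ).length with hL
  have hQ : (Polynomial.C (C + 13) * (Polynomial.X ^ 3 +
      P.comp (Polynomial.C C * Polynomial.X ^ 3)) ^ 2).eval L =
      (C + 13) * (L ^ 3 + P.eval (C * L ^ 3)) ^ 2 := by
    simp
  rw [hQ]
  have hLn : n + 1 + (encList encClause φ).length = L := (length_encCNF3 φ).symm
  -- The empty formula would yield an empty list of samples, which is not an instance; it is
  -- answered directly.
  by_cases hφ : φ = []
  · subst hφ
    refine ⟨true, ?_, fun _ => rfl, fun h => ?_⟩
    · obtain ⟨s', ⟨t, ht, hr⟩, h0⟩ := reduction_nil (k := k + 2) (D := D) (n := n) A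
      refine ⟨t, s', hr, ?_, h0⟩
      have h1 : (1 : ℝ) ≤ 2 ^ (2 * max (g (errorOf H e)) 0) :=
        Real.one_le_rpow (by norm_num) (by positivity)
      have h2 : t ≤ (C + 13) * (L ^ 3 + P.eval (C * L ^ 3)) ^ 2 := by
        have b1 : L ≤ L ^ 3 := Nat.le_self_pow (by decide) _
        have b2 : L ^ 3 + P.eval (C * L ^ 3) ≤ (L ^ 3 + P.eval (C * L ^ 3)) ^ 2 :=
          Nat.le_self_pow (by decide) _
        have b3 : 13 * (L ^ 3 + P.eval (C * L ^ 3)) ^ 2 ≤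
            (C + 13) * (L ^ 3 + P.eval (C * L ^ 3)) ^ 2 := Nat.mul_le_mul_right _ (by omega)
        omega
      calc (t : ℝ) ≤ (((C + 13) * (L ^ 3 + P.eval (C * L ^ 3)) ^ 2 : ℕ) : ℝ) := by
            exact_mod_cast h2
        _ ≤ _ := le_mul_of_one_le_left (by positivity) h1
    · have := h fun _ => true
      simp [CNF3.violated] at this
  obtain ⟨y, ⟨t, sA, hrun, ht, hy⟩, hsol⟩ := hA (n + (k + 2)) (instanceOf (kinds (k + 2)) e φ)
    (errorOf H e) (instanceOf_ne_nil e hφ) (errorOf_pos H e) (boundedSamples_instanceOf e φ)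
  obtain ⟨hlen, s', ⟨T, hT, hr⟩, h0⟩ := hC A n φ t sA hφ hrun
  refine ⟨_, ⟨T, s', hr, ?_, h0⟩, fun hsat => ?_, fun hviol => ?_⟩
  · have ht' : (t : ℝ) ≤ 2 ^ (g (errorOf H e)) * ((P.eval (C * L ^ 3) : ℕ) : ℝ) :=
      ht.trans (mul_le_mul_of_nonneg_left (by exact_mod_cast eval_mono hlen) (by positivity))
    have hT' : T ≤ (C + 13) * (L ^ 3 + t) ^ 2 := hT.trans (Nat.mul_le_mul_right _ (by omega))
    exact (Nat.cast_le.2 hT').trans (le_two_rpow_mul_sq ht')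
  · obtain ⟨w, hw, hsolw⟩ := hsol (realizable_of_satisfiable (lt_four_pow_halfLog n) hsat)
    rw [decide_eq_true_eq, hy, hw]
    exact exists_passes (lt_four_pow_halfLog n) hφ hsat hsolw
  -- No property of the output of `A` is needed: a passing assignment violates at most a `1/D`
  -- fraction of the clauses, and `1/D ≤ δ`.
  · rw [decide_eq_false_iff_not]
    rintro ⟨bits, -, hp⟩
    have h1 := hviol fun i => truth bits i
    have h2 : (φ.violated (fun i => truth bits i) : ℝ) * D ≤ φ.length := by exact_mod_cast hp
    set V : ℝ := (φ.violated (fun i => truth bits i) : ℝ) with hV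
    have hV0 : 0 ≤ V := by positivity
    have hδ : 0 < δ := by
      by_contra! h
      have : δ * D ≤ 0 := mul_nonpos_of_nonpos_of_nonneg h (by positivity)
      linarith
    nlinarith

end ReLUTraining

theorem mainTheorem8 (hGapETH : ReLUTraining.GapETH) (k : ℕ) (hk : 2 ≤ k) :
    ¬ ∃ (A : ReLUTraining.Prog) (g : ℝ → ℝ) (P : Polynomial ℕ),
      Asymptotics.IsLittleO (nhdsWithin (0 : ℝ) (Set.Ioi 0)) g (fun ε : ℝ => 1 / ε) ∧
      ReLUTraining.SolvesRealizable k A g P := by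
  rintro ⟨A, g, P, hg, hA⟩
  obtain ⟨δ, hδ, hno⟩ := hGapETH
  obtain ⟨D, hD⟩ := exists_nat_ge (1 / δ)
  have hD' : 1 ≤ δ * D := by rwa [div_le_iff₀' hδ] at hD
  obtain ⟨Q, hQ⟩ := ReLUTraining.exists_gap_algorithm hk hA hD'
  exact hno ⟨ReLUTraining.reduction k D A, _, Q, ReLUTraining.isLittleO_exponent hg _, hQ⟩
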